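/- **Setting.** Let $X\subset\mathbb R^n$, $Y\subset\mathbb R^m$ be compact and convex, let $X^+=\{x:\operatorname{dist}(x,X)\le \operatorname{diam}X\}$, and let $F$ have gradient $\nabla F=(\nabla_xF,\nabla_yF)$ on $X^+\times Y$, which is $L$-Lipschitz there in the Euclidean norm. Let $F$ be convex in $x\in X$ for each $y\in Y$ (that is, $\mu_p=0$), and $\mu_d$-strongly concave in $y\in Y$ for each $x\in X$, with $0<\mu_d\le L$ (the second inequality is automatic if $Y$ has more than one point). Put $f(x)=\max_{y\in Y}F(x,y)$, let $x^*$ be a minimizer of $f$ over $X$, let $D_Y=\operatorname{diam}Y$, and write $\log_+t=\max\{0,\log t\}$ (with $\log_+0=0$; also $\log 0$ is read as $0$ below, which only matters when $Y$ is a single point; and $0/0=0$). A stochastic first-order oracle (SFO) returns at $z\in X^+\times Y$ a vector $\nabla F(z;\xi)$, jointly measurable in $(z,\xi)$, with $\mathbb E_\xi\nabla F(z;\xi)=\nabla F(z)$ and $\mathbb E_\xi\|\nabla F(z;\xi)-\nabla F(z)\|^2\le\sigma^2$, where $\sigma>0$; different calls use independent identically distributed samples $\xi$. **SREG**$(\psi)$,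 for $\psi$ that is $\mu_X$-strongly convex in $x$ and $\mu_Y$-strongly concave in $y$, with stepsize $\eta$, $T$ steps and starting point $z_0$: with $G(z,\xi)=(\nabla_x\psi(z;\xi),-\nabla_y\psi(z;\xi))$, for $t=0,\dots,T-1$ take fresh samples $\xi_t,\hat\xi_t$ and put $$\hat z_t=\operatorname*{argmin}_{z\in X\times Y}\ \eta\langle G(z_t,\xi_t),z\rangle+\tfrac12\|z-z_t\|^2,$$ $$z_{t+1}=\operatorname*{argmin}_{z\in X\times Y}\ \eta\big[\langle G(\hat z_t,\hat\xi_t),z\rangle+\tfrac{\mu_X}2\|x-\hat x_t\|^2+\tfrac{\mu_Y}2\|y-\hat y_t\|^2\big]+\tfrac12\|z-z_t\|^2 .$$ The output is $(\bar z_T,z_T)$, where $\bar z_T$ is the average of $\hat z_0,\dots,\hat z_{T-1}$ with weights proportional to $\eta(1+\mu_X\eta)^t$. **Catalyst-Minimax(SREG).** Start at $z_0=(x_0,y_0)\in X\times Y$ with $\bar x_0=\tilde x_0=x_0$. For $k=1,\dots,K$ put $\hat x_k=\gamma_k\bar x_{k-1}+(1-\gamma_k)\tilde x_{k-1}$; let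 $(\tilde z_k,z_k)$ be the output of SREG$(\Phi_k)$ for $\Phi_k(x,y)=F(x,y)+\frac{\beta_k}2\|x-\hat x_k\|^2$, with $\mu_X=\beta_k$, $\mu_Y=\mu_d$, started at $(\hat x_k,y_{k-1})$ and run for $T$ steps with stepsize $\eta_k$; and put $\bar x_k=\frac1{\alpha_k\gamma_k}\left[\alpha_kx_k-\alpha_k(1-\gamma_k)\tilde x_{k-1}\right]$. Write $\tilde z_k=(\tilde x_k,\tilde y_k)$, $z_k=(x_k,y_k)$ and $\tilde y_k^*=\operatorname{argmax}_{y\in Y}F(\tilde x_k,y)$. **Theorem.** Let $d_x=\|x^*-x_0\|^2$, $d_y=\|\tilde y_0^*-y_0\|^2$, $D_0=d_x+d_y$ and $\rho=\frac{f(x_0)-f(x^*)}{\mu_dd_x}$. Use $$\gamma_k=\tfrac2{k+1},\quad \beta_k=\tfrac{\mu_d(k+1)}{4(k+2)},\quad \alpha_k=\tfrac{\beta_k\Lambda_T}{\Lambda_T-1},\quad \Lambda_T=\Big(1+\min\big\{\tfrac{\mu_d}{96L},\tfrac{q\log T}T\big\}\Big)^T,$$ $$\eta_k=\min\Big\{\tfrac{k+2}{24(k+1)L},\tfrac{q\log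 T}{\beta_kT}\Big\},\quad q=\max\Big\{\tfrac{2[\log(\mu_d^2D_Y^2/(16\sigma^2))+\log T]}{\log T},\tfrac1{\log T}\Big\}.$$ (i) For every $\epsilon>0$, every integer $K\ge1$ with $K\ge\sqrt{24(2\mu_dd_x+\mu_dd_y)/\epsilon}$ and every integer $$T\ge \tfrac{288L}{\mu_d}\big[\log 96+\log(48K^2)+\log_+(16\rho)\big]+\tfrac{24756\,\sigma^2K}{\epsilon\mu_d}\big(\log_+\tfrac{\mu_d^2D_Y^2}{\sigma^2}+2\big)+\tfrac{49152\,\sigma^2K}{\mu_d\epsilon}\max\big\{\log\tfrac{49152\,\sigma^2K}{\mu_d\epsilon},1\big\},$$ the random variable $f(\tilde x_K)-f(x^*)+\frac{\mu_d}6\|\tilde y_K^*-y_K\|^2$ is integrable and $$\mathbb E\Big[f(\tilde x_K)-f(x^*)+\tfrac{\mu_d}6\|\tilde y_K^*-y_K\|^2\Big]\le\epsilon .$$ (ii) Let $N(\epsilon)$ be the total number of SFO calls when $K$ and $T$ are the least integers allowed in (i). There is an absolute constant $C$ (one may take $C=10^9$) such that, whenever $0<\epsilon\le\mu_dD_0$,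 $$N(\epsilon)\le C\Big[\tfrac{L\sqrt{D_0}}{\sqrt{\mu_d\epsilon}}\Big(1+\log\tfrac{\mu_dD_0}\epsilon+\log_+\rho\Big)+\tfrac{\sigma^2D_0}{\epsilon^2}\Big(1+\log_+\tfrac{\sigma^2}{\mu_d\epsilon}+\log_+\tfrac{\mu_d^2D_Y^2}{\sigma^2}+\log\tfrac{\mu_dD_0}\epsilon\Big)\Big].$$ (iii) In particular, if $D_0>0$, then for the given problem and starting point, as $\epsilon\downarrow0$, $$N(\epsilon)=O\Big(\tfrac{LD_0}{\sqrt{\mu_d\epsilon}}\log\tfrac{\mu_dD_0}\epsilon+\tfrac{\sigma^2D_0}{\epsilon^2}\Big(\log\tfrac{\sigma^2}{\mu_d\epsilon}+\log\tfrac{\mu_d^2D_Y^2}{\sigma^2}\Big)\Big).$$ -/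

import Mathlib

open Set Filter Topology MeasureTheory ProbabilityTheory Asymptotics
open scoped BigOperators

noncomputable section

/-! ### The minimax problem `min_{x ∈ X} max_{y ∈ Y} F(x,y)` -/

/-- Euclidean space `ℝⁿ`. -/
abbrev Vec (n : ℕ) : Type := EuclideanSpace ℝ (Fin n)

/-- A pair `z = (x, y)`. The squared Euclidean norm of a pair is always written out below as
`‖x‖ ^ 2 + ‖y‖ ^ 2`; the product type only supplies the topology, the measurable structure and integrability. -/
abbrev Pt (n m : ℕ) : Type := Vec n × Vec m

/-- A minimizer of `φ` over `S` (in all uses below there is exactly one). -/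
def argminOn {α : Type*} [Nonempty α] (S : Set α) (φ : α → ℝ) : α :=
  Classical.epsilon (fun a => a ∈ S ∧ IsMinOn φ S a)

/-- The primal objective `f(x) = max_{y ∈ Y} F(x,y)`. -/
def primalObj {n m : ℕ} (F : Vec n → Vec m → ℝ) (Y : Set (Vec m)) (x : Vec n) : ℝ :=
  sSup (F x '' Y)

/-- The best dual response `argmax_{y ∈ Y} F(x,y)`. -/
def dualBest {n m : ℕ} (F : Vec n → Vec m → ℝ) (Y : Set (Vec m)) (x : Vec n) : Vec m :=
  argminOn Y (fun y => - F x y)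

/-- The closed neighbourhood `{x | dist(x, X) ≤ diam X}` of `X`. The extrapolated points at which
the accelerated scheme queries first-order information may leave `X`, but not this set. -/
def queryDom {n : ℕ} (X : Set (Vec n)) : Set (Vec n) :=
  Metric.cthickening (Metric.diam X) X

/-- `X`, `Y` are compact convex, `gradF = (∇ₓF, ∇ᵧF)` is the gradient of `F` and is `L`-Lipschitz,
`F` is `μp`-strongly convex in `x ∈ X` and `μd`-strongly concave in `y ∈ Y`. -/
structure IsMinimaxProblem {n m : ℕ} (X : Set (Vec n)) (Y : Set (Vec m))
    (F : Vec n → Vec m → ℝ) (gradF : Pt n m → Pt n m) (μp μd L : ℝ) : Prop where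
  compactX : IsCompact X
  convexX : Convex ℝ X
  compactY : IsCompact Y
  convexY : Convex ℝ Y
  grad_x : ∀ x ∈ queryDom X, ∀ y ∈ Y,
    HasGradientWithinAt (fun u => F u y) (gradF (x, y)).1 (queryDom X) x
  grad_y : ∀ x ∈ queryDom X, ∀ y ∈ Y,
    HasGradientWithinAt (fun v => F x v) (gradF (x, y)).2 Y y
  lipschitz : ∀ z ∈ queryDom X ×ˢ Y, ∀ w ∈ queryDom X ×ˢ Y,
    ‖(gradF z).1 - (gradF w).1‖ ^ 2 + ‖(gradF z).2 - (gradF w).2‖ ^ 2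
      ≤ L ^ 2 * (‖z.1 - w.1‖ ^ 2 + ‖z.2 - w.2‖ ^ 2)
  strongly_convex : ∀ x₁ ∈ X, ∀ x₂ ∈ X, ∀ y ∈ Y,
    μp / 2 * ‖x₁ - x₂‖ ^ 2
      ≤ F x₁ y - F x₂ y - inner ℝ (gradF (x₂, y)).1 (x₁ - x₂)
  strongly_concave : ∀ x ∈ X, ∀ y₁ ∈ Y, ∀ y₂ ∈ Y,
    F x y₁ - F x y₂ - inner ℝ (gradF (x, y₂)).2 (y₁ - y₂)
      ≤ - (μd / 2) * ‖y₁ - y₂‖ ^ 2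

/-- Stochastic first-order oracle: for a random `ξ` with law `P`, the output `g z ξ` is an unbiased
estimate of the gradient at `z` with variance at most `σ²`. -/
structure IsSFO {n m : ℕ} {Ξ : Type*} [MeasurableSpace Ξ] (X : Set (Vec n)) (Y : Set (Vec m))
    (gradF : Pt n m → Pt n m) (g : Pt n m → Ξ → Pt n m) (P : Measure Ξ) (σ : ℝ) : Prop where
  measurable : Measurable (Function.uncurry g)
  integrable : ∀ z ∈ queryDom X ×ˢ Y, Integrable (g z) P
  unbiased : ∀ z ∈ queryDom X ×ˢ Y, ∫ ξ, g z ξ ∂P = gradF z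
  integrable_sq : ∀ z ∈ queryDom X ×ˢ Y, Integrable
    (fun ξ => ‖(g z ξ).1 - (gradF z).1‖ ^ 2 + ‖(g z ξ).2 - (gradF z).2‖ ^ 2) P
  variance : ∀ z ∈ queryDom X ×ˢ Y,
    ∫ ξ, (‖(g z ξ).1 - (gradF z).1‖ ^ 2 + ‖(g z ξ).2 - (gradF z).2‖ ^ 2) ∂P ≤ σ ^ 2

/-! ### SREG with separate primal and dual regularization -/

/-- `argmin_{w ∈ X × Y} η ⟨G, w⟩ + ½ ‖w - z‖²`. -/
def extraPoint {n m : ℕ} (X : Set (Vec n)) (Y : Set (Vec m)) (η : ℝ) (G z : Pt n m) : Pt n m :=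
  argminOn (X ×ˢ Y) (fun w =>
    η * (inner ℝ G.1 w.1 + inner ℝ G.2 w.2)
      + 1 / 2 * (‖w.1 - z.1‖ ^ 2 + ‖w.2 - z.2‖ ^ 2))

/-- `argmin_{w ∈ X × Y} η [⟨G, w⟩ + (μX/2) ‖x - x̂‖² + (μY/2) ‖y - ŷ‖²] + ½ ‖w - z‖²`,
where `w = (x, y)` and `zh = (x̂, ŷ)`. -/
def regExtraPoint {n m : ℕ} (X : Set (Vec n)) (Y : Set (Vec m)) (μX μY η : ℝ)
    (G zh z : Pt n m) : Pt n m :=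
  argminOn (X ×ˢ Y) (fun w =>
    η * (inner ℝ G.1 w.1 + inner ℝ G.2 w.2
        + μX / 2 * ‖w.1 - zh.1‖ ^ 2 + μY / 2 * ‖w.2 - zh.2‖ ^ 2)
      + 1 / 2 * (‖w.1 - z.1‖ ^ 2 + ‖w.2 - z.2‖ ^ 2))

/-- Current iterate, and the number of oracle calls made so far. The `i`-th oracle call
(`i = 0, 1, …`) of a run consumes the `i`-th entry of a stream of samples, so that `calls` is also
the position of the next fresh sample. -/
structure SregState (n m : ℕ) where
  z : Pt n m
  calls : ℕ

/-- The extrapolated point `ẑ_t`, found with one oracle call at `z_t`. -/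
def sregHat {n m : ℕ} {Ξ : Type*} (X : Set (Vec n)) (Y : Set (Vec m))
    (G : Pt n m → Ξ → Pt n m) (s : ℕ → Ξ) (η : ℝ) (st : SregState n m) : Pt n m :=
  extraPoint X Y η (G st.z (s st.calls)) st.z

/-- The states `(z_t, calls)` of SREG. `G z ξ = (∇ₓψ(z;ξ), -∇ᵧψ(z;ξ))`; each step makes two oracle
calls, at `z_t` and at `ẑ_t`. -/
def sregState {n m : ℕ} {Ξ : Type*} (X : Set (Vec n)) (Y : Set (Vec m))
    (G : Pt n m → Ξ → Pt n m) (s : ℕ → Ξ) (μX μY : ℝ) (η : ℕ → ℝ) (init : SregState n m) :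
    ℕ → SregState n m
  | 0 => init
  | t + 1 =>
    let st := sregState X Y G s μX μY η init t
    let zh := sregHat X Y G s (η t) st
    { z := regExtraPoint X Y μX μY (η t) (G zh (s (st.calls + 1))) zh st.z
      calls := st.calls + 2 }

/-- `Λ_0 = 1`, `Λ_t = (1 + μX η_{t-1}) Λ_{t-1}`. -/
def sregWeight (μX : ℝ) (η : ℕ → ℝ) (t : ℕ) : ℝ :=
  ∏ i ∈ Finset.range t, (1 + μX * η i)

/-- What a subroutine returns: the averaged solution, the last iterate, the call counter. -/
structure SubOutput (n m : ℕ) where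
  avg : Pt n m
  last : Pt n m
  calls : ℕ

/-- SREG run for `T` steps: the average of the `ẑ_t` with weights `η_t Λ_t`, and `z_T`. -/
def sreg {n m : ℕ} {Ξ : Type*} (X : Set (Vec n)) (Y : Set (Vec m))
    (G : Pt n m → Ξ → Pt n m) (s : ℕ → Ξ) (μX μY : ℝ) (η : ℕ → ℝ) (T : ℕ)
    (init : SregState n m) : SubOutput n m where
  avg := (∑ t ∈ Finset.range T, η t * sregWeight μX η t)⁻¹ •
    ∑ t ∈ Finset.range T, (η t * sregWeight μX η t) •
      sregHat X Y G s (η t) (sregState X Y G s μX μY η init t)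
  last := (sregState X Y G s μX μY η init T).z
  calls := (sregState X Y G s μX μY η init T).calls

/-! ### The catalyst scheme -/

/-- Stochastic operator `(∇ₓΦ, -∇ᵧΦ)` of `Φ(x,y) = F(x,y) + (β/2) ‖x - x̂‖²`, obtained with one
call to the oracle `g` of `F`. -/
def proxOperator {n m : ℕ} {Ξ : Type*} (g : Pt n m → Ξ → Pt n m) (β : ℝ) (xh : Vec n)
    (z : Pt n m) (ξ : Ξ) : Pt n m :=
  ((g z ξ).1 + β • (z.1 - xh), - (g z ξ).2)

/-- State of the catalyst scheme: `x̄_k`, `z̃_k = (x̃_k, ỹ_k)`, `z_k = (x_k, y_k)`, and the number of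
oracle calls made so far. -/
structure CatState (n m : ℕ) where
  xbar : Vec n
  ztil : Pt n m
  z : Pt n m
  calls : ℕ

/-- `Catalyst-Minimax(𝒜)`. The subroutine is applied as `𝒜 k x̂_k init`: it treats the `k`-th
proximal subproblem with prox-center `x̂_k`, starting from the point `init.z = (x̂_k, y_{k-1})`. -/
def catalystMinimax {n m : ℕ} (μp : ℝ) (α γ : ℕ → ℝ)
    (𝒜 : ℕ → Vec n → SregState n m → SubOutput n m) (z₀ : Pt n m) : ℕ → CatState n m
  | 0 => { xbar := z₀.1, ztil := z₀, z := z₀, calls := 0 }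
  | k + 1 =>
    let c := catalystMinimax μp α γ 𝒜 z₀ k
    let xh : Vec n := γ (k + 1) • c.xbar + (1 - γ (k + 1)) • c.ztil.1
    let o := 𝒜 (k + 1) xh { z := (xh, c.z.2), calls := c.calls }
    { xbar := (1 / (α (k + 1) * γ (k + 1) + μp * (1 - γ (k + 1)))) •
        (α (k + 1) • o.last.1 + ((μp - α (k + 1)) * (1 - γ (k + 1))) • c.ztil.1)
      ztil := o.avg
      z := o.last
      calls := o.calls }

/-! ### Parameters for the convex–strongly-concave case -/

/-- `γ_k = 2/(k+1)`. -/
def gammaSeq (k : ℕ) : ℝ := 2 / (k + 1)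

/-- `β_k = μd (k+1) / (4 (k+2))`. -/
def betaSeq (μd : ℝ) (k : ℕ) : ℝ := μd * (k + 1) / (4 * (k + 2))

/-- `q = max {2 [log (μd² D_Y² / (16 σ²)) + log T] / log T, 1 / log T}`. -/
def qParam (μd DY σ : ℝ) (T : ℕ) : ℝ :=
  max (2 * (Real.log (μd ^ 2 * DY ^ 2 / (16 * σ ^ 2)) + Real.log T) / Real.log T)
    (1 / Real.log T)

/-- `Λ_T = (1 + min {μd / (96 L), q log T / T})^T`. -/
def bigLambda (μd L DY σ : ℝ) (T : ℕ) : ℝ :=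
  (1 + min (μd / (96 * L)) (qParam μd DY σ T * Real.log T / T)) ^ T

/-- `α_k = β_k Λ_T / (Λ_T - Λ_0)`, with `Λ_0 = 1`. -/
def alphaSeq (μd L DY σ : ℝ) (T : ℕ) (k : ℕ) : ℝ :=
  betaSeq μd k * bigLambda μd L DY σ T / (bigLambda μd L DY σ T - 1)

/-- The constant stepsize `min {(k+2) / (24 (k+1) L), q log T / (β_k T)}` in subproblem `k`. -/
def stepSize (μd L DY σ : ℝ) (T : ℕ) (k : ℕ) : ℝ :=
  min ((k + 2) / (24 * (k + 1) * L)) (qParam μd DY σ T * Real.log T / (betaSeq μd k * T))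

/-- `Catalyst-Minimax(SREG)` for `μp = 0`: in subproblem `k` SREG is run for `T` steps with moduli
`μX = β_k` and `μY = μd`. The oracle `g` is fed with the stream of samples `s`. -/
def catalystSREG {n m : ℕ} {Ξ : Type*} (X : Set (Vec n)) (Y : Set (Vec m))
    (g : Pt n m → Ξ → Pt n m) (μd L σ : ℝ) (T : ℕ) (z₀ : Pt n m) (s : ℕ → Ξ) :
    ℕ → CatState n m :=
  catalystMinimax 0 (alphaSeq μd L (Metric.diam Y) σ T) gammaSeq
    (fun k xh init => sreg X Y (proxOperator g (betaSeq μd k) xh) s (betaSeq μd k) μd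
      (fun _ => stepSize μd L (Metric.diam Y) σ T k) T init)
    z₀

/-- Lower bound on the number of outer iterations, as a function of
`dx = ‖x* - x̃₀‖²`, `dy = ‖ỹ₀* - y₀‖²` and the accuracy. -/
def outerBound (μd dx dy ε : ℝ) : ℝ :=
  Real.sqrt (24 * (2 * μd * dx + μd * dy) / ε)

/-- Lower bound on the number of inner steps; `gap = f(x̃₀) - f(x*)`, `dx = ‖x* - x̃₀‖²`, and
`Real.posLog t = max 0 (log t)`. -/
def innerBound (μd L DY σ gap dx ε : ℝ) (K : ℕ) : ℝ :=
  288 * L / μd *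
      (Real.log 96 + Real.log (48 * (K : ℝ) ^ 2) + Real.posLog (16 * gap / (μd * dx)))
    + 24756 * σ ^ 2 * (Real.posLog (μd ^ 2 * DY ^ 2 / σ ^ 2) + 2) * K / (ε * μd)
    + 49152 * σ ^ 2 * K / (μd * ε) * max (Real.log (49152 * σ ^ 2 * K / (μd * ε))) 1

/-- The least admissible number of outer iterations (at least one). -/
def outerCount (μd dx dy ε : ℝ) : ℕ := max 1 ⌈outerBound μd dx dy ε⌉₊

/-- The least admissible number of inner steps for `K` outer iterations. -/
def innerCount (μd L DY σ gap dx ε : ℝ) (K : ℕ) : ℕ := ⌈innerBound μd L DY σ gap dx ε K⌉₊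

/-- The number of oracle calls made by `Catalyst-Minimax(SREG)` when run on the stream of samples
`s` with the least admissible iteration counts for accuracy `ε`. -/
def sfoCalls {n m : ℕ} {Ξ : Type*} (X : Set (Vec n)) (Y : Set (Vec m))
    (g : Pt n m → Ξ → Pt n m) (μd L σ : ℝ) (z₀ : Pt n m) (s : ℕ → Ξ) (gap dx dy ε : ℝ) : ℕ :=
  (catalystSREG X Y g μd L σ
    (innerCount μd L (Metric.diam Y) σ gap dx ε (outerCount μd dx dy ε)) z₀ s
    (outerCount μd dx dy ε)).calls

end

/-! The argument is pathwise until the very end: oracle errors are kept as explicit terms, and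
expectations are taken only once the recursions are solved.

Inner loop. An extragradient step can be compared with any (x, y) ∈ X × Y; the bound ηL ≤ 1/16
absorbs the variation of the gradient (`sreg_step`). With weights (1 + βη)^t the steps telescope,
and Jensen's inequality yields one estimate for the averaged output and the last iterate together
(`proxSreg_spec`). The delicate point is the comparison point. Its x is known before the subproblem
starts, but its y is the best response to the output, hence correlated with the noise. A ghost
sequence v_t driven by the same dual errors e splits ⟨e, y - ŷ⟩ into ⟨e, y - v⟩, absorbed by the
potential ‖y - v‖², and ⟨e, v - ŷ⟩, which has mean zero. The price is a doubled initial dual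
distance. The noise of a subproblem then has mean at most 10ησ² (`integral_stageNoise_le`).

Outer loop. Put e = 1/(Λ_T - 1). The choice x = γx* + (1 - γ)x̃_{k-1}, y = ỹ_k* gives an accelerated
recursion (`catalystSREG_step`) with a single defect, β e ‖ỹ_k* - y_{k-1}‖². It is handled according
to which term attains the minimum in Λ_T. If it is the one with L, then e = O(1/K²), and the drift
of the best responses is controlled by the primal gaps because x* and its best response form a
saddle point (`sq_dualBest_sub_le`, `outer_le_of_contraction`). If it is q log T / T, the drift is
at most D_Y, and q is chosen so that e D_Y² = O(σ²/(μd² T)) (`outer_le_of_bounded`,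
`bounded_params`). The bound on K makes the contribution of the initial distances a fraction of ε,
the bound on T that of the noise.

Complexity. A run makes exactly 2TK calls, and the least K and T are estimated directly
(`four_mul_innerBound_mul_le`). -/

/-! ### Existence and continuous dependence of minimizers on compact sets. -/

theorem argminOn_spec {α : Type*} [Nonempty α] [TopologicalSpace α] {S : Set α} {φ : α → ℝ}
    (hS : IsCompact S) (hne : S.Nonempty) (hφ : ContinuousOn φ S) :
    argminOn S φ ∈ S ∧ IsMinOn φ S (argminOn S φ) := by
  obtain ⟨a, ha, hm⟩ := hS.exists_isMinOn hne hφ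
  exact Classical.epsilon_spec (p := fun a => a ∈ S ∧ IsMinOn φ S a) ⟨a, ha, hm⟩

/-- Maximum theorem for parametrized problems with a unique minimizer on a compact set. -/
theorem continuous_argminOn {Θ E : Type*} [TopologicalSpace Θ] [TopologicalSpace E] [Nonempty E]
    {S : Set E} (hS : IsCompact S) (hne : S.Nonempty) {φ : Θ → E → ℝ}
    (hφ : Continuous fun q : Θ × S => φ q.1 q.2)
    (huniq : ∀ p, ∀ a ∈ S, ∀ b ∈ S, IsMinOn (φ p) S a → IsMinOn (φ p) S b → a = b) :
    Continuous fun p => argminOn S (φ p) := by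
  have hc : ∀ p, ContinuousOn (φ p) S := fun p => by
    rw [continuousOn_iff_continuous_domRestrict]
    exact hφ.comp (Continuous.prodMk_right p)
  have hspec := fun p => argminOn_spec hS hne (hc p)
  rw [continuous_iff_continuousAt]
  intro p₀
  rw [ContinuousAt, tendsto_nhds]
  intro U hU hpU
  have : CompactSpace S := isCompact_iff_compactSpace.1 hS
  have hK : IsCompact {b : S | (b : E) ∉ U} :=
    (hU.preimage continuous_subtype_val).isClosed_compl.isCompact
  set a₀ : S := ⟨argminOn S (φ p₀), (hspec p₀).1⟩ with ha₀
  have hlt : ∀ b ∈ {b : S | (b : E) ∉ U}, φ p₀ a₀ < φ p₀ b := by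
    intro b hb
    refine lt_of_le_of_ne ((hspec p₀).2 b.2) fun h => hb ?_
    have hbm : IsMinOn (φ p₀) S b := fun c hcS => by
      change φ p₀ b ≤ φ p₀ c
      rw [← h]; exact (hspec p₀).2 hcS
    rw [← huniq p₀ _ (hspec p₀).1 _ b.2 (hspec p₀).2 hbm]
    exact hpU
  -- By compactness, `a₀` keeps beating all points outside `U` for parameters near `p₀`, so the
  -- minimizer there cannot leave `U`.
  have hev := hK.eventually_forall_of_forall_eventually (x₀ := p₀)
    (P := fun p b => φ p a₀ < φ p b) (fun b hb => by
      have h1 : Continuous fun q : Θ × S => φ q.1 a₀ :=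
        hφ.comp (continuous_fst.prodMk continuous_const)
      exact (h1.tendsto (p₀, b)).eventually_lt (hφ.tendsto (p₀, b)) (hlt b hb))
  filter_upwards [hev] with p hp
  by_contra hcon
  have h1 := hp ⟨argminOn S (φ p), (hspec p).1⟩ hcon
  exact absurd ((hspec p).2 a₀.2) (not_le.2 h1)

/-! ### Quadratic growth and the regularized proximal step. -/

/-- Quadratic growth at a minimizer: `a` is the minimal value, the bracket bounds the objective on a
segment under strong convexity. Divide by s and let s → 0. -/
theorem add_le_of_le_segment {a b C : ℝ}
    (h : ∀ s : ℝ, 0 < s → s < 1 → a ≤ (1 - s) * a + s * b - s * (1 - s) * C) : a + C ≤ b := by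
  have h2 : ∀ s : ℝ, 0 < s → s < 1 → (1 - s) * C ≤ b - a := fun s h0 h1 => by
    have := h s h0 h1
    have h3 : s * ((1 - s) * C) ≤ s * (b - a) := by linarith
    exact le_of_mul_le_mul_left h3 h0
  have ht : Tendsto (fun s : ℝ => (1 - s) * C) (𝓝[>] 0) (𝓝 ((1 - 0) * C)) :=
    ((continuous_const.sub continuous_id).mul continuous_const).continuousAt.tendsto.mono_left
      nhdsWithin_le_nhds
  have := le_of_tendsto ht (b := b - a) (by
    filter_upwards [Ioo_mem_nhdsGT (zero_lt_one' ℝ)] with s hs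
    exact h2 s hs.1 hs.2)
  linarith

theorem norm_sub_sq_segment {E : Type*} [NormedAddCommGroup E] [InnerProductSpace ℝ E]
    (r w c : E) (s : ℝ) :
    ‖(1 - s) • r + s • w - c‖ ^ 2
      = (1 - s) * ‖r - c‖ ^ 2 + s * ‖w - c‖ ^ 2 - s * (1 - s) * ‖w - r‖ ^ 2 := by
  have h1 : (1 - s) • r + s • w - c = (1 - s) • (r - c) + s • (w - c) := by module
  have h2 : w - r = (w - c) - (r - c) := by abel
  rw [h1, h2, norm_add_sq_real, norm_sub_sq_real (w - c), norm_smul, norm_smul, inner_smul_left,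
    inner_smul_right, mul_pow, mul_pow, Real.norm_eq_abs, Real.norm_eq_abs, sq_abs, sq_abs,
    real_inner_comm (r - c) (w - c)]
  simp only [conj_trivial]
  ring

/-- The objective of the regularized proximal step. -/
noncomputable def proxObj {n m : ℕ} (μX μY η : ℝ) (G zh z w : Pt n m) : ℝ :=
  η * (inner ℝ G.1 w.1 + inner ℝ G.2 w.2
      + μX / 2 * ‖w.1 - zh.1‖ ^ 2 + μY / 2 * ‖w.2 - zh.2‖ ^ 2)
    + 1 / 2 * (‖w.1 - z.1‖ ^ 2 + ‖w.2 - z.2‖ ^ 2)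

/-- With zero moduli the prox-center is irrelevant; both proximal steps can share one theory. -/
theorem extraPoint_eq_regExtraPoint {n m : ℕ} (X : Set (Vec n)) (Y : Set (Vec m)) (η : ℝ)
    (G z : Pt n m) : extraPoint X Y η G z = regExtraPoint X Y 0 0 η G z z := by
  simp [extraPoint, regExtraPoint]

theorem continuous_proxObj {n m : ℕ} (μX μY η : ℝ) :
    Continuous fun p : (Pt n m × Pt n m × Pt n m) × Pt n m =>
      proxObj μX μY η p.1.1 p.1.2.1 p.1.2.2 p.2 := by
  unfold proxObj
  fun_prop

theorem proxObj_segment {n m : ℕ} (μX μY η : ℝ) (G zh z r w : Pt n m) (s : ℝ) :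
    proxObj μX μY η G zh z ((1 - s) • r + s • w)
      = (1 - s) * proxObj μX μY η G zh z r + s * proxObj μX μY η G zh z w
        - s * (1 - s) * ((1 + η * μX) / 2 * ‖w.1 - r.1‖ ^ 2
            + (1 + η * μY) / 2 * ‖w.2 - r.2‖ ^ 2) := by
  simp only [proxObj, Prod.fst_add, Prod.snd_add, Prod.smul_fst, Prod.smul_snd,
    norm_sub_sq_segment, inner_add_right, inner_smul_right]
  ring

section Prox

variable {n m : ℕ} {X : Set (Vec n)} {Y : Set (Vec m)} {μX μY η : ℝ}

theorem proxObj_add_le_of_isMinOn (hX : Convex ℝ X) (hY : Convex ℝ Y)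
    {G zh z r w : Pt n m} (hr : r ∈ X ×ˢ Y) (hw : w ∈ X ×ˢ Y)
    (hmin : IsMinOn (proxObj μX μY η G zh z) (X ×ˢ Y) r) :
    proxObj μX μY η G zh z r + ((1 + η * μX) / 2 * ‖w.1 - r.1‖ ^ 2
      + (1 + η * μY) / 2 * ‖w.2 - r.2‖ ^ 2) ≤ proxObj μX μY η G zh z w := by
  refine add_le_of_le_segment fun s h0 h1 => ?_
  have hm : (1 - s) • r + s • w ∈ X ×ˢ Y :=
    ⟨hX hr.1 hw.1 (sub_nonneg.2 h1.le) h0.le (sub_add_cancel 1 s),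
      hY hr.2 hw.2 (sub_nonneg.2 h1.le) h0.le (sub_add_cancel 1 s)⟩
  have h := isMinOn_iff.1 hmin _ hm
  rw [proxObj_segment] at h
  exact h

theorem regExtraPoint_mem_isMinOn (hX : IsCompact X) (hY : IsCompact Y) (hXne : X.Nonempty)
    (hYne : Y.Nonempty) (G zh z : Pt n m) :
    regExtraPoint X Y μX μY η G zh z ∈ X ×ˢ Y ∧
      IsMinOn (proxObj μX μY η G zh z) (X ×ˢ Y) (regExtraPoint X Y μX μY η G zh z) :=
  argminOn_spec (φ := proxObj μX μY η G zh z) (hX.prod hY) (hXne.prod hYne)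
    ((continuous_proxObj μX μY η).comp
      (Continuous.prodMk_right (G, zh, z))).continuousOn

/-- Three-point inequality for the regularized proximal step. -/
theorem regExtraPoint_add_le (hX : IsCompact X) (hY : IsCompact Y) (hXc : Convex ℝ X)
    (hYc : Convex ℝ Y) (G zh z : Pt n m) {w : Pt n m} (hw : w ∈ X ×ˢ Y) :
    proxObj μX μY η G zh z (regExtraPoint X Y μX μY η G zh z)
      + ((1 + η * μX) / 2 * ‖w.1 - (regExtraPoint X Y μX μY η G zh z).1‖ ^ 2
      + (1 + η * μY) / 2 * ‖w.2 - (regExtraPoint X Y μX μY η G zh z).2‖ ^ 2)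
      ≤ proxObj μX μY η G zh z w := by
  obtain ⟨h1, h2⟩ := regExtraPoint_mem_isMinOn (μX := μX) (μY := μY) (η := η) hX hY ⟨_, hw.1⟩
    ⟨_, hw.2⟩ G zh z
  exact proxObj_add_le_of_isMinOn hXc hYc h1 hw h2

theorem continuous_regExtraPoint (hX : IsCompact X) (hY : IsCompact Y) (hXc : Convex ℝ X)
    (hYc : Convex ℝ Y) (hXne : X.Nonempty) (hYne : Y.Nonempty) (hμX : 0 ≤ μX) (hμY : 0 ≤ μY)
    (hη : 0 ≤ η) :
    Continuous fun p : Pt n m × Pt n m × Pt n m =>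
      regExtraPoint X Y μX μY η p.1 p.2.1 p.2.2 := by
  refine continuous_argminOn (φ := fun p : Pt n m × Pt n m × Pt n m =>
    proxObj μX μY η p.1 p.2.1 p.2.2) (hX.prod hY) (hXne.prod hYne) ?_ ?_
  · unfold proxObj
    fun_prop
  · intro p a ha b hb hma hmb
    have h1 := proxObj_add_le_of_isMinOn hXc hYc ha hb hma
    have h2 := isMinOn_iff.1 hmb a ha
    have h3 : 0 ≤ η * μX := mul_nonneg hη hμX
    have h4 : 0 ≤ η * μY := mul_nonneg hη hμY
    have h5 : 1 / 2 * ‖b.1 - a.1‖ ^ 2 ≤ (1 + η * μX) / 2 * ‖b.1 - a.1‖ ^ 2 := by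
      gcongr; linarith
    have h6 : 1 / 2 * ‖b.2 - a.2‖ ^ 2 ≤ (1 + η * μY) / 2 * ‖b.2 - a.2‖ ^ 2 := by
      gcongr; linarith
    have h7 : ‖b.1 - a.1‖ ^ 2 = 0 := by nlinarith [sq_nonneg ‖b.1 - a.1‖, sq_nonneg ‖b.2 - a.2‖]
    have h8 : ‖b.2 - a.2‖ ^ 2 = 0 := by nlinarith [sq_nonneg ‖b.1 - a.1‖, sq_nonneg ‖b.2 - a.2‖]
    rw [sq_eq_zero_iff, norm_eq_zero, sub_eq_zero] at h7 h8
    exact Prod.ext h7.symm h8.symm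

end Prox

/-! ### Continuity of F, best responses and the saddle point. -/

namespace IsMinimaxProblem

variable {n m : ℕ} {X : Set (Vec n)} {Y : Set (Vec m)} {F : Vec n → Vec m → ℝ}
  {gradF : Pt n m → Pt n m} {μd L : ℝ}

theorem subset_queryDom (X : Set (Vec n)) : X ⊆ queryDom X :=
  Metric.self_subset_cthickening X

/-- The product type carries the sup norm, whereas the Lipschitz hypothesis is Euclidean; 2|L| is a
crude constant covering the conversion. -/
theorem continuousOn_gradF (hF : IsMinimaxProblem X Y F gradF 0 μd L) :
    ContinuousOn gradF (queryDom X ×ˢ Y) := by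
  have hl : LipschitzOnWith (Real.toNNReal (2 * |L|)) gradF (queryDom X ×ˢ Y) := by
    refine LipschitzOnWith.of_dist_le_mul fun z hz w hw => ?_
    rw [Real.coe_toNNReal _ (by positivity), dist_eq_norm, dist_eq_norm]
    have h := hF.lipschitz z hz w hw
    have h1 : ‖z.1 - w.1‖ ≤ ‖z - w‖ := norm_fst_le (z - w)
    have h2 : ‖z.2 - w.2‖ ≤ ‖z - w‖ := norm_snd_le (z - w)
    have h3 : ‖z.1 - w.1‖ ^ 2 + ‖z.2 - w.2‖ ^ 2 ≤ 4 * ‖z - w‖ ^ 2 := by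
      have := pow_le_pow_left₀ (norm_nonneg _) h1 2
      have := pow_le_pow_left₀ (norm_nonneg _) h2 2
      nlinarith [sq_nonneg ‖z - w‖]
    have h4 : L ^ 2 * (‖z.1 - w.1‖ ^ 2 + ‖z.2 - w.2‖ ^ 2) ≤ (2 * |L| * ‖z - w‖) ^ 2 := by
      calc _ ≤ L ^ 2 * (4 * ‖z - w‖ ^ 2) := by gcongr
        _ = _ := by rw [mul_pow, mul_pow, sq_abs]; ring
    rw [Prod.norm_def]
    refine max_le ?_ ?_
    · refine abs_le_of_sq_le_sq' ?_ (by positivity) |>.2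
      simp only [Prod.fst_sub]
      nlinarith [sq_nonneg ‖(gradF z).2 - (gradF w).2‖]
    · refine abs_le_of_sq_le_sq' ?_ (by positivity) |>.2
      simp only [Prod.snd_sub]
      nlinarith [sq_nonneg ‖(gradF z).1 - (gradF w).1‖]
  exact hl.continuousOn

theorem inner_le_sub (hF : IsMinimaxProblem X Y F gradF 0 μd L) {x₁ x₂ : Vec n} {y : Vec m}
    (h₁ : x₁ ∈ X) (h₂ : x₂ ∈ X) (hy : y ∈ Y) :
    inner ℝ (gradF (x₂, y)).1 (x₁ - x₂) ≤ F x₁ y - F x₂ y := by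
  have := hF.strongly_convex x₁ h₁ x₂ h₂ y hy
  linarith

/-- Joint continuity is not a hypothesis. The first-order inequalities, convex in x and concave in
y, squeeze F between `lo` and `hi`; both are continuous because the gradient is, and both equal F at
(x₀, y₀). -/
theorem continuousOn_uncurry (hF : IsMinimaxProblem X Y F gradF 0 μd L) (hμd : 0 < μd) :
    ContinuousOn (fun z : Pt n m => F z.1 z.2) (X ×ˢ Y) := by
  rintro ⟨x₀, y₀⟩ ⟨hx₀, hy₀⟩
  have hg : ContinuousOn gradF (X ×ˢ Y) :=
    hF.continuousOn_gradF.mono (prod_mono (subset_queryDom X) subset_rfl)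
  have hg0 : ContinuousOn (fun z : Pt n m => gradF (x₀, z.2)) (X ×ˢ Y) :=
    hg.comp (by fun_prop) fun z hz => ⟨hx₀, hz.2⟩
  set lo : Pt n m → ℝ := fun z => F x₀ y₀ + inner ℝ (gradF (x₀, z.2)).1 (z.1 - x₀)
    + inner ℝ (gradF (x₀, z.2)).2 (z.2 - y₀) with hlo
  set hi : Pt n m → ℝ := fun z => F x₀ y₀ + inner ℝ (gradF z).1 (z.1 - x₀)
    + inner ℝ (gradF (x₀, y₀)).2 (z.2 - y₀) with hhi
  have hloc : ContinuousOn lo (X ×ˢ Y) :=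
    (continuousOn_const.add (hg0.fst.inner (by fun_prop))).add (hg0.snd.inner (by fun_prop))
  have hhic : ContinuousOn hi (X ×ˢ Y) :=
    (continuousOn_const.add (hg.fst.inner (by fun_prop))).add
      (continuousOn_const.inner (by fun_prop))
  have tlo := hloc (x₀, y₀) ⟨hx₀, hy₀⟩
  have thi := hhic (x₀, y₀) ⟨hx₀, hy₀⟩
  have elo : lo (x₀, y₀) = F x₀ y₀ := by simp [hlo]
  have ehi : hi (x₀, y₀) = F x₀ y₀ := by simp [hhi]
  rw [ContinuousWithinAt, elo] at tlo
  rw [ContinuousWithinAt, ehi] at thi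
  refine tendsto_of_tendsto_of_tendsto_of_le_of_le' tlo thi ?_ ?_
  · filter_upwards [self_mem_nhdsWithin] with z hz
    have h1 := hF.inner_le_sub hz.1 hx₀ hz.2
    have h2 := hF.strongly_concave x₀ hx₀ y₀ hy₀ z.2 hz.2
    have h3 : inner ℝ (gradF (x₀, z.2)).2 (y₀ - z.2)
        = - inner ℝ (gradF (x₀, z.2)).2 (z.2 - y₀) := by
      rw [← inner_neg_right, neg_sub]
    have h4 : 0 ≤ μd / 2 * ‖y₀ - z.2‖ ^ 2 := by positivity
    simp only [hlo]
    linarith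
  · filter_upwards [self_mem_nhdsWithin] with z hz
    have h1 := hF.inner_le_sub hx₀ hz.1 hz.2
    have h2 := hF.strongly_concave x₀ hx₀ z.2 hz.2 y₀ hy₀
    have h3 : inner ℝ (gradF (z.1, z.2)).1 (x₀ - z.1)
        = - inner ℝ (gradF z).1 (z.1 - x₀) := by
      rw [← inner_neg_right, neg_sub]
    have h4 : 0 ≤ μd / 2 * ‖z.2 - y₀‖ ^ 2 := by positivity
    simp only [hhi]
    linarith

theorem concave_segment (hF : IsMinimaxProblem X Y F gradF 0 μd L) {x : Vec n} (hx : x ∈ X)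
    {a b : Vec m} (ha : a ∈ Y) (hb : b ∈ Y) {s : ℝ} (h0 : 0 ≤ s) (h1 : s ≤ 1) :
    (1 - s) * F x a + s * F x b + s * (1 - s) * (μd / 2 * ‖b - a‖ ^ 2)
      ≤ F x ((1 - s) • a + s • b) := by
  set p := (1 - s) • a + s • b with hp
  have hpY : p ∈ Y := hF.convexY ha hb (sub_nonneg.2 h1) h0 (sub_add_cancel 1 s)
  have i1 := hF.strongly_concave x hx a ha p hpY
  have i2 := hF.strongly_concave x hx b hb p hpY
  have i3 := norm_sub_sq_segment a b p s
  rw [← hp, sub_self, norm_zero] at i3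
  have i4 : (1 - s) * inner ℝ (gradF (x, p)).2 (a - p) + s * inner ℝ (gradF (x, p)).2 (b - p)
      = 0 := by
    rw [← inner_smul_right, ← inner_smul_right, ← inner_add_right,
      show (1 - s) • (a - p) + s • (b - p) = 0 by rw [hp]; module, inner_zero_right]
  have i5 : 0 = μd / 2 * ((1 - s) * ‖a - p‖ ^ 2 + s * ‖b - p‖ ^ 2
    - s * (1 - s) * ‖b - a‖ ^ 2) := by rw [← i3]; ring
  linarith [mul_le_mul_of_nonneg_left i1 (sub_nonneg.2 h1), mul_le_mul_of_nonneg_left i2 h0]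

theorem convex_segment (hF : IsMinimaxProblem X Y F gradF 0 μd L) {y : Vec m} (hy : y ∈ Y)
    {a b : Vec n} (ha : a ∈ X) (hb : b ∈ X) {s : ℝ} (h0 : 0 ≤ s) (h1 : s ≤ 1) :
    F ((1 - s) • a + s • b) y ≤ (1 - s) * F a y + s * F b y := by
  set p := (1 - s) • a + s • b with hp
  have hpX : p ∈ X := hF.convexX ha hb (sub_nonneg.2 h1) h0 (sub_add_cancel 1 s)
  have i1 := hF.inner_le_sub ha hpX hy
  have i2 := hF.inner_le_sub hb hpX hy
  have i4 : (1 - s) * inner ℝ (gradF (p, y)).1 (a - p) + s * inner ℝ (gradF (p, y)).1 (b - p)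
      = 0 := by
    rw [← inner_smul_right, ← inner_smul_right, ← inner_add_right,
      show (1 - s) • (a - p) + s • (b - p) = 0 by rw [hp]; module, inner_zero_right]
  linarith [mul_le_mul_of_nonneg_left i1 (sub_nonneg.2 h1), mul_le_mul_of_nonneg_left i2 h0]

theorem add_le_of_forall_le (hF : IsMinimaxProblem X Y F gradF 0 μd L) {x : Vec n} (hx : x ∈ X) {a y : Vec m} (ha : a ∈ Y) (hy : y ∈ Y)
    (hmax : ∀ y ∈ Y, F x y ≤ F x a) : F x y + μd / 2 * ‖y - a‖ ^ 2 ≤ F x a := by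
  have := add_le_of_le_segment (a := - F x a) (b := - F x y) (C := μd / 2 * ‖y - a‖ ^ 2)
    fun s h0 h1 => by
      have i1 := hF.concave_segment hx ha hy h0.le h1.le
      have i2 := hmax _ (hF.convexY ha hy (sub_nonneg.2 h1.le) h0.le (sub_add_cancel 1 s))
      linarith
  linarith

section Dual

variable (hF : IsMinimaxProblem X Y F gradF 0 μd L) (hμd : 0 < μd) (hYne : Y.Nonempty)
include hF hμd hYne

theorem dualBest_spec {x : Vec n} (hx : x ∈ X) :
    dualBest F Y x ∈ Y ∧ ∀ y ∈ Y, F x y ≤ F x (dualBest F Y x) := by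
  have hc : ContinuousOn (fun y => - F x y) Y :=
    ((hF.continuousOn_uncurry hμd).comp (f := fun y => ((x, y) : Pt n m)) (by fun_prop)
      fun y hy => ⟨hx, hy⟩).neg
  obtain ⟨h1, h2⟩ := argminOn_spec hF.compactY hYne hc
  exact ⟨h1, fun y hy => neg_le_neg_iff.1 (isMinOn_iff.1 h2 y hy)⟩

theorem add_le_dualBest {x : Vec n} (hx : x ∈ X) {y : Vec m} (hy : y ∈ Y) :
    F x y + μd / 2 * ‖y - dualBest F Y x‖ ^ 2 ≤ F x (dualBest F Y x) :=
  hF.add_le_of_forall_le hx (hF.dualBest_spec hμd hYne hx).1 hy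
    (hF.dualBest_spec hμd hYne hx).2

theorem primalObj_eq {x : Vec n} (hx : x ∈ X) : primalObj F Y x = F x (dualBest F Y x) := by
  obtain ⟨h1, h2⟩ := hF.dualBest_spec hμd hYne hx
  refine IsGreatest.csSup_eq ⟨⟨_, h1, rfl⟩, ?_⟩
  rintro _ ⟨y, hy, rfl⟩
  exact h2 y hy

theorem le_primalObj {x : Vec n} (hx : x ∈ X) {y : Vec m} (hy : y ∈ Y) :
    F x y ≤ primalObj F Y x := by
  rw [hF.primalObj_eq hμd hYne hx]
  exact (hF.dualBest_spec hμd hYne hx).2 y hy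

theorem primalObj_segment {a b : Vec n} (ha : a ∈ X) (hb : b ∈ X) {s : ℝ} (h0 : 0 ≤ s)
    (h1 : s ≤ 1) :
    primalObj F Y ((1 - s) • a + s • b) ≤ (1 - s) * primalObj F Y a + s * primalObj F Y b := by
  have hp : (1 - s) • a + s • b ∈ X := hF.convexX ha hb (sub_nonneg.2 h1) h0 (sub_add_cancel 1 s)
  rw [hF.primalObj_eq hμd hYne hp]
  have hy := (hF.dualBest_spec hμd hYne hp).1
  refine (hF.convex_segment hy ha hb h0 h1).trans ?_
  have := sub_nonneg.2 h1
  gcongr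
  · exact hF.le_primalObj hμd hYne ha hy
  · exact hF.le_primalObj hμd hYne hb hy

/-- Strong concavity makes the maximizer unique, so the maximum theorem applies. This is what makes
the final error a random variable. -/
theorem continuous_dualBest : Continuous fun x : X => dualBest F Y x := by
  refine continuous_argminOn (φ := fun (x : X) y => - F x y) hF.compactY hYne ?_ ?_
  · exact ((hF.continuousOn_uncurry hμd).comp_continuous
      (f := fun q : X × Y => ((q.1, q.2) : Pt n m)) (by fun_prop)
        fun q => ⟨q.1.2, q.2.2⟩).neg
  · intro x a ha b hb hma hmb
    have h := hF.add_le_of_forall_le x.2 ha hb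
      fun y hy => neg_le_neg_iff.1 (isMinOn_iff.1 hma y hy)
    have h' := neg_le_neg_iff.1 (isMinOn_iff.1 hmb a ha)
    have h3 : ‖b - a‖ ^ 2 = 0 := by
      have : μd / 2 * ‖b - a‖ ^ 2 ≤ 0 := by linarith
      nlinarith [sq_nonneg ‖b - a‖]
    rw [sq_eq_zero_iff, norm_eq_zero, sub_eq_zero] at h3
    exact h3.symm

theorem continuous_primalObj : Continuous fun x : X => primalObj F Y x := by
  have h : (fun x : X => primalObj F Y x) = fun x : X => F x (dualBest F Y x) :=
    funext fun x => hF.primalObj_eq hμd hYne x.2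
  rw [h]
  exact (hF.continuousOn_uncurry hμd).comp_continuous
    (f := fun x : X => ((x, dualBest F Y x) : Pt n m))
    (continuous_subtype_val.prodMk (hF.continuous_dualBest hμd hYne))
    fun x => ⟨x.2, (hF.dualBest_spec hμd hYne x.2).1⟩

/-- The best response to a primal minimizer completes it to a saddle point. -/
theorem primalObj_le_of_isMinOn {xstar : Vec n} (hxs : xstar ∈ X)
    (hmin : IsMinOn (primalObj F Y) X xstar) {x : Vec n} (hx : x ∈ X) :
    primalObj F Y xstar ≤ F x (dualBest F Y xstar) := by
  set ys := dualBest F Y xstar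
  -- Move from x* a little towards x, and let y_s be the best response there. Minimality and
  -- convexity give f(x*) ≤ (1 - s) F(x*, y_s) + s F(x, y_s). Since F(x*, y_s) ≤ f(x*), this forces
  -- f(x*) ≤ F(x, y_s). The quadratic loss in F(x*, y_s) forces y_s → y*, so s → 0 finishes.
  set xs : ℝ → Vec n := fun s => (1 - s) • xstar + s • x with hxsdef
  have hmem : ∀ s ∈ Ioo (0 : ℝ) 1, xs s ∈ X := fun s hs =>
    hF.convexX hxs hx (sub_nonneg.2 hs.2.le) hs.1.le (sub_add_cancel 1 s)
  set yy : ℝ → Vec m := fun s => dualBest F Y (xs s)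
  set C := primalObj F Y x - primalObj F Y xstar
  have hyy : ∀ s ∈ Ioo (0 : ℝ) 1, yy s ∈ Y := fun s hs =>
    (hF.dualBest_spec hμd hYne (hmem s hs)).1
  have key : ∀ s ∈ Ioo (0 : ℝ) 1, primalObj F Y xstar ≤ F x (yy s) ∧
      (1 - s) * (μd / 2 * ‖yy s - ys‖ ^ 2) ≤ s * C := by
    intro s hs
    have h1 := isMinOn_iff.1 hmin _ (hmem s hs)
    rw [hF.primalObj_eq hμd hYne (hmem s hs)] at h1
    have h2 := hF.convex_segment (hyy s hs) hxs hx hs.1.le hs.2.le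
    have h3 := hF.add_le_dualBest hμd hYne hxs (hyy s hs)
    rw [← hF.primalObj_eq hμd hYne hxs] at h3
    have h4 := hF.le_primalObj hμd hYne hx (hyy s hs)
    have h5 : primalObj F Y xstar ≤ (1 - s) * F xstar (yy s) + s * F x (yy s) := h1.trans h2
    have h6 := mul_le_mul_of_nonneg_left h3 (sub_nonneg.2 hs.2.le)
    have h7 := mul_le_mul_of_nonneg_left h4 hs.1.le
    have h8 : 0 ≤ (1 - s) * (μd / 2 * ‖yy s - ys‖ ^ 2) :=
      mul_nonneg (sub_nonneg.2 hs.2.le) (by positivity)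
    refine ⟨?_, ?_⟩
    · refine le_of_mul_le_mul_left ?_ hs.1
      simp only [ys] at h8
      linarith
    · simp only [C, ys]
      linarith
  have hC : 0 ≤ C := sub_nonneg.2 (isMinOn_iff.1 hmin x hx)
  have ht : Tendsto yy (𝓝[>] 0) (𝓝 ys) := by
    rw [tendsto_iff_norm_sub_tendsto_zero]
    have hb : Tendsto (fun s : ℝ => Real.sqrt (s * (4 * C / μd))) (𝓝[>] 0) (𝓝 0) := by
      have : Tendsto (fun s : ℝ => Real.sqrt (s * (4 * C / μd))) (𝓝 0)
          (𝓝 (Real.sqrt (0 * (4 * C / μd)))) := by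
        refine Continuous.tendsto ?_ _
        fun_prop
      rw [zero_mul, Real.sqrt_zero] at this
      exact this.mono_left nhdsWithin_le_nhds
    refine tendsto_of_tendsto_of_tendsto_of_le_of_le' tendsto_const_nhds hb
      (Eventually.of_forall fun _ => norm_nonneg _) ?_
    filter_upwards [Ioo_mem_nhdsGT (show (0 : ℝ) < 1 / 2 by norm_num)] with s hs
    refine Real.le_sqrt_of_sq_le ?_
    have h1 := (key s ⟨hs.1, by linarith [hs.2]⟩).2
    have h2 : 1 / 2 * (μd / 2 * ‖yy s - ys‖ ^ 2) ≤ (1 - s) * (μd / 2 * ‖yy s - ys‖ ^ 2) := by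
      have := hs.2
      gcongr
      linarith
    rw [mul_div_assoc', le_div_iff₀ hμd]
    linarith
  have hcont : Tendsto (fun s => F x (yy s)) (𝓝[>] 0) (𝓝 (F x ys)) := by
    have hys : ys ∈ Y := (hF.dualBest_spec hμd hYne hxs).1
    have h1 := (hF.continuousOn_uncurry hμd) (x, ys) ⟨hx, hys⟩
    have h2 : Tendsto (fun s => ((x, yy s) : Pt n m)) (𝓝[>] 0) (𝓝[X ×ˢ Y] (x, ys)) := by
      refine tendsto_nhdsWithin_iff.2 ⟨tendsto_const_nhds.prodMk_nhds ht, ?_⟩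
      filter_upwards [Ioo_mem_nhdsGT (zero_lt_one' ℝ)] with s hs
      exact ⟨hx, hyy s hs⟩
    exact h1.tendsto.comp h2
  refine ge_of_tendsto hcont ?_
  filter_upwards [Ioo_mem_nhdsGT (zero_lt_one' ℝ)] with s hs
  exact (key s hs).1

/-- The saddle inequality F(x, y*) ≥ f(x*) is combined with the growth of F(x, ·) below its maximum.
The drift of best responses is thus paid by primal gaps, with no factor L/μd. -/
theorem sq_dualBest_sub_le {xstar : Vec n} (hxs : xstar ∈ X)
    (hmin : IsMinOn (primalObj F Y) X xstar) {x : Vec n} (hx : x ∈ X) :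
    μd / 2 * ‖dualBest F Y x - dualBest F Y xstar‖ ^ 2
      ≤ primalObj F Y x - primalObj F Y xstar := by
  have h1 := hF.primalObj_le_of_isMinOn hμd hYne hxs hmin hx
  have h2 := hF.add_le_dualBest hμd hYne hx (hF.dualBest_spec hμd hYne hxs).1
  rw [← hF.primalObj_eq hμd hYne hx, norm_sub_rev] at h2
  linarith

end Dual

end IsMinimaxProblem

/-! ### Euclidean inequalities and the ghost step. -/

section InnerProduct

variable {E : Type*} [NormedAddCommGroup E]

theorem norm_add_four_sq_le (a b c d : E) :
    ‖a + b + c + d‖ ^ 2 ≤ 4 * (‖a‖ ^ 2 + ‖b‖ ^ 2 + ‖c‖ ^ 2 + ‖d‖ ^ 2) := by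
  have h : ‖a + b + c + d‖ ≤ ‖a‖ + ‖b‖ + ‖c‖ + ‖d‖ := norm_add₄_le
  have h2 := pow_le_pow_left₀ (norm_nonneg _) h 2
  nlinarith [sq_nonneg (‖a‖ - ‖b‖), sq_nonneg (‖a‖ - ‖c‖), sq_nonneg (‖a‖ - ‖d‖),
    sq_nonneg (‖b‖ - ‖c‖), sq_nonneg (‖b‖ - ‖d‖), sq_nonneg (‖c‖ - ‖d‖)]

theorem norm_sub_sq_le_two_mul (a b c : E) :
    ‖a - c‖ ^ 2 ≤ 2 * ‖a - b‖ ^ 2 + 2 * ‖b - c‖ ^ 2 := by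
  have h2 := pow_le_pow_left₀ (norm_nonneg _) (norm_sub_le_norm_sub_add_norm_sub a b c) 2
  nlinarith [sq_nonneg (‖a - b‖ - ‖b - c‖)]

variable [InnerProductSpace ℝ E]

theorem mul_inner_le_sq_add (η : ℝ) (a b : E) :
    η * inner ℝ a b ≤ η ^ 2 * ‖a‖ ^ 2 + 1 / 4 * ‖b‖ ^ 2 := by
  have h := sq_nonneg ‖η • a - (1 / 2 : ℝ) • b‖
  rw [norm_sub_sq_real, norm_smul, norm_smul, inner_smul_left, inner_smul_right, mul_pow, mul_pow,
    Real.norm_eq_abs, Real.norm_eq_abs, sq_abs, sq_abs] at h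
  simp only [conj_trivial] at h
  linarith

/-- One step of the auxiliary sequence that absorbs the correlation between the oracle noise and
the dual comparison point. -/
noncomputable def ghostStep (η β : ℝ) (v e yh : E) : E :=
  (1 + η * β)⁻¹ • (v - η • e + (η * β) • yh)

/-- `ghostStep` is the unconstrained minimizer in w of η⟨e, w⟩ + (ηβ/2)‖w - yh‖² + ½‖w - v‖², so y -
`ghostStep` is a weighted mean of `u` and `b`; the inequality is convexity of the squared norm. No
projection on Y is involved. -/
theorem ghostStep_le {η β : ℝ} (hη : 0 ≤ η) (hβ : 0 ≤ β) (v e yh y : E) :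
    (1 + η * β) / 2 * ‖y - ghostStep η β v e yh‖ ^ 2 ≤
      1 / 2 * ‖y - v‖ ^ 2 + η * inner ℝ e (y - v) + η * β / 2 * ‖y - yh‖ ^ 2
        + 1 / 2 * η ^ 2 * ‖e‖ ^ 2 := by
  have hθ : 0 ≤ η * β := mul_nonneg hη hβ
  set θ := η * β with hθdef
  have hc : 0 < 1 + θ := by linarith
  set u := (y - v) + η • e with hu
  set b := y - yh with hb
  have h1 : y - ghostStep η β v e yh = (1 + θ)⁻¹ • (u + θ • b) := by
    have : y = (1 + θ)⁻¹ • ((1 + θ) • y) := by rw [smul_smul, inv_mul_cancel₀ hc.ne', one_smul]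
    rw [ghostStep, ← hθdef]
    nth_rewrite 1 [this]
    rw [← smul_sub]
    congr 1
    rw [hu, hb]
    module
  have h2 : ‖u + θ • b‖ ^ 2 = (1 + θ) * (‖u‖ ^ 2 + θ * ‖b‖ ^ 2) - θ * ‖u - b‖ ^ 2 := by
    rw [norm_add_sq_real, norm_sub_sq_real u b, norm_smul, inner_smul_right, mul_pow,
      Real.norm_eq_abs, sq_abs]
    ring
  have h3 : ‖u‖ ^ 2 = ‖y - v‖ ^ 2 + 2 * (η * inner ℝ e (y - v)) + η ^ 2 * ‖e‖ ^ 2 := by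
    rw [hu, norm_add_sq_real, norm_smul, inner_smul_right, mul_pow, Real.norm_eq_abs, sq_abs,
      real_inner_comm]
  have h4 : (1 + θ) / 2 * ‖y - ghostStep η β v e yh‖ ^ 2
      = 1 / 2 * (‖u‖ ^ 2 + θ * ‖b‖ ^ 2) - θ / (2 * (1 + θ)) * ‖u - b‖ ^ 2 := by
    rw [h1, norm_smul, mul_pow, Real.norm_eq_abs, sq_abs, h2]
    field_simp
  have h5 : 0 ≤ θ / (2 * (1 + θ)) * ‖u - b‖ ^ 2 := by positivity
  rw [h4, h3]
  linarith

end InnerProduct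

/-! ### The one-step inequality for SREG. -/

/-- The two proximal steps of an extragradient iteration, combined. -/
theorem extraPoint_regExtraPoint_le {n m : ℕ} {X : Set (Vec n)} {Y : Set (Vec m)}
    (hX : IsCompact X) (hY : IsCompact Y) (hXc : Convex ℝ X) (hYc : Convex ℝ Y) {η β μ : ℝ}
    (hη : 0 ≤ η) (hβ : 0 ≤ β) (hμ : 0 ≤ μ) {z zh z' G Gh : Pt n m}
    (hzh : zh = extraPoint X Y η G z) (hz' : z' = regExtraPoint X Y β μ η Gh zh z)
    {x : Vec n} (hx : x ∈ X) {y : Vec m} (hy : y ∈ Y) :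
    η * inner ℝ Gh.1 (zh.1 - x) + η * inner ℝ Gh.2 (zh.2 - y)
      + (1 + η * β) / 2 * ‖x - z'.1‖ ^ 2 + (1 + η * μ) / 2 * ‖y - z'.2‖ ^ 2
      + 1 / 2 * (‖zh.1 - z.1‖ ^ 2 + ‖zh.2 - z.2‖ ^ 2)
      + 1 / 2 * (‖zh.1 - z'.1‖ ^ 2 + ‖zh.2 - z'.2‖ ^ 2)
      ≤ 1 / 2 * (‖x - z.1‖ ^ 2 + ‖y - z.2‖ ^ 2)
        + η * (β / 2 * ‖x - zh.1‖ ^ 2 + μ / 2 * ‖y - zh.2‖ ^ 2)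
        + (η * inner ℝ (Gh.1 - G.1) (zh.1 - z'.1) + η * inner ℝ (G.2 - Gh.2) (z'.2 - zh.2)) := by
  have hw : ((x, y) : Pt n m) ∈ X ×ˢ Y := ⟨hx, hy⟩
  have hz'm : z' ∈ X ×ˢ Y := by
    rw [hz']
    exact (regExtraPoint_mem_isMinOn hX hY ⟨x, hx⟩ ⟨y, hy⟩ _ _ _).1
  -- `A` tests the regularized step against (x, y), `B` tests the extrapolation against z'; in their
  -- sum ½‖z' - z‖² cancels.
  have A := regExtraPoint_add_le (μX := β) (μY := μ) (η := η) hX hY hXc hYc Gh zh z hw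
  rw [← hz'] at A
  have B := regExtraPoint_add_le (μX := 0) (μY := 0) (η := η) hX hY hXc hYc G z z hz'm
  rw [← extraPoint_eq_regExtraPoint, ← hzh] at B
  rw [norm_sub_rev zh.1 z'.1, norm_sub_rev zh.2 z'.2]
  have h1 : 0 ≤ η * (β / 2 * ‖z'.1 - zh.1‖ ^ 2) := by positivity
  have h2 : 0 ≤ η * (μ / 2 * ‖z'.2 - zh.2‖ ^ 2) := by positivity
  simp only [proxObj, zero_div, zero_mul, mul_zero, add_zero] at A B
  simp only [inner_sub_left, inner_sub_right]
  linarith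

namespace IsMinimaxProblem

variable {n m : ℕ} {X : Set (Vec n)} {Y : Set (Vec m)} {F : Vec n → Vec m → ℝ}
  {gradF : Pt n m → Pt n m} {μd L : ℝ}

/-- The operator difference splits into two oracle errors, a gradient difference and a prox
difference. The last two cost at most 8η²L²‖ẑ - z‖², which ηL ≤ 1/16 fits into the ½‖ẑ - z‖² gained
by the extragradient step. The point z need not lie in X: only the Lipschitz bound is used there. -/
theorem sq_norm_operator_sub_le (hF : IsMinimaxProblem X Y F gradF 0 μd L) (hL : 0 ≤ L) {η β : ℝ}
    (hη : 0 ≤ η) (hβ : 0 ≤ β) (hηL : η * L ≤ 1 / 16) (hβL : 4 * β ≤ L)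
    {z zh gz gh : Pt n m} (xc : Vec n) (hz : z ∈ queryDom X ×ˢ Y) (hzh : zh ∈ queryDom X ×ˢ Y) :
    η ^ 2 * ‖(gh.1 + β • (zh.1 - xc)) - (gz.1 + β • (z.1 - xc))‖ ^ 2
        + η ^ 2 * ‖gz.2 - gh.2‖ ^ 2
      ≤ 4 * η ^ 2 * ((‖gz.1 - (gradF z).1‖ ^ 2 + ‖gz.2 - (gradF z).2‖ ^ 2)
            + (‖gh.1 - (gradF zh).1‖ ^ 2 + ‖gh.2 - (gradF zh).2‖ ^ 2))
        + 1 / 2 * (‖zh.1 - z.1‖ ^ 2 + ‖zh.2 - z.2‖ ^ 2) := by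
  have hLip := hF.lipschitz zh hzh z hz
  have E1 : ‖(gh.1 + β • (zh.1 - xc)) - (gz.1 + β • (z.1 - xc))‖ ^ 2 ≤
      4 * (‖gh.1 - (gradF zh).1‖ ^ 2 + ‖gz.1 - (gradF z).1‖ ^ 2
        + ‖(gradF zh).1 - (gradF z).1‖ ^ 2 + β ^ 2 * ‖zh.1 - z.1‖ ^ 2) := by
    have h1 : (gh.1 + β • (zh.1 - xc)) - (gz.1 + β • (z.1 - xc))
        = (gh.1 - (gradF zh).1) + (-(gz.1 - (gradF z).1)) + ((gradF zh).1 - (gradF z).1)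
          + β • (zh.1 - z.1) := by
      module
    have h2 := norm_add_four_sq_le (gh.1 - (gradF zh).1) (-(gz.1 - (gradF z).1))
      ((gradF zh).1 - (gradF z).1) (β • (zh.1 - z.1))
    rw [norm_neg, norm_smul, mul_pow, Real.norm_eq_abs, sq_abs] at h2
    rw [h1]; exact h2
  have E2 : ‖gz.2 - gh.2‖ ^ 2 ≤
      4 * (‖gh.2 - (gradF zh).2‖ ^ 2 + ‖gz.2 - (gradF z).2‖ ^ 2
        + ‖(gradF zh).2 - (gradF z).2‖ ^ 2) := by
    have h1 : gz.2 - gh.2 = (-(gh.2 - (gradF zh).2)) + (gz.2 - (gradF z).2)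
        + (-((gradF zh).2 - (gradF z).2)) + 0 := by
      module
    have h2 := norm_add_four_sq_le (-(gh.2 - (gradF zh).2)) (gz.2 - (gradF z).2)
      (-((gradF zh).2 - (gradF z).2)) 0
    rw [norm_neg, norm_neg, norm_zero] at h2
    rw [h1]; linarith
  have hη2 : 0 ≤ η ^ 2 := sq_nonneg η
  have hβ2 : β ^ 2 ≤ L ^ 2 / 16 := by nlinarith
  have hηL2 : η ^ 2 * L ^ 2 ≤ 1 / 256 := by
    have : 0 ≤ η * L := mul_nonneg hη hL
    nlinarith
  have hNx := sq_nonneg ‖zh.1 - z.1‖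
  have hNy := sq_nonneg ‖zh.2 - z.2‖
  have h1 : ‖(gradF zh).1 - (gradF z).1‖ ^ 2 + β ^ 2 * ‖zh.1 - z.1‖ ^ 2
      + ‖(gradF zh).2 - (gradF z).2‖ ^ 2 ≤
        2 * L ^ 2 * (‖zh.1 - z.1‖ ^ 2 + ‖zh.2 - z.2‖ ^ 2) := by
    linarith [mul_le_mul_of_nonneg_right hβ2 hNx, mul_nonneg (sq_nonneg L) hNx,
      mul_nonneg (sq_nonneg L) hNy]
  have E3 : 4 * η ^ 2 * (‖(gradF zh).1 - (gradF z).1‖ ^ 2 + β ^ 2 * ‖zh.1 - z.1‖ ^ 2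
      + ‖(gradF zh).2 - (gradF z).2‖ ^ 2)
      ≤ 1 / 2 * (‖zh.1 - z.1‖ ^ 2 + ‖zh.2 - z.2‖ ^ 2) := by
    calc _ ≤ 4 * η ^ 2 * (2 * L ^ 2 * (‖zh.1 - z.1‖ ^ 2 + ‖zh.2 - z.2‖ ^ 2)) := by gcongr
      _ = 8 * (η ^ 2 * L ^ 2) * (‖zh.1 - z.1‖ ^ 2 + ‖zh.2 - z.2‖ ^ 2) := by ring
      _ ≤ _ := by gcongr; linarith
  have E1' := mul_le_mul_of_nonneg_left E1 hη2
  have E2' := mul_le_mul_of_nonneg_left E2 hη2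
  linarith

/-- One step of SREG on the proximal subproblem with center `xc`; `gz` and `gh` are the oracle
answers at `z` and `zh`. -/
theorem sreg_step (hF : IsMinimaxProblem X Y F gradF 0 μd L) (hL : 0 ≤ L) {η β : ℝ}
    (hη : 0 ≤ η) (hβ : 0 ≤ β) (hηL : η * L ≤ 1 / 16) (hβμ : 4 * β ≤ μd) (hβL : 4 * β ≤ L)
    {z zh z' gz gh : Pt n m} {xc : Vec n} (v : Vec m) (hz : z ∈ queryDom X ×ˢ Y)
    (hzh : zh = extraPoint X Y η (gz.1 + β • (z.1 - xc), - gz.2) z)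
    (hz' : z' = regExtraPoint X Y β μd η (gh.1 + β • (zh.1 - xc), - gh.2) zh z)
    {x : Vec n} (hx : x ∈ X) {y : Vec m} (hy : y ∈ Y) :
    η * (F zh.1 y - F x zh.2 - β / 2 * ‖x - xc‖ ^ 2)
      + (1 + η * β) / 2 * (‖x - z'.1‖ ^ 2 + ‖y - z'.2‖ ^ 2
          + ‖y - ghostStep η β v (gh.2 - (gradF zh).2) zh.2‖ ^ 2)
      ≤ 1 / 2 * (‖x - z.1‖ ^ 2 + ‖y - z.2‖ ^ 2 + ‖y - v‖ ^ 2)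
        + (5 * η ^ 2 * ((‖gz.1 - (gradF z).1‖ ^ 2 + ‖gz.2 - (gradF z).2‖ ^ 2)
            + (‖gh.1 - (gradF zh).1‖ ^ 2 + ‖gh.2 - (gradF zh).2‖ ^ 2))
          + η * (inner ℝ (gh.1 - (gradF zh).1) (x - zh.1)
            + inner ℝ (gh.2 - (gradF zh).2) (zh.2 - v))) := by
  have hμ : 0 ≤ μd := by linarith
  have hzhm : zh ∈ X ×ˢ Y := by
    rw [hzh, extraPoint_eq_regExtraPoint]
    exact (regExtraPoint_mem_isMinOn hF.compactX hF.compactY ⟨x, hx⟩ ⟨y, hy⟩ _ _ _).1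
  have A := extraPoint_regExtraPoint_le hF.compactX hF.compactY hF.convexX hF.convexY hη hβ hμ
    hzh hz' hx hy
  have hG := ghostStep_le hη hβ v (gh.2 - (gradF zh).2) zh.2 y
  have D1 := mul_le_mul_of_nonneg_left (hF.inner_le_sub hx hzhm.1 hzhm.2) hη
  have D2 := mul_le_mul_of_nonneg_left (hF.strongly_concave zh.1 hzhm.1 y hy zh.2 hzhm.2) hη
  have E := hF.sq_norm_operator_sub_le hL hη hβ hηL hβL (gz := gz) (gh := gh) xc hz
    ⟨subset_queryDom X hzhm.1, hzhm.2⟩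
  have C1 := mul_inner_le_sq_add η ((gh.1 + β • (zh.1 - xc)) - (gz.1 + β • (z.1 - xc)))
    (zh.1 - z'.1)
  have C2 := mul_inner_le_sq_add η (gz.2 - gh.2) (zh.2 - z'.2)
  have hθ : η * β ≤ 1 / 64 := by nlinarith
  have hθ0 : 0 ≤ η * β := mul_nonneg hη hβ
  -- The ghost step costs (ηβ/2)‖y - ŷ‖². Only the rate β is kept in the y-direction, and the unused
  -- concavity μd - β ≥ 3β pays for it; half of the available ½‖ŷ - y'‖² covers the remainder, the
  -- other half is used by Young's inequality in `C2`.
  have F2 : η * β / 2 * ‖y - zh.2‖ ^ 2 ≤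
      η * (μd - β) / 2 * ‖y - z'.2‖ ^ 2 + 1 / 4 * ‖zh.2 - z'.2‖ ^ 2 := by
    rw [norm_sub_rev zh.2]
    have h1 : η * (3 * β) ≤ η * (μd - β) := by gcongr; linarith
    have h2 := mul_le_mul_of_nonneg_left (norm_sub_sq_le_two_mul y z'.2 zh.2)
      (show 0 ≤ η * β / 2 by linarith)
    have h3 := mul_le_mul_of_nonneg_right h1 (sq_nonneg ‖y - z'.2‖)
    have h4 := mul_le_mul_of_nonneg_right hθ (sq_nonneg ‖z'.2 - zh.2‖)
    have h5 := mul_nonneg hθ0 (sq_nonneg ‖y - z'.2‖)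
    linarith [sq_nonneg ‖z'.2 - zh.2‖]
  have Q1 : inner ℝ (gh.1 + β • (zh.1 - xc)) (zh.1 - x)
      = - inner ℝ (gh.1 - (gradF zh).1) (x - zh.1) - inner ℝ (gradF zh).1 (x - zh.1)
        + β / 2 * (‖zh.1 - xc‖ ^ 2 + ‖x - zh.1‖ ^ 2 - ‖x - xc‖ ^ 2) := by
    have h1 : ‖x - xc‖ ^ 2 = ‖zh.1 - xc‖ ^ 2 + 2 * inner ℝ (zh.1 - xc) (x - zh.1)
        + ‖x - zh.1‖ ^ 2 := by
      rw [← norm_add_sq_real]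
      congr 2
      abel
    rw [h1, ← neg_sub x zh.1, inner_neg_right, inner_add_left, inner_smul_left, inner_sub_left gh.1]
    simp only [conj_trivial]
    ring
  -- Insertion of v: the pairing with y - v cancels against the one in `hG`, the pairing with v - ŷ
  -- stays as mean-zero noise.
  have Q2 : inner ℝ (-gh.2) (zh.2 - y)
      = inner ℝ (gh.2 - (gradF zh).2) (y - v) + inner ℝ (gh.2 - (gradF zh).2) (v - zh.2)
        + inner ℝ (gradF zh).2 (y - zh.2) := by
    rw [← inner_add_right, inner_neg_left, ← inner_neg_right, neg_sub, sub_add_sub_cancel,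
      inner_sub_left]
    ring
  have Q3 : inner ℝ (gh.2 - (gradF zh).2) (zh.2 - v)
      = - inner ℝ (gh.2 - (gradF zh).2) (v - zh.2) := by
    rw [← inner_neg_right, neg_sub]
  have Q4 : inner ℝ (-gz.2 - -gh.2) (z'.2 - zh.2) = inner ℝ (gz.2 - gh.2) (zh.2 - z'.2) := by
    rw [← neg_sub zh.2, inner_neg_right, ← inner_neg_left]
    congr 1
    abel
  rw [Q1, Q2, Q4] at A
  rw [Q3]
  have hPx : 0 ≤ η * (β / 2 * ‖zh.1 - xc‖ ^ 2) := by positivity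
  have hd1 : 0 ≤ η ^ 2 * ‖gz.1 - (gradF z).1‖ ^ 2 := by positivity
  have hd2 : 0 ≤ η ^ 2 * ‖gz.2 - (gradF z).2‖ ^ 2 := by positivity
  have he1 : 0 ≤ η ^ 2 * ‖gh.1 - (gradF zh).1‖ ^ 2 := by positivity
  have he2 : 0 ≤ η ^ 2 * ‖gh.2 - (gradF zh).2‖ ^ 2 := by positivity
  have hz1 : 0 ≤ 1 / 4 * ‖zh.1 - z'.1‖ ^ 2 := by positivity
  linarith

end IsMinimaxProblem

/-! ### A whole run of SREG on one proximal subproblem. -/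

section Run

variable {n m : ℕ} {Ξ : Type*} (X : Set (Vec n)) (Y : Set (Vec m)) (gradF : Pt n m → Pt n m)
  (g : Pt n m → Ξ → Pt n m) (β μ η : ℝ) (xc : Vec n) (init : SregState n m) (s : ℕ → Ξ)

/-- The states of SREG on the proximal subproblem with center `xc`, with constant stepsize. -/
noncomputable def proxState (t : ℕ) : SregState n m :=
  sregState X Y (proxOperator g β xc) s β μ (fun _ => η) init t

/-- The extrapolated points of SREG on the proximal subproblem. -/
noncomputable def proxHat (t : ℕ) : Pt n m :=
  sregHat X Y (proxOperator g β xc) s η (proxState X Y g β μ η xc init s t)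

/-- Oracle error at the iterate. -/
noncomputable def proxErr (t : ℕ) : Pt n m :=
  g (proxState X Y g β μ η xc init s t).z (s (proxState X Y g β μ η xc init s t).calls)
    - gradF (proxState X Y g β μ η xc init s t).z

/-- Oracle error at the extrapolated point. -/
noncomputable def proxHatErr (t : ℕ) : Pt n m :=
  g (proxHat X Y g β μ η xc init s t) (s ((proxState X Y g β μ η xc init s t).calls + 1))
    - gradF (proxHat X Y g β μ η xc init s t)

/-- The auxiliary dual sequence of a run. -/
noncomputable def proxGhost : ℕ → Vec m
  | 0 => init.z.2
  | t + 1 => ghostStep η β (proxGhost t) (proxHatErr X Y gradF g β μ η xc init s t).2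
      (proxHat X Y g β μ η xc init s t).2

/-- The contribution of the oracle errors in step `t`, relative to the primal point `x`. -/
noncomputable def proxNoise (x : Vec n) (t : ℕ) : ℝ :=
  5 * η ^ 2 * ((‖(proxErr X Y gradF g β μ η xc init s t).1‖ ^ 2
      + ‖(proxErr X Y gradF g β μ η xc init s t).2‖ ^ 2)
    + (‖(proxHatErr X Y gradF g β μ η xc init s t).1‖ ^ 2
      + ‖(proxHatErr X Y gradF g β μ η xc init s t).2‖ ^ 2))
  + η * (inner ℝ (proxHatErr X Y gradF g β μ η xc init s t).1
        (x - (proxHat X Y g β μ η xc init s t).1)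
      + inner ℝ (proxHatErr X Y gradF g β μ η xc init s t).2
        ((proxHat X Y g β μ η xc init s t).2 - proxGhost X Y gradF g β μ η xc init s t))

/-- The total contribution of the oracle errors to the estimate for the output. -/
noncomputable def stageNoise (T : ℕ) (x : Vec n) : ℝ :=
  β / ((1 + β * η) ^ T - 1) *
    ∑ t ∈ Finset.range T, (1 + β * η) ^ t * proxNoise X Y gradF g β μ η xc init s x t

theorem proxState_succ_z (t : ℕ) :
    (proxState X Y g β μ η xc init s (t + 1)).z =
      regExtraPoint X Y β μ η
        (proxOperator g β xc (proxHat X Y g β μ η xc init s t)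
          (s ((proxState X Y g β μ η xc init s t).calls + 1)))
        (proxHat X Y g β μ η xc init s t) (proxState X Y g β μ η xc init s t).z := rfl

theorem proxHat_eq (t : ℕ) :
    proxHat X Y g β μ η xc init s t =
      extraPoint X Y η (proxOperator g β xc (proxState X Y g β μ η xc init s t).z
        (s (proxState X Y g β μ η xc init s t).calls))
        (proxState X Y g β μ η xc init s t).z := rfl

theorem proxState_calls (t : ℕ) :
    (proxState X Y g β μ η xc init s t).calls = init.calls + 2 * t := by
  induction t with
  | zero => rfl
  | succ t ih =>
    change (proxState X Y g β μ η xc init s t).calls + 2 = _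
    rw [ih]; ring

theorem proxHat_mem (hX : IsCompact X) (hY : IsCompact Y) (hXne : X.Nonempty) (hYne : Y.Nonempty)
    (t : ℕ) : proxHat X Y g β μ η xc init s t ∈ X ×ˢ Y := by
  rw [proxHat_eq, extraPoint_eq_regExtraPoint]
  exact (regExtraPoint_mem_isMinOn hX hY hXne hYne _ _ _).1

theorem proxState_succ_mem (hX : IsCompact X) (hY : IsCompact Y) (hXne : X.Nonempty)
    (hYne : Y.Nonempty) (t : ℕ) : (proxState X Y g β μ η xc init s (t + 1)).z ∈ X ×ˢ Y := by
  rw [proxState_succ_z]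
  exact (regExtraPoint_mem_isMinOn hX hY hXne hYne _ _ _).1

theorem proxState_mem (hX : IsCompact X) (hY : IsCompact Y) (hXne : X.Nonempty)
    (hYne : Y.Nonempty) (hinit : init.z ∈ queryDom X ×ˢ Y) (t : ℕ) :
    (proxState X Y g β μ η xc init s t).z ∈ queryDom X ×ˢ Y := by
  cases t with
  | zero => exact hinit
  | succ t =>
    have h := proxState_succ_mem X Y g β μ η xc init s hX hY hXne hYne t
    exact ⟨IsMinimaxProblem.subset_queryDom X h.1, h.2⟩

theorem sregWeight_const (β η : ℝ) (t : ℕ) : sregWeight β (fun _ => η) t = (1 + β * η) ^ t := by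
  simp [sregWeight]

theorem sum_mul_sregWeight {β : ℝ} (hβ : β ≠ 0) (η : ℝ) (T : ℕ) :
    ∑ t ∈ Finset.range T, η * sregWeight β (fun _ => η) t = ((1 + β * η) ^ T - 1) / β := by
  simp only [sregWeight_const]
  rw [← Finset.mul_sum, eq_div_iff hβ, ← geom_sum_mul]
  ring

end Run

namespace IsMinimaxProblem

variable {n m : ℕ} {X : Set (Vec n)} {Y : Set (Vec m)} {F : Vec n → Vec m → ℝ}
  {gradF : Pt n m → Pt n m} {μd L : ℝ} {Ξ : Type*}

/-- Multiplied by (1 + βη)^t the one-step inequalities telescope. The ghost starts at the initial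
dual point, so the dual distance is counted twice: coefficient 1 instead of ½. -/
theorem sum_gap_le (hF : IsMinimaxProblem X Y F gradF 0 μd L) (hL : 0 ≤ L) {η β : ℝ}
    (hη : 0 ≤ η) (hβ : 0 ≤ β) (hηL : η * L ≤ 1 / 16) (hβμ : 4 * β ≤ μd) (hβL : 4 * β ≤ L)
    (g : Pt n m → Ξ → Pt n m) (xc : Vec n) {init : SregState n m}
    (hinit : init.z ∈ queryDom X ×ˢ Y) (s : ℕ → Ξ)
    {x : Vec n} (hx : x ∈ X) {y : Vec m} (hy : y ∈ Y) (T : ℕ) :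
    ∑ t ∈ Finset.range T, η * (1 + β * η) ^ t *
        (F (proxHat X Y g β μd η xc init s t).1 y - F x (proxHat X Y g β μd η xc init s t).2
          - β / 2 * ‖x - xc‖ ^ 2)
      + (1 + β * η) ^ T / 2 * (‖x - (proxState X Y g β μd η xc init s T).z.1‖ ^ 2
        + ‖y - (proxState X Y g β μd η xc init s T).z.2‖ ^ 2
        + ‖y - proxGhost X Y gradF g β μd η xc init s T‖ ^ 2)
      ≤ 1 / 2 * ‖x - init.z.1‖ ^ 2 + ‖y - init.z.2‖ ^ 2
        + ∑ t ∈ Finset.range T, (1 + β * η) ^ t * proxNoise X Y gradF g β μd η xc init s x t := by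
  induction T with
  | zero =>
    simp only [Finset.range_zero, Finset.sum_empty, pow_zero, proxState, sregState, proxGhost]
    linarith
  | succ T ih =>
    have h := hF.sreg_step hL hη hβ hηL hβμ hβL (xc := xc)
      (proxGhost X Y gradF g β μd η xc init s T)
      (proxState_mem X Y g β μd η xc init s hF.compactX hF.compactY ⟨x, hx⟩ ⟨y, hy⟩ hinit T)
      (proxHat_eq X Y g β μd η xc init s T) (proxState_succ_z X Y g β μd η xc init s T) hx hy
    have hΛ : 0 ≤ (1 + β * η) ^ T := by positivity
    have h' := mul_le_mul_of_nonneg_left h hΛ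
    rw [Finset.sum_range_succ, Finset.sum_range_succ, pow_succ (1 + β * η) T]
    simp only [proxNoise, proxGhost, proxErr, proxHatErr, Prod.fst_sub, Prod.snd_sub] at ih ⊢
    linarith

/-- Jensen's inequality from the tangent at the barycentre, where the gradient terms sum to zero. -/
theorem sum_mul_fst_ge (hF : IsMinimaxProblem X Y F gradF 0 μd L) {y : Vec m} (hy : y ∈ Y)
    {T : ℕ} {w : ℕ → ℝ} (hw : ∀ t ∈ Finset.range T, 0 ≤ w t) (hW : 0 < ∑ t ∈ Finset.range T, w t)
    {u : ℕ → Vec n} (hu : ∀ t ∈ Finset.range T, u t ∈ X) :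
    (Finset.range T).centerMass w u ∈ X ∧
      (∑ t ∈ Finset.range T, w t) * F ((Finset.range T).centerMass w u) y
        ≤ ∑ t ∈ Finset.range T, w t * F (u t) y := by
  have hp := hF.convexX.centerMass_mem hw hW hu
  refine ⟨hp, ?_⟩
  set p := (Finset.range T).centerMass w u with hpdef
  have h1 : ∀ t ∈ Finset.range T, w t * F p y + inner ℝ (gradF (p, y)).1 (w t • (u t - p))
      ≤ w t * F (u t) y := fun t ht => by
    rw [inner_smul_right, ← mul_add]
    have := hF.inner_le_sub (hu t ht) hp hy
    exact mul_le_mul_of_nonneg_left (by linarith) (hw t ht)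
  have h2 := Finset.sum_le_sum h1
  rw [Finset.sum_add_distrib, ← Finset.sum_mul, ← inner_sum] at h2
  have h3 : ∑ t ∈ Finset.range T, w t • (u t - p) = 0 := by
    simp only [smul_sub]
    rw [Finset.sum_sub_distrib, ← Finset.sum_smul, hpdef, Finset.centerMass, smul_smul,
      mul_inv_cancel₀ hW.ne', one_smul, sub_self]
  rwa [h3, inner_zero_right, add_zero] at h2

theorem sum_mul_snd_le (hF : IsMinimaxProblem X Y F gradF 0 μd L) (hμd : 0 ≤ μd) {x : Vec n}
    (hx : x ∈ X)
    {T : ℕ} {w : ℕ → ℝ} (hw : ∀ t ∈ Finset.range T, 0 ≤ w t) (hW : 0 < ∑ t ∈ Finset.range T, w t)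
    {u : ℕ → Vec m} (hu : ∀ t ∈ Finset.range T, u t ∈ Y) :
    (Finset.range T).centerMass w u ∈ Y ∧
      ∑ t ∈ Finset.range T, w t * F x (u t)
        ≤ (∑ t ∈ Finset.range T, w t) * F x ((Finset.range T).centerMass w u) := by
  have hp := hF.convexY.centerMass_mem hw hW hu
  refine ⟨hp, ?_⟩
  set p := (Finset.range T).centerMass w u with hpdef
  have h1 : ∀ t ∈ Finset.range T, w t * F x (u t)
      ≤ w t * F x p + inner ℝ (gradF (x, p)).2 (w t • (u t - p)) := fun t ht => by
    rw [inner_smul_right, ← mul_add]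
    have := hF.strongly_concave x hx _ (hu t ht) _ hp
    have h0 : 0 ≤ μd / 2 * ‖u t - p‖ ^ 2 := by positivity
    exact mul_le_mul_of_nonneg_left (by linarith) (hw t ht)
  have h2 := Finset.sum_le_sum h1
  rw [Finset.sum_add_distrib, ← Finset.sum_mul, ← inner_sum] at h2
  have h3 : ∑ t ∈ Finset.range T, w t • (u t - p) = 0 := by
    simp only [smul_sub]
    rw [Finset.sum_sub_distrib, ← Finset.sum_smul, hpdef, Finset.centerMass, smul_smul,
      mul_inv_cancel₀ hW.ne', one_smul, sub_self]
  rwa [h3, inner_zero_right, add_zero] at h2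

/-- The output of SREG on the proximal subproblem with center `xc`. -/
noncomputable def _root_.proxSreg (X : Set (Vec n)) (Y : Set (Vec m)) (g : Pt n m → Ξ → Pt n m)
    (β μ η : ℝ) (T : ℕ) (xc : Vec n) (init : SregState n m) (s : ℕ → Ξ) : SubOutput n m :=
  sreg X Y (proxOperator g β xc) s β μ (fun _ => η) T init

/-- The telescoped sum is divided by its total weight (Λ_T - 1)/β, and the ghost potential is
dropped. Since y is quantified after the output, it may be chosen as a best response to that output.
-/
theorem proxSreg_spec (hF : IsMinimaxProblem X Y F gradF 0 μd L) (hL : 0 ≤ L) {η β : ℝ}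
    (hη : 0 < η) (hβ : 0 < β) (hηL : η * L ≤ 1 / 16) (hβμ : 4 * β ≤ μd) (hβL : 4 * β ≤ L)
    (g : Pt n m → Ξ → Pt n m) (xc : Vec n) {init : SregState n m}
    (hinit : init.z ∈ queryDom X ×ˢ Y) (s : ℕ → Ξ) {T : ℕ} (hT : 0 < T)
    {x : Vec n} (hx : x ∈ X) :
    (proxSreg X Y g β μd η T xc init s).avg.1 ∈ X ∧
    (proxSreg X Y g β μd η T xc init s).avg.2 ∈ Y ∧
    (proxSreg X Y g β μd η T xc init s).last.1 ∈ X ∧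
    (proxSreg X Y g β μd η T xc init s).last.2 ∈ Y ∧
    ∀ y ∈ Y,
      F (proxSreg X Y g β μd η T xc init s).avg.1 y - F x (proxSreg X Y g β μd η T xc init s).avg.2
        - β / 2 * ‖x - xc‖ ^ 2
        + β * (1 + β * η) ^ T / ((1 + β * η) ^ T - 1) / 2 *
          (‖x - (proxSreg X Y g β μd η T xc init s).last.1‖ ^ 2
            + ‖y - (proxSreg X Y g β μd η T xc init s).last.2‖ ^ 2)
      ≤ β / ((1 + β * η) ^ T - 1) * (1 / 2 * ‖x - init.z.1‖ ^ 2 + ‖y - init.z.2‖ ^ 2)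
        + stageNoise X Y gradF g β μd η xc init s T x := by
  have hμd : 0 ≤ μd := by linarith
  have hYne : Y.Nonempty := ⟨_, hinit.2⟩
  set M := (1 + β * η) ^ T with hM
  have hM1 : 1 < M := one_lt_pow₀ (by nlinarith [mul_pos hβ hη]) hT.ne'
  set w : ℕ → ℝ := fun t => η * sregWeight β (fun _ => η) t with hw
  have hWsum : ∑ t ∈ Finset.range T, w t = (M - 1) / β := sum_mul_sregWeight hβ.ne' η T
  have hW : 0 < ∑ t ∈ Finset.range T, w t := by
    rw [hWsum]; exact div_pos (by linarith) hβ
  have hw0 : ∀ t ∈ Finset.range T, 0 ≤ w t := fun t _ => by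
    simp only [hw, sregWeight_const]; positivity
  have hmem := fun t => proxHat_mem X Y g β μd η xc init s hF.compactX hF.compactY ⟨x, hx⟩ hYne t
  have hlast : (proxSreg X Y g β μd η T xc init s).last = (proxState X Y g β μd η xc init s T).z :=
    rfl
  have hlm : (proxSreg X Y g β μd η T xc init s).last ∈ X ×ˢ Y := by
    rw [hlast]
    obtain ⟨t, rfl⟩ := Nat.exists_eq_succ_of_ne_zero hT.ne'
    exact proxState_succ_mem X Y g β μd η xc init s hF.compactX hF.compactY ⟨x, hx⟩ hYne t
  have e1 : (proxSreg X Y g β μd η T xc init s).avg.1 =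
      (Finset.range T).centerMass w fun t => (proxHat X Y g β μd η xc init s t).1 := by
    simp only [proxSreg, sreg, Finset.centerMass, Prod.smul_fst, Prod.fst_sum]
    rfl
  have e2 : (proxSreg X Y g β μd η T xc init s).avg.2 =
      (Finset.range T).centerMass w fun t => (proxHat X Y g β μd η xc init s t).2 := by
    simp only [proxSreg, sreg, Finset.centerMass, Prod.smul_snd, Prod.snd_sum]
    rfl
  have hyJ := hF.sum_mul_snd_le hμd hx hw0 hW
    (u := fun t => (proxHat X Y g β μd η xc init s t).2) fun t _ => (hmem t).2
  have hxJ := fun y (hy : y ∈ Y) => hF.sum_mul_fst_ge hy hw0 hW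
    (u := fun t => (proxHat X Y g β μd η xc init s t).1) fun t _ => (hmem t).1
  rw [← e2] at hyJ
  rw [← e1] at hxJ
  refine ⟨(hxJ _ hinit.2).1, hyJ.1, hlm.1, hlm.2, fun y hy => ?_⟩
  have h := hF.sum_gap_le hL hη.le hβ.le hηL hβμ hβL g xc hinit s hx hy T
  have h1 := (hxJ y hy).2
  have h2 := hyJ.2
  have h3 : ∑ t ∈ Finset.range T, η * (1 + β * η) ^ t *
        (F (proxHat X Y g β μd η xc init s t).1 y - F x (proxHat X Y g β μd η xc init s t).2
          - β / 2 * ‖x - xc‖ ^ 2) = ∑ t ∈ Finset.range T, w t * F (proxHat X Y g β μd η xc init s t).1 y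
        - ∑ t ∈ Finset.range T, w t * F x (proxHat X Y g β μd η xc init s t).2
        - (∑ t ∈ Finset.range T, w t) * (β / 2 * ‖x - xc‖ ^ 2) := by
    rw [Finset.sum_mul, ← Finset.sum_sub_distrib, ← Finset.sum_sub_distrib]
    refine Finset.sum_congr rfl fun t _ => ?_
    simp only [hw, sregWeight_const]
    ring
  rw [h3] at h
  rw [stageNoise, ← hM]
  rw [hlast]
  rw [hWsum] at h h1 h2
  set S := ∑ t ∈ Finset.range T, (1 + β * η) ^ t * proxNoise X Y gradF g β μd η xc init s x t
  have hc : 0 < β / (M - 1) := div_pos hβ (by linarith)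
  have hg0 : 0 ≤ M / 2 * ‖y - proxGhost X Y gradF g β μd η xc init s T‖ ^ 2 := by
    have : 0 ≤ M := by linarith
    positivity
  have h4 : (M - 1) / β * (F (proxSreg X Y g β μd η T xc init s).avg.1 y
      - F x (proxSreg X Y g β μd η T xc init s).avg.2 - β / 2 * ‖x - xc‖ ^ 2)
      + M / 2 * (‖x - (proxState X Y g β μd η xc init s T).z.1‖ ^ 2
        + ‖y - (proxState X Y g β μd η xc init s T).z.2‖ ^ 2)
      ≤ 1 / 2 * ‖x - init.z.1‖ ^ 2 + ‖y - init.z.2‖ ^ 2 + S := by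
    linarith
  have h5 := mul_le_mul_of_nonneg_left h4 hc.le
  have h6 : M - 1 ≠ 0 := by linarith
  have h7 : β / (M - 1) * ((M - 1) / β) = 1 := by field_simp
  calc _ = (β / (M - 1) * ((M - 1) / β)) * (F (proxSreg X Y g β μd η T xc init s).avg.1 y
      - F x (proxSreg X Y g β μd η T xc init s).avg.2 - β / 2 * ‖x - xc‖ ^ 2)
      + β / (M - 1) * (M / 2 * (‖x - (proxState X Y g β μd η xc init s T).z.1‖ ^ 2
        + ‖y - (proxState X Y g β μd η xc init s T).z.2‖ ^ 2)) := by rw [h7]; ring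
    _ = _ := by rw [mul_assoc (β / (M - 1)), ← mul_add]
    _ ≤ _ := h5
    _ = _ := by ring

end IsMinimaxProblem

/-! ### Recursions for the outer loop -/

/-- The weights `(k+1)(k+2)` of the outer recursion. -/
noncomputable def outerWeight (k : ℕ) : ℝ := (k + 1) * (k + 2)

theorem outerWeight_pos (k : ℕ) : 0 < outerWeight k := by unfold outerWeight; positivity

theorem outerWeight_mono : Monotone outerWeight := fun a b h => by
  unfold outerWeight
  gcongr

theorem betaSeq_pos {μd : ℝ} (hμ : 0 < μd) (k : ℕ) : 0 < betaSeq μd k := by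
  unfold betaSeq; positivity

theorem four_mul_betaSeq_le {μd : ℝ} (hμ : 0 < μd) (k : ℕ) : 4 * betaSeq μd k ≤ μd := by
  unfold betaSeq
  rw [mul_div_assoc', div_le_iff₀ (by positivity)]
  nlinarith

theorem le_six_mul_betaSeq {μd : ℝ} (hμ : 0 < μd) {k : ℕ} (hk : 1 ≤ k) :
    μd ≤ 6 * betaSeq μd k := by
  have hk' : (1 : ℝ) ≤ k := by exact_mod_cast hk
  unfold betaSeq
  rw [mul_div_assoc', le_div_iff₀ (by positivity)]
  nlinarith

theorem outerWeight_mul_betaSeq (μd : ℝ) (k : ℕ) :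
    outerWeight k * betaSeq μd k = μd * (k + 1) ^ 2 / 4 := by
  unfold outerWeight betaSeq
  field_simp

/-- This governs the choice of the weights and of β_k: the coefficient of ‖x* - x̄_k‖² becomes
constant in k and telescopes. -/
theorem outerWeight_mul_betaSeq_mul_sq (μd : ℝ) (k : ℕ) :
    outerWeight k * betaSeq μd k * gammaSeq k ^ 2 = μd := by
  rw [outerWeight_mul_betaSeq]
  unfold gammaSeq
  field_simp
  ring

/-- The surplus 2 is the room in which the e-terms of the recursion are absorbed. -/
theorem outerWeight_succ_mul (k : ℕ) :
    outerWeight (k + 1) * (1 - gammaSeq (k + 1)) = outerWeight k - 2 := by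
  unfold gammaSeq outerWeight
  push_cast
  field_simp
  ring

section Recursion

variable {μd e : ℝ} {D B V Z N : ℕ → ℝ}

theorem weighted_step
    (h : ∀ k, D (k + 1) + betaSeq μd (k + 1) * (1 + e) * gammaSeq (k + 1) ^ 2 / 2 * B (k + 1)
        + betaSeq μd (k + 1) * (1 + e) / 2 * V (k + 1)
      ≤ (1 - gammaSeq (k + 1)) * D k
        + betaSeq μd (k + 1) * (1 + e) * gammaSeq (k + 1) ^ 2 / 2 * B k
        + betaSeq μd (k + 1) * e * Z (k + 1) + N (k + 1)) (k : ℕ) :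
    outerWeight (k + 1) * D (k + 1) + μd * (1 + e) / 2 * B (k + 1)
        + μd * (k + 2) ^ 2 / 4 * (1 + e) / 2 * V (k + 1)
      ≤ (outerWeight k - 2) * D k + μd * (1 + e) / 2 * B k
        + μd * (k + 2) ^ 2 / 4 * e * Z (k + 1) + outerWeight (k + 1) * N (k + 1) := by
  have h1 := mul_le_mul_of_nonneg_left (h k) (outerWeight_pos (k + 1)).le
  have h2 := outerWeight_mul_betaSeq_mul_sq μd (k + 1)
  have h3 := outerWeight_mul_betaSeq μd (k + 1)
  have h4 := outerWeight_succ_mul k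
  push_cast at h3
  rw [show ((k : ℝ) + 1 + 1) = k + 2 by ring] at h3
  rw [← h4, ← h3]
  nth_rewrite 1 3 [← h2]
  linarith

/-- By `hZ` the defect turns into multiples of e times D and V. The D-part fits into the surplus 2
of the weights because 2 e W_K ≤ 1, the V-part into the V kept on the left because e ≤ 1/16. -/
theorem outer_le_of_contraction (hμ : 0 < μd) (he : 0 ≤ e) (hD : ∀ k, 0 ≤ D k)
    (hV : ∀ k, 0 ≤ V k)
    (h : ∀ k, D (k + 1) + betaSeq μd (k + 1) * (1 + e) * gammaSeq (k + 1) ^ 2 / 2 * B (k + 1)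
        + betaSeq μd (k + 1) * (1 + e) / 2 * V (k + 1)
      ≤ (1 - gammaSeq (k + 1)) * D k
        + betaSeq μd (k + 1) * (1 + e) * gammaSeq (k + 1) ^ 2 / 2 * B k
        + betaSeq μd (k + 1) * e * Z (k + 1) + N (k + 1))
    (hZ : ∀ k, μd * Z (k + 1) ≤ 8 * (D (k + 1) + D k) + 2 * μd * V k)
    {K : ℕ} (he16 : e ≤ 1 / 16) (heK : 2 * outerWeight K * e ≤ 1) :
    ∀ k, k + 1 ≤ K →
      (1 - 2 * e) * outerWeight (k + 1) * D (k + 1) + μd * (1 + e) / 2 * B (k + 1)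
        + μd * (k + 2) ^ 2 / 4 * (1 + e) / 2 * V (k + 1)
      ≤ μd * (1 + e) / 2 * B 0 + 12 * e * D 0 + 2 * e * μd * V 0
        + ∑ j ∈ Finset.range (k + 1), outerWeight (j + 1) * N (j + 1) := by
  have key : ∀ k : ℕ, (1 - 2 * e) * outerWeight (k + 1) * D (k + 1) + μd * (1 + e) / 2 * B (k + 1)
        + μd * (k + 2) ^ 2 / 4 * (1 + e) / 2 * V (k + 1)
      ≤ (outerWeight k - 2 + 2 * e * outerWeight (k + 1)) * D k + μd * (1 + e) / 2 * B k
        + (k + 2) ^ 2 / 2 * e * μd * V k + outerWeight (k + 1) * N (k + 1) := by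
    intro k
    have h1 := weighted_step h k
    have h2 : (k + 2 : ℝ) ^ 2 / 4 * e * (μd * Z (k + 1)) ≤
        (k + 2 : ℝ) ^ 2 / 4 * e * (8 * (D (k + 1) + D k) + 2 * μd * V k) :=
      mul_le_mul_of_nonneg_left (hZ k) (by positivity)
    have h3 : (k + 2 : ℝ) ^ 2 * (2 * e * (D (k + 1) + D k)) ≤
        outerWeight (k + 1) * (2 * e * (D (k + 1) + D k)) := by
      have := hD k
      have := hD (k + 1)
      refine mul_le_mul_of_nonneg_right ?_ (by positivity)
      unfold outerWeight
      push_cast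
      nlinarith [(Nat.cast_nonneg k : (0 : ℝ) ≤ k)]
    linarith
  intro k
  induction k with
  | zero =>
    intro _
    -- W_0 - 2 = 0, so D 0 enters only through 2eW_1 = 12e.
    have := key 0
    simp only [Finset.sum_range_one, zero_add]
    norm_num [outerWeight] at this ⊢
    linarith
  | succ k ih =>
    intro hk
    have h1 := ih (by omega)
    have h2 := key (k + 1)
    rw [Finset.sum_range_succ]
    have hw1 : outerWeight (k + 1) ≤ outerWeight K := outerWeight_mono (by omega)
    have hw2 : outerWeight (k + 1 + 1) ≤ outerWeight K := outerWeight_mono (by omega)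
    have h3 : (outerWeight (k + 1) - 2 + 2 * e * outerWeight (k + 1 + 1)) * D (k + 1)
        ≤ (1 - 2 * e) * outerWeight (k + 1) * D (k + 1) := by
      refine mul_le_mul_of_nonneg_right ?_ (hD _)
      nlinarith [mul_le_mul_of_nonneg_right hw1 he, mul_le_mul_of_nonneg_right hw2 he]
    have h4 : (((k + 1 : ℕ) : ℝ) + 2) ^ 2 / 2 * e * μd * V (k + 1)
        ≤ μd * (k + 2) ^ 2 / 4 * (1 + e) / 2 * V (k + 1) := by
      refine mul_le_mul_of_nonneg_right ?_ (hV _)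
      have h5 : (((k + 1 : ℕ) : ℝ) + 2) ^ 2 * (4 * e) ≤ (k + 2) ^ 2 * (1 + e) := by
        have hk0 : (0 : ℝ) ≤ k := Nat.cast_nonneg k
        push_cast
        calc ((k : ℝ) + 1 + 2) ^ 2 * (4 * e) ≤ ((k : ℝ) + 1 + 2) ^ 2 * (1 / 4) := by gcongr; linarith
          _ ≤ ((k : ℝ) + 2) ^ 2 := by nlinarith
          _ ≤ ((k : ℝ) + 2) ^ 2 * (1 + e) := le_mul_of_one_le_right (by positivity) (by linarith)
      nlinarith
    linarith

/-- Here e need not be small: the defect is not absorbed but summed, each stage adding at most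
W_{k+1} · (μd/4) e d2. -/
theorem outer_le_of_bounded (hμ : 0 < μd) (he : 0 ≤ e) (hD : ∀ k, 0 ≤ D k) {d2 : ℝ}
    (h : ∀ k, D (k + 1) + betaSeq μd (k + 1) * (1 + e) * gammaSeq (k + 1) ^ 2 / 2 * B (k + 1)
        + betaSeq μd (k + 1) * (1 + e) / 2 * V (k + 1)
      ≤ (1 - gammaSeq (k + 1)) * D k
        + betaSeq μd (k + 1) * (1 + e) * gammaSeq (k + 1) ^ 2 / 2 * B k
        + betaSeq μd (k + 1) * e * Z (k + 1) + N (k + 1))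
    (hV : ∀ k, 0 ≤ V k) (hd2 : 0 ≤ d2) (hZ : ∀ k, Z (k + 1) ≤ d2) :
    ∀ k : ℕ, outerWeight (k + 1) * D (k + 1) + μd * (1 + e) / 2 * B (k + 1)
        + μd * (k + 2) ^ 2 / 4 * (1 + e) / 2 * V (k + 1)
      ≤ μd * (1 + e) / 2 * B 0 + (k + 1) * outerWeight (k + 1) * (μd / 4 * e * d2)
        + ∑ j ∈ Finset.range (k + 1), outerWeight (j + 1) * N (j + 1) := by
  have hc : 0 ≤ μd / 4 * e * d2 := by positivity
  have key : ∀ k : ℕ, outerWeight (k + 1) * D (k + 1) + μd * (1 + e) / 2 * B (k + 1)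
        + μd * (k + 2) ^ 2 / 4 * (1 + e) / 2 * V (k + 1)
      ≤ (outerWeight k - 2) * D k + μd * (1 + e) / 2 * B k
        + outerWeight (k + 1) * (μd / 4 * e * d2) + outerWeight (k + 1) * N (k + 1) := by
    intro k
    have h1 := weighted_step h k
    have h2 : μd * (k + 2) ^ 2 / 4 * e * Z (k + 1) ≤ (k + 2) ^ 2 * (μd / 4 * e * d2) := by
      have := mul_le_mul_of_nonneg_left (hZ k)
        (show 0 ≤ μd * (k + 2) ^ 2 / 4 * e by positivity)
      linarith
    have h3 : (k + 2 : ℝ) ^ 2 * (μd / 4 * e * d2) ≤ outerWeight (k + 1) * (μd / 4 * e * d2) := by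
      refine mul_le_mul_of_nonneg_right ?_ hc
      unfold outerWeight
      push_cast
      nlinarith [(Nat.cast_nonneg k : (0 : ℝ) ≤ k)]
    linarith
  intro k
  induction k with
  | zero =>
    have := key 0
    simp only [Finset.sum_range_one, zero_add]
    norm_num [outerWeight] at this ⊢
    linarith
  | succ k ih =>
    have h2 := key (k + 1)
    rw [Finset.sum_range_succ]
    have hw1 : outerWeight (k + 1) ≤ outerWeight (k + 1 + 1) := outerWeight_mono (by omega)
    have h3 : (k + 1) * outerWeight (k + 1) * (μd / 4 * e * d2) ≤
        (k + 1) * outerWeight (k + 1 + 1) * (μd / 4 * e * d2) := by gcongr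
    have h4 : 0 ≤ μd * (k + 2) ^ 2 / 4 * (1 + e) / 2 * V (k + 1) :=
      mul_nonneg (by positivity) (hV _)
    have := hD (k + 1)
    push_cast
    push_cast at h2
    linarith

end Recursion

/-! ### Parameters -/

section Parameters

variable {μd L DY σ : ℝ} {T : ℕ}

/-- The common value of `β_k η_k`. -/
noncomputable def thetaParam (μd L DY σ : ℝ) (T : ℕ) : ℝ :=
  min (μd / (96 * L)) (qParam μd DY σ T * Real.log T / T)

theorem one_le_qParam_mul_log (hT : 2 ≤ T) : 1 ≤ qParam μd DY σ T * Real.log T := by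
  have hl : 0 < Real.log T := Real.log_pos (by exact_mod_cast hT)
  calc (1 : ℝ) = 1 / Real.log T * Real.log T := by field_simp
    _ ≤ _ := by gcongr; exact le_max_right _ _

theorem qParam_mul_log_eq (hT : 2 ≤ T) : qParam μd DY σ T * Real.log T =
    max (2 * (Real.log (μd ^ 2 * DY ^ 2 / (16 * σ ^ 2)) + Real.log T)) 1 := by
  have hl : 0 < Real.log T := Real.log_pos (by exact_mod_cast hT)
  rw [qParam, max_mul_of_nonneg _ _ hl.le, div_mul_cancel₀ _ hl.ne', div_mul_cancel₀ _ hl.ne']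

theorem thetaParam_pos (hμ : 0 < μd) (hL : 0 < L) (hT : 2 ≤ T) :
    0 < thetaParam μd L DY σ T := by
  have := one_le_qParam_mul_log (μd := μd) (DY := DY) (σ := σ) hT
  have hT' : (0 : ℝ) < T := by exact_mod_cast (by omega : 0 < T)
  exact lt_min (by positivity) (by positivity)

/-- The product does not depend on k, so Λ_T, and with it e, is the same in all subproblems;
otherwise the outer recursion would not telescope. -/
theorem betaSeq_mul_stepSize (hμ : 0 < μd) (k : ℕ) :
    betaSeq μd k * stepSize μd L DY σ T k = thetaParam μd L DY σ T := by
  have hβ := betaSeq_pos hμ k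
  rw [stepSize, thetaParam, mul_min_of_nonneg _ _ hβ.le]
  congr 1
  · rw [betaSeq]
    by_cases hL : L = 0
    · simp [hL]
    · field_simp
      norm_num
  · by_cases hT : (T : ℝ) = 0
    · simp [hT]
    · field_simp

theorem stepSize_pos (hμ : 0 < μd) (hL : 0 < L) (hT : 2 ≤ T) (k : ℕ) :
    0 < stepSize μd L DY σ T k := by
  have h := betaSeq_mul_stepSize (L := L) (DY := DY) (σ := σ) (T := T) hμ k
  have h2 := thetaParam_pos (DY := DY) (σ := σ) hμ hL hT
  rw [← h] at h2
  exact pos_of_mul_pos_right h2 (betaSeq_pos hμ k).le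

/-- (k + 2)/(k + 1) ≤ 3/2, and 3/2 · 1/24 = 1/16. -/
theorem stepSize_mul_le (hL : 0 < L) {k : ℕ} (hk : 1 ≤ k) :
    stepSize μd L DY σ T k * L ≤ 1 / 16 := by
  have hk' : (1 : ℝ) ≤ k := by exact_mod_cast hk
  calc stepSize μd L DY σ T k * L ≤ (k + 2) / (24 * (k + 1) * L) * L := by
        gcongr; exact min_le_left _ _
    _ = (k + 2) / (24 * (k + 1)) := by field_simp
    _ ≤ 1 / 16 := by
      rw [div_le_div_iff₀ (by positivity) (by norm_num)]
      linarith

theorem bigLambda_eq : bigLambda μd L DY σ T = (1 + thetaParam μd L DY σ T) ^ T := rfl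

theorem one_lt_bigLambda (hμ : 0 < μd) (hL : 0 < L) (hT : 2 ≤ T) :
    1 < bigLambda μd L DY σ T := by
  rw [bigLambda_eq]
  exact one_lt_pow₀ (by linarith [thetaParam_pos (DY := DY) (σ := σ) hμ hL hT]) (by omega)

theorem stepSize_le (hμ : 0 < μd) (hT : 2 ≤ T) {k : ℕ} (hk : 1 ≤ k) :
    stepSize μd L DY σ T k ≤ 6 * (qParam μd DY σ T * Real.log T) / (μd * T) := by
  have hT' : (0 : ℝ) < T := by exact_mod_cast (by omega : 0 < T)
  have hq := one_le_qParam_mul_log (μd := μd) (DY := DY) (σ := σ) hT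
  have hβ := betaSeq_pos hμ k
  have h6 := le_six_mul_betaSeq hμ hk
  refine (min_le_right _ _).trans ?_
  rw [div_le_div_iff₀ (by positivity) (by positivity)]
  calc qParam μd DY σ T * Real.log T * (μd * T)
      ≤ qParam μd DY σ T * Real.log T * (6 * betaSeq μd k * T) := by gcongr
    _ = _ := by ring

end Parameters

/-! ### The outer scheme: call counts, location of the iterates, recursion. -/

section Outer

variable {n m : ℕ} {Ξ : Type*} (X : Set (Vec n)) (Y : Set (Vec m)) (gradF : Pt n m → Pt n m)
  (g : Pt n m → Ξ → Pt n m) (μd L σ : ℝ) (T : ℕ) (z₀ : Pt n m) (s : ℕ → Ξ)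

/-- The prox-center of subproblem `k + 1`. -/
noncomputable def catCenter (k : ℕ) : Vec n :=
  gammaSeq (k + 1) • (catalystSREG X Y g μd L σ T z₀ s k).xbar
    + (1 - gammaSeq (k + 1)) • (catalystSREG X Y g μd L σ T z₀ s k).ztil.1

/-- The starting state of subproblem `k + 1`. -/
noncomputable def catInit (k : ℕ) : SregState n m where
  z := (catCenter X Y g μd L σ T z₀ s k, (catalystSREG X Y g μd L σ T z₀ s k).z.2)
  calls := (catalystSREG X Y g μd L σ T z₀ s k).calls

/-- The primal comparison point of subproblem `k + 1`. -/
noncomputable def catRef (xstar : Vec n) (k : ℕ) : Vec n :=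
  gammaSeq (k + 1) • xstar
    + (1 - gammaSeq (k + 1)) • (catalystSREG X Y g μd L σ T z₀ s k).ztil.1

/-- The contribution of the oracle errors in subproblem `k + 1`. -/
noncomputable def catNoise (xstar : Vec n) (k : ℕ) : ℝ :=
  stageNoise X Y gradF g (betaSeq μd (k + 1)) μd (stepSize μd L (Metric.diam Y) σ T (k + 1))
    (catCenter X Y g μd L σ T z₀ s k) (catInit X Y g μd L σ T z₀ s k) s T
    (catRef X Y g μd L σ T z₀ s xstar k)

/-- The counter does not depend on the samples. This gives the complexity, and also tells which
samples a subproblem has not yet seen. -/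
theorem catalystSREG_calls (k : ℕ) : (catalystSREG X Y g μd L σ T z₀ s k).calls = 2 * T * k := by
  induction k with
  | zero => rfl
  | succ k ih =>
    have h : (catalystSREG X Y g μd L σ T z₀ s (k + 1)).calls =
        (catalystSREG X Y g μd L σ T z₀ s k).calls + 2 * T :=
      proxState_calls X Y g (betaSeq μd (k + 1)) μd (stepSize μd L (Metric.diam Y) σ T (k + 1))
        (catCenter X Y g μd L σ T z₀ s k) (catInit X Y g μd L σ T z₀ s k) s T
    rw [h, ih]; ring

variable {X Y g μd L σ T z₀ s}

theorem gammaSeq_pos (k : ℕ) : 0 < gammaSeq k := by unfold gammaSeq; positivity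

theorem gammaSeq_succ_le_one (k : ℕ) : gammaSeq (k + 1) ≤ 1 := by
  unfold gammaSeq
  rw [div_le_one (by positivity)]
  push_cast
  linarith [(Nat.cast_nonneg k : (0 : ℝ) ≤ k)]

theorem alphaSeq_pos (hμ : 0 < μd) (hL : 0 < L) (hT : 2 ≤ T) (DY σ : ℝ) (k : ℕ) :
    0 < alphaSeq μd L DY σ T k := by
  have h := one_lt_bigLambda (DY := DY) (σ := σ) hμ hL hT
  have := betaSeq_pos hμ k
  exact div_pos (mul_pos this (by linarith)) (by linarith)

/-- For μp = 0 the factor α cancels: x_k is the combination of x̄_k and x̃_{k-1} with weights γ and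
1 - γ. Only α ≠ 0 matters. -/
theorem gammaSeq_smul_xbar_succ (hμ : 0 < μd) (hL : 0 < L) (hT : 2 ≤ T) (k : ℕ) :
    gammaSeq (k + 1) • (catalystSREG X Y g μd L σ T z₀ s (k + 1)).xbar =
      (catalystSREG X Y g μd L σ T z₀ s (k + 1)).z.1
        - (1 - gammaSeq (k + 1)) • (catalystSREG X Y g μd L σ T z₀ s k).ztil.1 := by
  set α := alphaSeq μd L (Metric.diam Y) σ T (k + 1) with hα
  have hα0 : α ≠ 0 := (alphaSeq_pos hμ hL hT _ σ (k + 1)).ne'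
  have hγ0 := (gammaSeq_pos (k + 1)).ne'
  have h : (catalystSREG X Y g μd L σ T z₀ s (k + 1)).xbar =
      (1 / (α * gammaSeq (k + 1) + 0 * (1 - gammaSeq (k + 1)))) •
        (α • (catalystSREG X Y g μd L σ T z₀ s (k + 1)).z.1
          + ((0 - α) * (1 - gammaSeq (k + 1))) •
            (catalystSREG X Y g μd L σ T z₀ s k).ztil.1) := rfl
  rw [h, smul_smul, smul_add, smul_smul, smul_smul]
  rw [show gammaSeq (k + 1) * (1 / (α * gammaSeq (k + 1) + 0 * (1 - gammaSeq (k + 1)))) * α = 1 by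
      field_simp; ring,
    show gammaSeq (k + 1) * (1 / (α * gammaSeq (k + 1) + 0 * (1 - gammaSeq (k + 1))))
      * ((0 - α) * (1 - gammaSeq (k + 1))) = -(1 - gammaSeq (k + 1)) by field_simp; ring]
  module

end Outer

namespace IsMinimaxProblem

variable {n m : ℕ} {X : Set (Vec n)} {Y : Set (Vec m)} {F : Vec n → Vec m → ℝ}
  {gradF : Pt n m → Pt n m} {μd L σ : ℝ} {Ξ : Type*} {T : ℕ} {z₀ : Pt n m}
  {g : Pt n m → Ξ → Pt n m}

/-- The next prox-center is a convex combination of x_{k+1} and x̃_{k+1}, plus k/(k+3) times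
x̃_{k+1} - x̃_k. It may leave X, but by no more than diam X; this explains `queryDom`. -/
theorem catCenter_mem_of_mem (hF : IsMinimaxProblem X Y F gradF 0 μd L) (hμ : 0 < μd)
    (hL : 0 < L) (hT : 2 ≤ T) (s : ℕ → Ξ) {k : ℕ}
    (h0 : (catalystSREG X Y g μd L σ T z₀ s k).ztil.1 ∈ X)
    (h1 : (catalystSREG X Y g μd L σ T z₀ s (k + 1)).ztil.1 ∈ X)
    (hz : (catalystSREG X Y g μd L σ T z₀ s (k + 1)).z.1 ∈ X) :
    catCenter X Y g μd L σ T z₀ s (k + 1) ∈ queryDom X := by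
  set a := (catalystSREG X Y g μd L σ T z₀ s k).ztil.1
  set b := (catalystSREG X Y g μd L σ T z₀ s (k + 1)).ztil.1 with hb
  set z := (catalystSREG X Y g μd L σ T z₀ s (k + 1)).z.1
  have hk : (0 : ℝ) ≤ k := Nat.cast_nonneg k
  have hp : ((k + 2 : ℝ) / (k + 3)) • z + ((1 : ℝ) / (k + 3)) • b ∈ X :=
    hF.convexX hz h1 (by positivity) (by positivity) (by field_simp; ring)
  have hx : catCenter X Y g μd L σ T z₀ s (k + 1)
      = (((k + 2 : ℝ) / (k + 3)) • z + ((1 : ℝ) / (k + 3)) • b) + ((k : ℝ) / (k + 3)) • (b - a) := by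
    have hx1 := gammaSeq_smul_xbar_succ (X := X) (Y := Y) (g := g) (σ := σ) (z₀ := z₀) (s := s)
      hμ hL hT k
    have hγ : gammaSeq (k + 1 + 1) = ((k + 2 : ℝ) / (k + 3)) * gammaSeq (k + 1) := by
      unfold gammaSeq; push_cast; field_simp; ring
    rw [catCenter, ← hb]
    nth_rewrite 1 [hγ]
    rw [mul_smul, hx1]
    have e1 : gammaSeq (k + 1 + 1) = 2 / (k + 3) := by
      unfold gammaSeq; push_cast; congr 1; ring
    have e2 : gammaSeq (k + 1) = 2 / (k + 2) := by
      unfold gammaSeq; push_cast; congr 1; ring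
    rw [e1, e2]
    have e3 : (1 : ℝ) - 2 / (k + 3) = 1 / (k + 3) + k / (k + 3) := by field_simp; ring
    have e4 : ((k + 2 : ℝ) / (k + 3)) * (1 - 2 / (k + 2)) = k / (k + 3) := by field_simp; ring
    rw [smul_sub, smul_smul, e4, e3]
    module
  rw [hx]
  refine Metric.mem_cthickening_of_dist_le _ _ _ _ hp ?_
  rw [dist_eq_norm, add_sub_cancel_left, norm_smul, Real.norm_of_nonneg (by positivity),
    ← dist_eq_norm]
  have hd := Metric.dist_le_diam_of_mem hF.compactX.isBounded h1 h0
  calc (k : ℝ) / (k + 3) * dist b a ≤ 1 * dist b a := by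
        gcongr
        rw [div_le_one (by positivity)]
        linarith
    _ ≤ _ := by rw [one_mul]; exact hd

variable (hF : IsMinimaxProblem X Y F gradF 0 μd L) (hμ : 0 < μd) (hμL : μd ≤ L) (hT : 2 ≤ T)
  (hz₀ : z₀ ∈ X ×ˢ Y) (s : ℕ → Ξ)
include hF hμ hμL hT hz₀

theorem catalystSREG_mem (k : ℕ) :
    (catalystSREG X Y g μd L σ T z₀ s k).ztil ∈ X ×ˢ Y ∧
    (catalystSREG X Y g μd L σ T z₀ s k).z ∈ X ×ˢ Y ∧
    (catInit X Y g μd L σ T z₀ s k).z ∈ queryDom X ×ˢ Y := by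
  have hL : 0 < L := hμ.trans_le hμL
  induction k with
  | zero =>
    refine ⟨hz₀, hz₀, ?_, hz₀.2⟩
    have : catCenter X Y g μd L σ T z₀ s 0 = z₀.1 := by
      simp only [catCenter, catalystSREG, catalystMinimax]
      rw [← add_smul]
      simp
    change catCenter X Y g μd L σ T z₀ s 0 ∈ _
    rw [this]
    exact subset_queryDom X hz₀.1
  | succ k ih =>
    have h4 := four_mul_betaSeq_le hμ (k + 1)
    obtain ⟨h1, h2, h3, h4, -⟩ := hF.proxSreg_spec hL.le
      (stepSize_pos (DY := Metric.diam Y) (σ := σ) hμ hL hT (k + 1))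
      (betaSeq_pos hμ (k + 1)) (stepSize_mul_le hL (by omega)) h4 (h4.trans hμL) g
      (catCenter X Y g μd L σ T z₀ s k) ih.2.2 s (by omega : 0 < T) hz₀.1
    exact ⟨⟨h1, h2⟩, ⟨h3, h4⟩,
      hF.catCenter_mem_of_mem hμ hL hT s ih.1.1 h1 h3, h4⟩

theorem catRef_mem {xstar : Vec n} (hxs : xstar ∈ X) (k : ℕ) :
    catRef X Y g μd L σ T z₀ s xstar k ∈ X :=
  hF.convexX hxs (hF.catalystSREG_mem hμ hμL hT hz₀ s k).1.1 (gammaSeq_pos _).le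
    (sub_nonneg.2 (gammaSeq_succ_le_one k)) (by ring)

/-- The recursion satisfied by the outer iterates. -/
theorem catalystSREG_step {xstar : Vec n} (hxs : xstar ∈ X) {e : ℝ}
    (he : e = 1 / (bigLambda μd L (Metric.diam Y) σ T - 1)) (k : ℕ) :
    (primalObj F Y (catalystSREG X Y g μd L σ T z₀ s (k + 1)).ztil.1 - primalObj F Y xstar)
      + betaSeq μd (k + 1) * (1 + e) * gammaSeq (k + 1) ^ 2 / 2
        * ‖xstar - (catalystSREG X Y g μd L σ T z₀ s (k + 1)).xbar‖ ^ 2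
      + betaSeq μd (k + 1) * (1 + e) / 2
        * ‖dualBest F Y (catalystSREG X Y g μd L σ T z₀ s (k + 1)).ztil.1
          - (catalystSREG X Y g μd L σ T z₀ s (k + 1)).z.2‖ ^ 2
    ≤ (1 - gammaSeq (k + 1)) *
        (primalObj F Y (catalystSREG X Y g μd L σ T z₀ s k).ztil.1 - primalObj F Y xstar)
      + betaSeq μd (k + 1) * (1 + e) * gammaSeq (k + 1) ^ 2 / 2
        * ‖xstar - (catalystSREG X Y g μd L σ T z₀ s k).xbar‖ ^ 2
      + betaSeq μd (k + 1) * e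
        * ‖dualBest F Y (catalystSREG X Y g μd L σ T z₀ s (k + 1)).ztil.1
          - (catalystSREG X Y g μd L σ T z₀ s k).z.2‖ ^ 2
      + catNoise X Y gradF g μd L σ T z₀ s xstar k := by
  have hL : 0 < L := hμ.trans_le hμL
  have hYne : Y.Nonempty := ⟨_, hz₀.2⟩
  have h4 := four_mul_betaSeq_le hμ (k + 1)
  have hM := one_lt_bigLambda (DY := Metric.diam Y) (σ := σ) hμ hL hT
  obtain ⟨m1, m2, m3⟩ := hF.catalystSREG_mem (g := g) (σ := σ) hμ hμL hT hz₀ s k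
  have hxr := hF.catRef_mem (g := g) (σ := σ) hμ hμL hT hz₀ s hxs k
  obtain ⟨h1, h2, h3, h4, h5⟩ := hF.proxSreg_spec hL.le
      (stepSize_pos (DY := Metric.diam Y) (σ := σ) hμ hL hT (k + 1))
      (betaSeq_pos hμ (k + 1)) (stepSize_mul_le hL (by omega)) h4 (h4.trans hμL) g
      (catCenter X Y g μd L σ T z₀ s k) m3 s (by omega : 0 < T) hxr
  set c := catalystSREG X Y g μd L σ T z₀ s k with hc
  set c' := catalystSREG X Y g μd L σ T z₀ s (k + 1) with hc'
  set β := betaSeq μd (k + 1)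
  set γ := gammaSeq (k + 1)
  set M := bigLambda μd L (Metric.diam Y) σ T
  change c'.ztil.1 ∈ X at h1
  -- The dual comparison point is the best response to the output of this very subproblem.
  have h6 := h5 _ (hF.dualBest_spec hμ hYne h1).1
  change F c'.ztil.1 (dualBest F Y c'.ztil.1)
      - F (catRef X Y g μd L σ T z₀ s xstar k) c'.ztil.2
      - β / 2 * ‖catRef X Y g μd L σ T z₀ s xstar k - catCenter X Y g μd L σ T z₀ s k‖ ^ 2
      + β * (1 + β * stepSize μd L (Metric.diam Y) σ T (k + 1)) ^ T
        / ((1 + β * stepSize μd L (Metric.diam Y) σ T (k + 1)) ^ T - 1) / 2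
        * (‖catRef X Y g μd L σ T z₀ s xstar k - c'.z.1‖ ^ 2
          + ‖dualBest F Y c'.ztil.1 - c'.z.2‖ ^ 2)
      ≤ β / ((1 + β * stepSize μd L (Metric.diam Y) σ T (k + 1)) ^ T - 1)
        * (1 / 2 * ‖catRef X Y g μd L σ T z₀ s xstar k - catCenter X Y g μd L σ T z₀ s k‖ ^ 2
          + ‖dualBest F Y c'.ztil.1 - c.z.2‖ ^ 2)
        + catNoise X Y gradF g μd L σ T z₀ s xstar k at h6
  rw [betaSeq_mul_stepSize hμ, ← bigLambda_eq, ← hF.primalObj_eq hμ hYne h1] at h6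
  change primalObj F Y c'.ztil.1 - F (catRef X Y g μd L σ T z₀ s xstar k) c'.ztil.2
      - β / 2 * ‖catRef X Y g μd L σ T z₀ s xstar k - catCenter X Y g μd L σ T z₀ s k‖ ^ 2
      + β * M / (M - 1) / 2 * (‖catRef X Y g μd L σ T z₀ s xstar k - c'.z.1‖ ^ 2
          + ‖dualBest F Y c'.ztil.1 - c'.z.2‖ ^ 2)
      ≤ β / (M - 1)
        * (1 / 2 * ‖catRef X Y g μd L σ T z₀ s xstar k - catCenter X Y g μd L σ T z₀ s k‖ ^ 2
          + ‖dualBest F Y c'.ztil.1 - c.z.2‖ ^ 2)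
        + catNoise X Y gradF g μd L σ T z₀ s xstar k at h6
  have hM0 : M - 1 ≠ 0 := by linarith
  -- The run starts at its prox-center, so β/2 and βe/2 multiply the same squared distance; together
  -- they match the coefficient β(1 + e)/2 of the new distance.
  have e1 : β * M / (M - 1) = β * (1 + e) := by rw [he]; field_simp; ring
  have e2 : β / (M - 1) = β * e := by rw [he]; ring
  have e3 : ‖catRef X Y g μd L σ T z₀ s xstar k - catCenter X Y g μd L σ T z₀ s k‖ ^ 2
      = γ ^ 2 * ‖xstar - c.xbar‖ ^ 2 := by
    have : catRef X Y g μd L σ T z₀ s xstar k - catCenter X Y g μd L σ T z₀ s k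
        = γ • (xstar - c.xbar) := by
      rw [catRef, catCenter]; module
    rw [this, norm_smul, mul_pow, Real.norm_eq_abs, sq_abs]
  have e4 : ‖catRef X Y g μd L σ T z₀ s xstar k - c'.z.1‖ ^ 2
      = γ ^ 2 * ‖xstar - c'.xbar‖ ^ 2 := by
    have : catRef X Y g μd L σ T z₀ s xstar k - c'.z.1 = γ • (xstar - c'.xbar) := by
      rw [smul_sub, gammaSeq_smul_xbar_succ hμ hL hT, catRef]
      abel
    rw [this, norm_smul, mul_pow, Real.norm_eq_abs, sq_abs]
  rw [e1, e2, e3, e4] at h6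
  have h7 : F (catRef X Y g μd L σ T z₀ s xstar k) c'.ztil.2
      ≤ γ * primalObj F Y xstar + (1 - γ) * primalObj F Y c.ztil.1 := by
    refine (hF.le_primalObj hμ hYne hxr h2).trans ?_
    have := hF.primalObj_segment hμ hYne hxs m1.1 (sub_nonneg.2 (gammaSeq_succ_le_one k))
      (sub_le_self 1 (gammaSeq_pos (k + 1)).le)
    rw [sub_sub_cancel] at this
    exact this
  linarith

end IsMinimaxProblem

/-! ### Pathwise error bounds in the two regimes. -/

/-- Origin of the coefficient μd/6 in the error: μd ≤ 6β_k for k ≥ 1. -/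
theorem outerWeight_mul_sixth_le {μd e v : ℝ} (hμ : 0 < μd) (he : 0 ≤ e) (hv : 0 ≤ v) (k : ℕ) :
    outerWeight (k + 1) * (μd / 6 * v) ≤ 2 * (μd * (k + 2) ^ 2 / 4 * (1 + e) / 2 * v) := by
  have h6 := le_six_mul_betaSeq hμ (show 1 ≤ k + 1 by omega)
  have hW := outerWeight_pos (k + 1)
  have hWβ := outerWeight_mul_betaSeq μd (k + 1)
  push_cast at hWβ
  rw [show ((k : ℝ) + 1 + 1) = k + 2 by ring] at hWβ
  rw [← hWβ]
  have j1 : outerWeight (k + 1) * (μd / 6 * v) ≤ outerWeight (k + 1) * (betaSeq μd (k + 1) * v) := by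
    gcongr
    linarith
  have j2 : 0 ≤ e * (outerWeight (k + 1) * (betaSeq μd (k + 1) * v)) :=
    mul_nonneg he (mul_nonneg hW.le (mul_nonneg (betaSeq_pos hμ _).le hv))
  linarith

namespace IsMinimaxProblem

variable {n m : ℕ} {X : Set (Vec n)} {Y : Set (Vec m)} {F : Vec n → Vec m → ℝ}
  {gradF : Pt n m → Pt n m} {μd L σ : ℝ} {Ξ : Type*} {T : ℕ} {z₀ : Pt n m}
  {g : Pt n m → Ξ → Pt n m}

variable (hF : IsMinimaxProblem X Y F gradF 0 μd L) (hμ : 0 < μd) (hμL : μd ≤ L) (hT : 2 ≤ T)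
  (hz₀ : z₀ ∈ X ×ˢ Y) (s : ℕ → Ξ) {xstar : Vec n} (hxs : xstar ∈ X)
  (hmin : IsMinOn (primalObj F Y) X xstar) {e : ℝ}
  (he : e = 1 / (bigLambda μd L (Metric.diam Y) σ T - 1)) {K : ℕ} (hK : 1 ≤ K)
include hF hμ hμL hT hz₀ hxs hmin he hK

theorem error_le_of_contraction (he16 : e ≤ 1 / 16) (heK : 2 * outerWeight K * e ≤ 1) :
    primalObj F Y (catalystSREG X Y g μd L σ T z₀ s K).ztil.1 - primalObj F Y xstar
        + μd / 6 * ‖dualBest F Y (catalystSREG X Y g μd L σ T z₀ s K).ztil.1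
          - (catalystSREG X Y g μd L σ T z₀ s K).z.2‖ ^ 2
      ≤ 2 / outerWeight K * ((μd * (1 + e) / 2 * ‖xstar - z₀.1‖ ^ 2
          + 12 * e * (primalObj F Y z₀.1 - primalObj F Y xstar)
          + 2 * e * μd * ‖dualBest F Y z₀.1 - z₀.2‖ ^ 2)
        + ∑ j ∈ Finset.range K,
          outerWeight (j + 1) * catNoise X Y gradF g μd L σ T z₀ s xstar j) := by
  have hYne : Y.Nonempty := ⟨_, hz₀.2⟩
  have hM := one_lt_bigLambda (DY := Metric.diam Y) (σ := σ) hμ (hμ.trans_le hμL) hT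
  have he0 : 0 ≤ e := by rw [he]; exact div_nonneg zero_le_one (by linarith)
  have hmem := hF.catalystSREG_mem (g := g) (σ := σ) hμ hμL hT hz₀ s
  set c := catalystSREG X Y g μd L σ T z₀ s with hc
  set D : ℕ → ℝ := fun k => primalObj F Y (c k).ztil.1 - primalObj F Y xstar with hD
  set B : ℕ → ℝ := fun k => ‖xstar - (c k).xbar‖ ^ 2 with hB
  set V : ℕ → ℝ := fun k => ‖dualBest F Y (c k).ztil.1 - (c k).z.2‖ ^ 2 with hV
  set Z : ℕ → ℝ := fun k => ‖dualBest F Y (c k).ztil.1 - (c (k - 1)).z.2‖ ^ 2 with hZ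
  set N : ℕ → ℝ := fun k => catNoise X Y gradF g μd L σ T z₀ s xstar (k - 1) with hN
  have hD0 : ∀ k, 0 ≤ D k := fun k => sub_nonneg.2 (isMinOn_iff.1 hmin _ (hmem k).1.1)
  have hV0 : ∀ k, 0 ≤ V k := fun k => sq_nonneg _
  -- Triangle inequality through ỹ_k* and then through the best response to x*; each squared
  -- distance to the latter costs 2/μd times a primal gap.
  have hZ' : ∀ k, μd * Z (k + 1) ≤ 8 * (D (k + 1) + D k) + 2 * μd * V k := by
    intro k
    have h1 := hF.sq_dualBest_sub_le hμ hYne hxs hmin (hmem (k + 1)).1.1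
    have h2 := hF.sq_dualBest_sub_le hμ hYne hxs hmin (hmem k).1.1
    have h3 := norm_sub_sq_le_two_mul (dualBest F Y (c (k + 1)).ztil.1)
      (dualBest F Y (c k).ztil.1) (c k).z.2
    have h4 := norm_sub_sq_le_two_mul (dualBest F Y (c (k + 1)).ztil.1)
      (dualBest F Y xstar) (dualBest F Y (c k).ztil.1)
    rw [norm_sub_rev (dualBest F Y xstar)] at h4
    have h5 := mul_le_mul_of_nonneg_left h3 hμ.le
    have h6 := mul_le_mul_of_nonneg_left h4 hμ.le
    simp only [hZ, hD, hV, Nat.add_sub_cancel]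
    linarith
  obtain ⟨k, rfl⟩ := Nat.exists_eq_succ_of_ne_zero (by omega : K ≠ 0)
  have h := outer_le_of_contraction (D := D) (B := B) (V := V) (Z := Z) (N := N) hμ he0 hD0 hV0
    (fun k => hF.catalystSREG_step hμ hμL hT hz₀ s hxs he k) hZ' he16 heK k le_rfl
  have hBk : 0 ≤ B (k + 1) := sq_nonneg _
  have hW := outerWeight_pos (k + 1)
  simp only [hN, Nat.add_sub_cancel] at h
  rw [Nat.succ_eq_add_one]
  rw [div_mul_eq_mul_div (2 : ℝ), le_div_iff₀ hW]
  change (D (k + 1) + μd / 6 * V (k + 1)) * outerWeight (k + 1) ≤ 2 *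
    (μd * (1 + e) / 2 * B 0 + 12 * e * D 0 + 2 * e * μd * V 0 + _)
  have i1 : outerWeight (k + 1) * D (k + 1)
      ≤ 2 * ((1 - 2 * e) * outerWeight (k + 1) * D (k + 1)) := by
    have : 0 ≤ outerWeight (k + 1) * D (k + 1) := mul_nonneg hW.le (hD0 _)
    nlinarith
  have i2 := outerWeight_mul_sixth_le hμ he0 (hV0 (k + 1)) k
  have i3 : 0 ≤ μd * (1 + e) / 2 * B (k + 1) := by positivity
  linarith

theorem error_le_of_bounded :
    primalObj F Y (catalystSREG X Y g μd L σ T z₀ s K).ztil.1 - primalObj F Y xstar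
        + μd / 6 * ‖dualBest F Y (catalystSREG X Y g μd L σ T z₀ s K).ztil.1
          - (catalystSREG X Y g μd L σ T z₀ s K).z.2‖ ^ 2
      ≤ 2 / outerWeight K * ((μd * (1 + e) / 2 * ‖xstar - z₀.1‖ ^ 2
          + K * outerWeight K * (μd / 4 * e * Metric.diam Y ^ 2))
        + ∑ j ∈ Finset.range K,
          outerWeight (j + 1) * catNoise X Y gradF g μd L σ T z₀ s xstar j) := by
  have hYne : Y.Nonempty := ⟨_, hz₀.2⟩
  have hM := one_lt_bigLambda (DY := Metric.diam Y) (σ := σ) hμ (hμ.trans_le hμL) hT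
  have he0 : 0 ≤ e := by rw [he]; exact div_nonneg zero_le_one (by linarith)
  have hmem := hF.catalystSREG_mem (g := g) (σ := σ) hμ hμL hT hz₀ s
  set c := catalystSREG X Y g μd L σ T z₀ s with hc
  set D : ℕ → ℝ := fun k => primalObj F Y (c k).ztil.1 - primalObj F Y xstar with hD
  set B : ℕ → ℝ := fun k => ‖xstar - (c k).xbar‖ ^ 2 with hB
  set V : ℕ → ℝ := fun k => ‖dualBest F Y (c k).ztil.1 - (c k).z.2‖ ^ 2 with hV
  set Z : ℕ → ℝ := fun k => ‖dualBest F Y (c k).ztil.1 - (c (k - 1)).z.2‖ ^ 2 with hZ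
  set N : ℕ → ℝ := fun k => catNoise X Y gradF g μd L σ T z₀ s xstar (k - 1) with hN
  have hD0 : ∀ k, 0 ≤ D k := fun k => sub_nonneg.2 (isMinOn_iff.1 hmin _ (hmem k).1.1)
  have hV0 : ∀ k, 0 ≤ V k := fun k => sq_nonneg _
  have hZ' : ∀ k, Z (k + 1) ≤ Metric.diam Y ^ 2 := by
    intro k
    have := Metric.dist_le_diam_of_mem hF.compactY.isBounded
      (hF.dualBest_spec hμ hYne (hmem (k + 1)).1.1).1 (hmem k).2.1.2
    rw [dist_eq_norm] at this
    exact pow_le_pow_left₀ (norm_nonneg _) this 2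
  obtain ⟨k, rfl⟩ := Nat.exists_eq_succ_of_ne_zero (by omega : K ≠ 0)
  have h := outer_le_of_bounded (D := D) (B := B) (V := V) (Z := Z) (N := N) hμ he0 hD0
    (fun k => hF.catalystSREG_step hμ hμL hT hz₀ s hxs he k) hV0 (sq_nonneg _) hZ' k
  have hBk : 0 ≤ B (k + 1) := sq_nonneg _
  have hW := outerWeight_pos (k + 1)
  simp only [hN, Nat.add_sub_cancel] at h
  rw [Nat.succ_eq_add_one]
  rw [div_mul_eq_mul_div (2 : ℝ), le_div_iff₀ hW]
  push_cast
  change (D (k + 1) + μd / 6 * V (k + 1)) * outerWeight (k + 1) ≤ 2 *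
    (μd * (1 + e) / 2 * B 0 + ((k : ℝ) + 1) * outerWeight (k + 1) * _ + _)
  have i1 : 0 ≤ outerWeight (k + 1) * D (k + 1) := mul_nonneg hW.le (hD0 _)
  have i2 := outerWeight_mul_sixth_le hμ he0 (hV0 (k + 1)) k
  have i3 : 0 ≤ μd * (1 + e) / 2 * B (k + 1) := by positivity
  linarith

end IsMinimaxProblem

/-! ### Past samples and independence of the next one. -/

section Past

variable {Ω Ξ : Type*} [mΞ : MeasurableSpace Ξ]

/-- The information carried by the samples with index less than `c`. -/
@[reducible]
def pastSamples (ξ : ℕ → Ω → Ξ) (c : ℕ) : MeasurableSpace Ω :=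
  ⨆ j ∈ Iio c, MeasurableSpace.comap (ξ j) mΞ

theorem pastSamples_mono (ξ : ℕ → Ω → Ξ) {c d : ℕ} (h : c ≤ d) :
    pastSamples ξ c ≤ pastSamples ξ d :=
  biSup_mono fun _ hj => lt_of_lt_of_le hj h

theorem measurable_pastSamples (ξ : ℕ → Ω → Ξ) {j c : ℕ} (h : j < c) :
    Measurable[pastSamples ξ c] (ξ j) :=
  Measurable.mono (comap_measurable (ξ j))
    (le_iSup₂_of_le (f := fun j (_ : j ∈ Iio c) => MeasurableSpace.comap (ξ j) mΞ) j h le_rfl)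
    le_rfl

variable [mΩ : MeasurableSpace Ω] {Pr : Measure Ω} {ξ : ℕ → Ω → Ξ}

theorem pastSamples_le (hξ : ∀ i, Measurable (ξ i)) (c : ℕ) : pastSamples ξ c ≤ mΩ :=
  iSup₂_le fun j _ => (hξ j).comap_le

theorem indepFun_of_measurable_pastSamples {A : Type*} [MeasurableSpace A]
    (hξ : ∀ i, Measurable (ξ i)) (hindep : iIndepFun ξ Pr) {c : ℕ} {U : Ω → A}
    (hU : Measurable[pastSamples ξ c] U) : IndepFun U (ξ c) Pr := by
  have h := indep_iSup_of_disjoint (m := fun i => MeasurableSpace.comap (ξ i) mΞ) (μ := Pr)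
    (fun i => (hξ i).comap_le) hindep (S := Iio c) (T := {c}) (by simp)
  rw [IndepFun_iff_Indep]
  refine indep_of_indep_of_le_left (indep_of_indep_of_le_right h ?_) hU.comap_le
  simp

end Past

/-! ### Moments of the oracle error at random points. -/

section OracleError

variable {n m : ℕ} {X : Set (Vec n)} {Y : Set (Vec m)} {gradF : Pt n m → Pt n m}
  {Ξ : Type*} [MeasurableSpace Ξ] {g : Pt n m → Ξ → Pt n m} {P : Measure Ξ} {σ : ℝ}
  {Ω : Type*} [MeasurableSpace Ω] {Pr : Measure Ω}

/-- By unbiasedness, `gradF` agrees on the query domain with a parameter integral of the jointly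
measurable `g`; off that domain nothing is known about it. -/
theorem measurable_of_integral [SFinite P] (hg : IsSFO X Y gradF g P σ) {Ω' : Type*}
    {m' : MeasurableSpace Ω'} {z : Ω' → Pt n m} (hz : Measurable z)
    (hzd : ∀ ω, z ω ∈ queryDom X ×ˢ Y) : Measurable fun ω => gradF (z ω) := by
  have h1 : StronglyMeasurable fun z => ∫ ξ, g z ξ ∂P :=
    hg.measurable.stronglyMeasurable.integral_prod_right
  have h2 : (fun ω => gradF (z ω)) = fun ω => ∫ ξ, g (z ω) ξ ∂P :=
    funext fun ω => (hg.unbiased _ (hzd ω)).symm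
  rw [h2]
  exact h1.measurable.comp hz

theorem integrable_inner_of_sq {E : Type*} [NormedAddCommGroup E] [InnerProductSpace ℝ E]
    {a b : Ω → E} (ha : MemLp a 2 Pr) (hb : MemLp b 2 Pr) :
    Integrable (fun ω => inner ℝ (a ω) (b ω)) Pr := by
  refine Integrable.mono' (ha.norm.integrable_sq.add hb.norm.integrable_sq)
    (ha.1.inner hb.1) (Eventually.of_forall fun ω => ?_)
  refine (norm_inner_le_norm _ _).trans ?_
  simp only [Pi.add_apply]
  nlinarith [sq_nonneg (‖a ω‖ - ‖b ω‖), norm_nonneg (a ω), norm_nonneg (b ω)]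

variable [IsProbabilityMeasure Pr] (hg : IsSFO X Y gradF g P σ)
  {z h : Ω → Pt n m} {ζ : Ω → Ξ} (hz : Measurable z) (hh : Measurable h) (hζ : Measurable ζ)
  (hlaw : Pr.map ζ = P) (hind : IndepFun (fun ω => (z ω, h ω)) ζ Pr)
  (hzd : ∀ ω, z ω ∈ queryDom X ×ˢ Y)
include hg hz hh hζ hlaw hind hzd

/-- Second moment of the oracle error at a random point independent of the sample. -/
theorem oracleError_sq :
    Integrable (fun ω => ‖(g (z ω) (ζ ω) - gradF (z ω)).1‖ ^ 2
      + ‖(g (z ω) (ζ ω) - gradF (z ω)).2‖ ^ 2) Pr ∧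
    ∫ ω, (‖(g (z ω) (ζ ω) - gradF (z ω)).1‖ ^ 2
      + ‖(g (z ω) (ζ ω) - gradF (z ω)).2‖ ^ 2) ∂Pr ≤ σ ^ 2 := by
  have hP : IsProbabilityMeasure P := by
    rw [← hlaw]; exact Measure.isProbabilityMeasure_map hζ.aemeasurable
  have hU : Measurable fun ω => (z ω, h ω) := hz.prodMk hh
  have hν := Measure.isProbabilityMeasure_map hU.aemeasurable (μ := Pr)
  -- Independence makes the joint law a product, so Fubini reduces the claim to a fixed query point.
  set ν := Pr.map fun ω => (z ω, h ω) with hνdef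
  have hmap : Pr.map (fun ω => ((z ω, h ω), ζ ω)) = ν.prod P := by
    rw [(indepFun_iff_map_prod_eq_prod_map_map hU.aemeasurable hζ.aemeasurable).1 hind, hlaw]
  -- A globally measurable substitute for `gradF`, equal to it wherever z takes values.
  set gb : Pt n m → Pt n m := fun z => ∫ ξ, g z ξ ∂P with hgb
  have hgbm : Measurable gb :=
    (hg.measurable.stronglyMeasurable.integral_prod_right (ν := P)).measurable
  set φ : (Pt n m × Pt n m) × Ξ → ℝ := fun p => ‖(g p.1.1 p.2 - gb p.1.1).1‖ ^ 2
      + ‖(g p.1.1 p.2 - gb p.1.1).2‖ ^ 2 with hφ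
  have hgm : Measurable fun p : (Pt n m × Pt n m) × Ξ => g p.1.1 p.2 :=
    hg.measurable.comp (by fun_prop : Measurable fun p : (Pt n m × Pt n m) × Ξ => (p.1.1, p.2))
  have hdm : Measurable fun p : (Pt n m × Pt n m) × Ξ => g p.1.1 p.2 - gb p.1.1 :=
    hgm.sub (hgbm.comp measurable_fst.fst)
  have hφm : Measurable φ := (hdm.fst.norm.pow_const 2).add (hdm.snd.norm.pow_const 2)
  have hgbz : ∀ w ∈ queryDom X ×ˢ Y, gb w = gradF w := hg.unbiased
  have hcomp : (fun ω => ‖(g (z ω) (ζ ω) - gradF (z ω)).1‖ ^ 2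
      + ‖(g (z ω) (ζ ω) - gradF (z ω)).2‖ ^ 2) = fun ω => φ ((z ω, h ω), ζ ω) := by
    funext ω
    simp only [hφ, hgbz _ (hzd ω)]
  have hslice : ∀ ω, Integrable (fun x => φ ((z ω, h ω), x)) P ∧
      ∫ x, φ ((z ω, h ω), x) ∂P ≤ σ ^ 2 := fun ω => by
    simp only [hφ, hgbz _ (hzd ω), Prod.fst_sub, Prod.snd_sub]
    exact ⟨hg.integrable_sq _ (hzd ω), hg.variance _ (hzd ω)⟩
  have hφ0 : ∀ p, 0 ≤ φ p := fun p => by positivity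
  have hJm : StronglyMeasurable fun u => ∫ x, φ (u, x) ∂P :=
    hφm.stronglyMeasurable.integral_prod_right' (ν := P)
  have hJle : ∀ᵐ u ∂ν, ∫ x, φ (u, x) ∂P ≤ σ ^ 2 := by
    rw [hνdef, ae_map_iff hU.aemeasurable (measurableSet_le hJm.measurable measurable_const)]
    exact Eventually.of_forall fun ω => (hslice ω).2
  have hJint : Integrable (fun u => ∫ x, φ (u, x) ∂P) ν := by
    refine Integrable.mono' (integrable_const (σ ^ 2)) hJm.aestronglyMeasurable ?_
    filter_upwards [hJle] with u hu
    rwa [Real.norm_of_nonneg (integral_nonneg fun _ => hφ0 _)]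
  have hφint : Integrable φ (ν.prod P) := by
    rw [integrable_prod_iff hφm.aestronglyMeasurable]
    refine ⟨?_, ?_⟩
    · rw [hνdef, ae_map_iff hU.aemeasurable]
      · exact Eventually.of_forall fun ω => (hslice ω).1
      · exact measurableSet_integrable hφm.stronglyMeasurable
    · simpa only [Real.norm_of_nonneg (hφ0 _)] using hJint
  have hpm : Measurable fun ω => ((z ω, h ω), ζ ω) := hU.prodMk hζ
  rw [hcomp]
  rw [← hmap] at hφint
  refine ⟨hφint.comp_measurable hpm, ?_⟩
  rw [← integral_map hpm.aemeasurable hφm.aestronglyMeasurable, hmap]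
  rw [hmap] at hφint
  rw [integral_prod _ hφint]
  calc _ ≤ ∫ _, σ ^ 2 ∂ν := integral_mono_ae hJint (integrable_const _) hJle
    _ = σ ^ 2 := by simp

theorem oracleError_memLp :
    MemLp (fun ω => (g (z ω) (ζ ω) - gradF (z ω)).1) 2 Pr ∧
    MemLp (fun ω => (g (z ω) (ζ ω) - gradF (z ω)).2) 2 Pr := by
  have hP : IsProbabilityMeasure P := by
    rw [← hlaw]; exact Measure.isProbabilityMeasure_map hζ.aemeasurable
  have hm : Measurable fun ω => g (z ω) (ζ ω) - gradF (z ω) :=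
    (hg.measurable.comp (hz.prodMk hζ)).sub (measurable_of_integral hg hz hzd)
  have hI := (oracleError_sq hg hz hh hζ hlaw hind hzd).1
  refine ⟨(memLp_two_iff_integrable_sq_norm hm.fst.aestronglyMeasurable).2 ?_,
    (memLp_two_iff_integrable_sq_norm hm.snd.aestronglyMeasurable).2 ?_⟩
  · refine hI.mono' (hm.fst.norm.pow_const 2).aestronglyMeasurable (Eventually.of_forall fun ω => ?_)
    rw [Real.norm_of_nonneg (by positivity)]
    exact le_add_of_nonneg_right (by positivity)
  · refine hI.mono' (hm.snd.norm.pow_const 2).aestronglyMeasurable (Eventually.of_forall fun ω => ?_)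
    rw [Real.norm_of_nonneg (by positivity)]
    exact le_add_of_nonneg_left (by positivity)

/-- The oracle error is orthogonal to quantities independent of the sample. -/
theorem integral_inner_oracleError (h1 : MemLp (fun ω => (h ω).1) 2 Pr)
    (h2 : MemLp (fun ω => (h ω).2) 2 Pr) :
    Integrable (fun ω => inner ℝ (g (z ω) (ζ ω) - gradF (z ω)).1 (h ω).1
      + inner ℝ (g (z ω) (ζ ω) - gradF (z ω)).2 (h ω).2) Pr ∧
    ∫ ω, (inner ℝ (g (z ω) (ζ ω) - gradF (z ω)).1 (h ω).1
      + inner ℝ (g (z ω) (ζ ω) - gradF (z ω)).2 (h ω).2) ∂Pr = 0 := by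
  have hP : IsProbabilityMeasure P := by
    rw [← hlaw]; exact Measure.isProbabilityMeasure_map hζ.aemeasurable
  obtain ⟨m1, m2⟩ := oracleError_memLp hg hz hh hζ hlaw hind hzd
  have hint := (integrable_inner_of_sq m1 h1).add (integrable_inner_of_sq m2 h2)
  refine ⟨hint, ?_⟩
  have hU : Measurable fun ω => (z ω, h ω) := hz.prodMk hh
  have hν := Measure.isProbabilityMeasure_map hU.aemeasurable (μ := Pr)
  set ν := Pr.map fun ω => (z ω, h ω) with hνdef
  have hmap : Pr.map (fun ω => ((z ω, h ω), ζ ω)) = ν.prod P := by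
    rw [(indepFun_iff_map_prod_eq_prod_map_map hU.aemeasurable hζ.aemeasurable).1 hind, hlaw]
  set gb : Pt n m → Pt n m := fun z => ∫ ξ, g z ξ ∂P with hgb
  have hgbm : Measurable gb :=
    (hg.measurable.stronglyMeasurable.integral_prod_right (ν := P)).measurable
  set φ : (Pt n m × Pt n m) × Ξ → ℝ := fun p => inner ℝ (g p.1.1 p.2 - gb p.1.1).1 p.1.2.1
      + inner ℝ (g p.1.1 p.2 - gb p.1.1).2 p.1.2.2 with hφ
  have hgm : Measurable fun p : (Pt n m × Pt n m) × Ξ => g p.1.1 p.2 :=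
    hg.measurable.comp (by fun_prop : Measurable fun p : (Pt n m × Pt n m) × Ξ => (p.1.1, p.2))
  have hdm : Measurable fun p : (Pt n m × Pt n m) × Ξ => g p.1.1 p.2 - gb p.1.1 :=
    hgm.sub (hgbm.comp measurable_fst.fst)
  have hφm : Measurable φ :=
    (hdm.fst.inner measurable_fst.snd.fst).add (hdm.snd.inner measurable_fst.snd.snd)
  have hgbz : ∀ w ∈ queryDom X ×ˢ Y, gb w = gradF w := hg.unbiased
  have hcomp : (fun ω => inner ℝ (g (z ω) (ζ ω) - gradF (z ω)).1 (h ω).1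
      + inner ℝ (g (z ω) (ζ ω) - gradF (z ω)).2 (h ω).2) = fun ω => φ ((z ω, h ω), ζ ω) := by
    funext ω
    simp only [hφ, hgbz _ (hzd ω)]
  have hslice : ∀ ω, ∫ x, φ ((z ω, h ω), x) ∂P = 0 := fun ω => by
    have hgi := hg.integrable _ (hzd ω)
    have hdi : Integrable (fun x => g (z ω) x - gb (z ω)) P := hgi.sub (integrable_const _)
    have hd0 : ∫ x, (g (z ω) x - gb (z ω)) ∂P = 0 := by
      rw [integral_sub hgi (integrable_const _)]
      simp [hgb]
    have e1 : ∫ x, (g (z ω) x - gb (z ω)).1 ∂P = 0 := by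
      rw [← fst_integral hdi, hd0]; rfl
    have e2 : ∫ x, (g (z ω) x - gb (z ω)).2 ∂P = 0 := by
      rw [← snd_integral hdi, hd0]; rfl
    simp only [hφ]
    simp_rw [real_inner_comm _ (g _ _ - gb _).1, real_inner_comm _ (g _ _ - gb _).2]
    rw [integral_add (hdi.fst.const_inner _) (hdi.snd.const_inner _), integral_inner hdi.fst,
      integral_inner hdi.snd, e1, e2, inner_zero_right, inner_zero_right, add_zero]
  have hJm : StronglyMeasurable fun u => ∫ x, φ (u, x) ∂P :=
    hφm.stronglyMeasurable.integral_prod_right' (ν := P)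
  have hpm : Measurable fun ω => ((z ω, h ω), ζ ω) := hU.prodMk hζ
  have hφint : Integrable φ (ν.prod P) := by
    rw [← hmap, integrable_map_measure hφm.aestronglyMeasurable hpm.aemeasurable]
    exact (congrArg (fun f => Integrable f Pr) hcomp).mp hint
  rw [hcomp, ← integral_map hpm.aemeasurable hφm.aestronglyMeasurable, hmap,
    integral_prod _ hφint, hνdef, integral_map hU.aemeasurable hJm.aestronglyMeasurable]
  simp only [hslice, integral_zero]

end OracleError

/-! ### Measurability of a run with respect to past samples. -/

section ProxMeasurable

variable {n m : ℕ} {X : Set (Vec n)} {Y : Set (Vec m)} {Ξ : Type*} [MeasurableSpace Ξ]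
  {g : Pt n m → Ξ → Pt n m} {β μ η : ℝ}

theorem measurable_proxOperator (hg : Measurable (Function.uncurry g)) {Ω' : Type*}
    {m' : MeasurableSpace Ω'} {xc : Ω' → Vec n} {z : Ω' → Pt n m} {ζ : Ω' → Ξ}
    (hxc : Measurable xc) (hz : Measurable z) (hζ : Measurable ζ) :
    Measurable fun ω => proxOperator g β (xc ω) (z ω) (ζ ω) := by
  have hG : Measurable fun ω => g (z ω) (ζ ω) := hg.comp (hz.prodMk hζ)
  exact (hG.fst.add ((hz.fst.sub hxc).const_smul β)).prodMk hG.snd.neg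

theorem measurable_comp_triple {f : Pt n m × Pt n m × Pt n m → Pt n m} (hf : Continuous f)
    {Ω' : Type*} {m' : MeasurableSpace Ω'} {G zh z : Ω' → Pt n m}
    (hG : Measurable G) (hzh : Measurable zh) (hz : Measurable z) :
    Measurable fun ω => f (G ω, zh ω, z ω) :=
  hf.measurable.comp (hG.prodMk (hzh.prodMk hz))

theorem measurable_regExtraPoint (hX : IsCompact X) (hY : IsCompact Y) (hXc : Convex ℝ X)
    (hYc : Convex ℝ Y) (hXne : X.Nonempty) (hYne : Y.Nonempty) (hβ : 0 ≤ β) (hμ : 0 ≤ μ)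
    (hη : 0 ≤ η) {Ω' : Type*} {m' : MeasurableSpace Ω'} {G zh z : Ω' → Pt n m}
    (hG : Measurable G) (hzh : Measurable zh) (hz : Measurable z) :
    Measurable fun ω => regExtraPoint X Y β μ η (G ω) (zh ω) (z ω) :=
  measurable_comp_triple (continuous_regExtraPoint hX hY hXc hYc hXne hYne hβ hμ hη) hG hzh hz

end ProxMeasurable

section StageMeasurable

variable {n m : ℕ} {X : Set (Vec n)} {Y : Set (Vec m)} {F : Vec n → Vec m → ℝ}
  {gradF : Pt n m → Pt n m} {μd L : ℝ} (hF : IsMinimaxProblem X Y F gradF 0 μd L)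
  {Ξ : Type*} [MeasurableSpace Ξ] {g : Pt n m → Ξ → Pt n m}
  {P : Measure Ξ} {σ : ℝ} (hg : IsSFO X Y gradF g P σ)
  {Ω : Type*} {ξ : ℕ → Ω → Ξ} {β μ η : ℝ} (hβ : 0 ≤ β) (hμ : 0 ≤ μ) (hη : 0 ≤ η)
  {c : ℕ} {xc : Ω → Vec n} {init : Ω → SregState n m}
  (hxc : Measurable[pastSamples ξ c] xc)
  (hz : Measurable[pastSamples ξ c] fun ω => (init ω).z)
  (hc : ∀ ω, (init ω).calls = c) (hXne : X.Nonempty) (hYne : Y.Nonempty)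
include hF hg hβ hμ hη hxc hz hc hXne hYne

/-- The sample of index c + 2t is consumed in forming ẑ_t, hence the shift by one. The sample c + 2t
+ 1, used for the call at ẑ_t, is still fresh. -/
theorem measurable_proxHat_of_proxState {t : ℕ}
    (h : Measurable[pastSamples ξ (c + 2 * t)] fun ω =>
      (proxState X Y g β μ η (xc ω) (init ω) (fun i => ξ i ω) t).z) :
    Measurable[pastSamples ξ (c + 2 * t + 1)] fun ω =>
      proxHat X Y g β μ η (xc ω) (init ω) (fun i => ξ i ω) t := by
  have h' := h.mono (pastSamples_mono ξ (Nat.le_succ (c + 2 * t))) le_rfl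
  have hxc' := hxc.mono (pastSamples_mono ξ (show c ≤ c + 2 * t + 1 by omega)) le_rfl
  have hG := measurable_proxOperator (β := β) hg.measurable hxc' h'
    (measurable_pastSamples ξ (Nat.lt_succ_self (c + 2 * t)))
  simp only [proxHat_eq, proxState_calls, hc, extraPoint_eq_regExtraPoint]
  exact measurable_regExtraPoint hF.compactX hF.compactY hF.convexX hF.convexY hXne hYne le_rfl
    le_rfl hη hG h' h'

theorem measurable_proxState (t : ℕ) :
    Measurable[pastSamples ξ (c + 2 * t)] fun ω =>
      (proxState X Y g β μ η (xc ω) (init ω) (fun i => ξ i ω) t).z := by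
  induction t with
  | zero => exact hz
  | succ t ih =>
    have hh := measurable_proxHat_of_proxState hF hg hβ hμ hη hxc hz hc hXne hYne ih
    have ih' := ih.mono (pastSamples_mono ξ (show c + 2 * t ≤ c + 2 * (t + 1) by omega)) le_rfl
    have hh' := hh.mono (pastSamples_mono ξ (show c + 2 * t + 1 ≤ c + 2 * (t + 1) by omega)) le_rfl
    have hxc' := hxc.mono (pastSamples_mono ξ (show c ≤ c + 2 * (t + 1) by omega)) le_rfl
    have hG := measurable_proxOperator (β := β) hg.measurable hxc' hh'
      (measurable_pastSamples ξ (show c + 2 * t + 1 < c + 2 * (t + 1) by omega))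
    simp only [proxState_succ_z, proxState_calls, hc]
    exact measurable_regExtraPoint hF.compactX hF.compactY hF.convexX hF.convexY hXne hYne hβ
      hμ hη hG hh' ih'

theorem measurable_proxHat (t : ℕ) :
    Measurable[pastSamples ξ (c + 2 * t + 1)] fun ω =>
      proxHat X Y g β μ η (xc ω) (init ω) (fun i => ξ i ω) t :=
  measurable_proxHat_of_proxState hF hg hβ hμ hη hxc hz hc hXne hYne
    (measurable_proxState hF hg hβ hμ hη hxc hz hc hXne hYne t)

theorem measurable_proxSreg_last (T : ℕ) :
    Measurable[pastSamples ξ (c + 2 * T)] fun ω =>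
      (proxSreg X Y g β μ η T (xc ω) (init ω) fun i => ξ i ω).last :=
  measurable_proxState hF hg hβ hμ hη hxc hz hc hXne hYne T

theorem measurable_proxSreg_avg (T : ℕ) :
    Measurable[pastSamples ξ (c + 2 * T)] fun ω =>
      (proxSreg X Y g β μ η T (xc ω) (init ω) fun i => ξ i ω).avg := by
  refine Measurable.const_smul (M := ℝ)
    (Finset.measurable_sum _ fun t ht => Measurable.const_smul (M := ℝ) ?_ _) _
  have ht' := Finset.mem_range.1 ht
  exact (measurable_proxHat hF hg hβ hμ hη hxc hz hc hXne hYne t).mono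
    (pastSamples_mono ξ (by omega)) le_rfl

variable [SFinite P] (hinit : ∀ ω, (init ω).z ∈ queryDom X ×ˢ Y)
include hinit

theorem measurable_proxHatErr (t : ℕ) :
    Measurable[pastSamples ξ (c + 2 * t + 2)] fun ω =>
      proxHatErr X Y gradF g β μ η (xc ω) (init ω) (fun i => ξ i ω) t := by
  have hh := (measurable_proxHat hF hg hβ hμ hη hxc hz hc hXne hYne t).mono
    (pastSamples_mono ξ (Nat.le_succ (c + 2 * t + 1))) le_rfl
  simp only [proxHatErr, proxState_calls, hc]
  refine Measurable.sub (hg.measurable.comp (hh.prodMk (measurable_pastSamples ξ (by omega)))) ?_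
  refine measurable_of_integral hg hh fun ω => ?_
  have := proxHat_mem X Y g β μ η (xc ω) (init ω) (fun i => ξ i ω) hF.compactX hF.compactY
    hXne hYne t
  exact ⟨IsMinimaxProblem.subset_queryDom X this.1, this.2⟩

/-- The error at ẑ_t enters only v_{t+1}; hence v_t is independent of the sample it is paired with.
-/
theorem measurable_proxGhost (t : ℕ) :
    Measurable[pastSamples ξ (c + 2 * t)] fun ω =>
      proxGhost X Y gradF g β μ η (xc ω) (init ω) (fun i => ξ i ω) t := by
  induction t with
  | zero => exact hz.snd
  | succ t ih =>
    have ih' := ih.mono (pastSamples_mono ξ (show c + 2 * t ≤ c + 2 * (t + 1) by omega)) le_rfl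
    have hh := (measurable_proxHat hF hg hβ hμ hη hxc hz hc hXne hYne t).mono
      (pastSamples_mono ξ (show c + 2 * t + 1 ≤ c + 2 * (t + 1) by omega)) le_rfl
    have he := measurable_proxHatErr hF hg hβ hμ hη hxc hz hc hXne hYne hinit t
    exact ((ih'.sub (he.snd.const_smul η)).add (hh.snd.const_smul (η * β))).const_smul (1 + η * β)⁻¹

end StageMeasurable

/-! ### Expected noise of one subproblem. -/

section StageExpectation

variable {n m : ℕ} {X : Set (Vec n)} {Y : Set (Vec m)} {F : Vec n → Vec m → ℝ}
  {gradF : Pt n m → Pt n m} {μd L : ℝ} (hF : IsMinimaxProblem X Y F gradF 0 μd L)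
  {Ξ : Type*} [MeasurableSpace Ξ] {g : Pt n m → Ξ → Pt n m}
  {P : Measure Ξ} {σ : ℝ} (hg : IsSFO X Y gradF g P σ)
  {Ω : Type*} [MeasurableSpace Ω] {Pr : Measure Ω} [IsProbabilityMeasure Pr]
  {ξ : ℕ → Ω → Ξ} (hξ : ∀ i, Measurable (ξ i)) (hlaw : ∀ i, Pr.map (ξ i) = P)
  (hindep : iIndepFun ξ Pr)
  {β μ η : ℝ} (hβ : 0 ≤ β) (hμ : 0 ≤ μ) (hη : 0 ≤ η)
  {c : ℕ} {xc : Ω → Vec n} {init : Ω → SregState n m}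
  (hxc : Measurable[pastSamples ξ c] xc)
  (hz : Measurable[pastSamples ξ c] fun ω => (init ω).z)
  (hc : ∀ ω, (init ω).calls = c) (hXne : X.Nonempty) (hYne : Y.Nonempty)
  (hinit : ∀ ω, (init ω).z ∈ queryDom X ×ˢ Y)

theorem memLp_two_of_mem {E : Type*} [NormedAddCommGroup E] [MeasurableSpace E] [BorelSpace E]
    [SecondCountableTopology E] {S : Set E} (hS : IsCompact S) {u : Ω → E} (hu : Measurable u)
    (hmem : ∀ ω, u ω ∈ S) : MemLp u 2 Pr := by
  obtain ⟨C, hC⟩ := hS.isBounded.exists_norm_le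
  exact MemLp.of_bound hu.aestronglyMeasurable C (Eventually.of_forall fun ω => hC _ (hmem ω))

include hF hg hξ hlaw hindep hβ hμ hη hxc hz hc hXne hYne hinit

theorem memLp_proxHatErr (t : ℕ) :
    MemLp (fun ω => (proxHatErr X Y gradF g β μ η (xc ω) (init ω) (fun i => ξ i ω) t).2) 2 Pr := by
  have hh := measurable_proxHat hF hg hβ hμ hη hxc hz hc hXne hYne t
  simp only [proxHatErr, proxState_calls, hc]
  have hd : ∀ ω, proxHat X Y g β μ η (xc ω) (init ω) (fun i => ξ i ω) t ∈ queryDom X ×ˢ Y :=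
    fun ω => by
      have := proxHat_mem X Y g β μ η (xc ω) (init ω) (fun i => ξ i ω) hF.compactX hF.compactY
        hXne hYne t
      exact ⟨IsMinimaxProblem.subset_queryDom X this.1, this.2⟩
  have hh' := hh.mono (pastSamples_le hξ _) le_rfl
  exact (oracleError_memLp hg hh' hh' (hξ _) (hlaw _)
    (indepFun_of_measurable_pastSamples hξ hindep (hh.prodMk hh)) hd).2

/-- The ghost sequence is not projected on Y and may be unbounded, so square integrability comes by
induction from that of the errors. -/
theorem memLp_proxGhost (t : ℕ) :
    MemLp (fun ω => proxGhost X Y gradF g β μ η (xc ω) (init ω) (fun i => ξ i ω) t) 2 Pr := by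
  induction t with
  | zero =>
    exact memLp_two_of_mem hF.compactY (hz.snd.mono (pastSamples_le hξ _) le_rfl)
      fun ω => (hinit ω).2
  | succ t ih =>
    have he := memLp_proxHatErr hF hg hξ hlaw hindep hβ hμ hη hxc hz hc hXne hYne hinit t
    have hh := (measurable_proxHat hF hg hβ hμ hη hxc hz hc hXne hYne t).mono
      (pastSamples_le hξ _) le_rfl
    have hh' := memLp_two_of_mem (Pr := Pr) hF.compactY hh.snd fun ω =>
      (proxHat_mem X Y g β μ η (xc ω) (init ω) (fun i => ξ i ω) hF.compactX hF.compactY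
        hXne hYne t).2
    exact ((ih.sub (he.const_smul η)).add (hh'.const_smul (η * β))).const_smul (1 + η * β)⁻¹

/-- The inner products have mean zero, because x is fixed before the run and ẑ_t, v_t before the
sample. The squares give 5η²(σ² + σ²). -/
theorem integral_proxNoise_le {x : Ω → Vec n} (hx : Measurable[pastSamples ξ c] x)
    (hxX : ∀ ω, x ω ∈ X) (t : ℕ) :
    Integrable (fun ω =>
      proxNoise X Y gradF g β μ η (xc ω) (init ω) (fun i => ξ i ω) (x ω) t) Pr ∧
    ∫ ω, proxNoise X Y gradF g β μ η (xc ω) (init ω) (fun i => ξ i ω) (x ω) t ∂Pr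
      ≤ 10 * η ^ 2 * σ ^ 2 := by
  have hP : IsProbabilityMeasure P := by
    rw [← hlaw 0]; exact Measure.isProbabilityMeasure_map (hξ 0).aemeasurable
  have hs := measurable_proxState hF hg hβ hμ hη hxc hz hc hXne hYne t
  have hh := measurable_proxHat hF hg hβ hμ hη hxc hz hc hXne hYne t
  have hv := measurable_proxGhost hF hg hβ hμ hη hxc hz hc hXne hYne hinit t
  have hx' := hx.mono (pastSamples_mono ξ (show c ≤ c + 2 * t + 1 by omega)) le_rfl
  have hv' := hv.mono (pastSamples_mono ξ (Nat.le_succ (c + 2 * t))) le_rfl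
  have hmem := fun ω => proxHat_mem X Y g β μ η (xc ω) (init ω) (fun i => ξ i ω) hF.compactX
    hF.compactY hXne hYne t
  have hhd : ∀ ω, proxHat X Y g β μ η (xc ω) (init ω) (fun i => ξ i ω) t ∈ queryDom X ×ˢ Y :=
    fun ω => ⟨IsMinimaxProblem.subset_queryDom X (hmem ω).1, (hmem ω).2⟩
  have hsd := fun ω => proxState_mem X Y g β μ η (xc ω) (init ω) (fun i => ξ i ω) hF.compactX
    hF.compactY hXne hYne (hinit ω) t
  have hsm := hs.mono (pastSamples_le hξ _) le_rfl
  have hhm := hh.mono (pastSamples_le hξ _) le_rfl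
  have hw := (hx'.sub hh.fst).prodMk (hh.snd.sub hv')
  have hwm := hw.mono (pastSamples_le hξ _) le_rfl
  obtain ⟨i1, i1'⟩ := oracleError_sq hg hsm hsm (hξ _) (hlaw _)
    (indepFun_of_measurable_pastSamples hξ hindep (hs.prodMk hs)) hsd
  obtain ⟨i2, i2'⟩ := oracleError_sq hg hhm hhm (hξ _) (hlaw _)
    (indepFun_of_measurable_pastSamples hξ hindep (hh.prodMk hh)) hhd
  obtain ⟨i3, i3'⟩ := integral_inner_oracleError hg hhm hwm (hξ _) (hlaw _)
    (indepFun_of_measurable_pastSamples hξ hindep (hh.prodMk hw)) hhd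
    ((memLp_two_of_mem hF.compactX (hx.mono (pastSamples_le hξ _) le_rfl) hxX).sub
      (memLp_two_of_mem hF.compactX hhm.fst fun ω => (hmem ω).1))
    ((memLp_two_of_mem hF.compactY hhm.snd fun ω => (hmem ω).2).sub
      (memLp_proxGhost hF hg hξ hlaw hindep hβ hμ hη hxc hz hc hXne hYne hinit t))
  have i4 := (i1.add i2).const_mul (5 * η ^ 2)
  have i5 := i3.const_mul η
  simp only [proxNoise, proxErr, proxHatErr, proxState_calls, hc]
  refine ⟨i4.add i5, ?_⟩
  refine (integral_add i4 i5).trans_le ?_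
  rw [integral_const_mul, integral_const_mul, i3', mul_zero, add_zero]
  simp only [Pi.add_apply]
  rw [integral_add i1 i2]
  nlinarith [sq_nonneg η]

/-- The weights ηΛ_t sum to (Λ_T - 1)/β, which the normalization cancels; of the factor η² one η is
spent on the weights. -/
theorem integral_stageNoise_le {x : Ω → Vec n} (hx : Measurable[pastSamples ξ c] x)
    (hxX : ∀ ω, x ω ∈ X) {T : ℕ} (hT : T ≠ 0) (hβ' : 0 < β) (hη' : 0 < η) :
    Integrable (fun ω =>
      stageNoise X Y gradF g β μ η (xc ω) (init ω) (fun i => ξ i ω) T (x ω)) Pr ∧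
    ∫ ω, stageNoise X Y gradF g β μ η (xc ω) (init ω) (fun i => ξ i ω) T (x ω) ∂Pr
      ≤ 10 * η * σ ^ 2 := by
  have h := integral_proxNoise_le hF hg hξ hlaw hindep hβ hμ hη hxc hz hc hXne hYne hinit hx hxX
  have hi : ∀ t ∈ Finset.range T, Integrable (fun ω => (1 + β * η) ^ t *
      proxNoise X Y gradF g β μ η (xc ω) (init ω) (fun i => ξ i ω) (x ω) t) Pr :=
    fun t _ => (h t).1.const_mul _
  refine ⟨(integrable_finsetSum _ hi).const_mul _, ?_⟩
  simp only [stageNoise]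
  rw [integral_const_mul, integral_finsetSum _ hi]
  have hM : 1 < (1 + β * η) ^ T := one_lt_pow₀ (by nlinarith [mul_pos hβ' hη']) hT
  have hcpos : 0 ≤ β / ((1 + β * η) ^ T - 1) := div_nonneg hβ (by linarith)
  have hsum : ∑ t ∈ Finset.range T, ∫ ω, (1 + β * η) ^ t *
      proxNoise X Y gradF g β μ η (xc ω) (init ω) (fun i => ξ i ω) (x ω) t ∂Pr
      ≤ ∑ t ∈ Finset.range T, (η * sregWeight β (fun _ => η) t) * (10 * η * σ ^ 2) := by
    refine Finset.sum_le_sum fun t _ => ?_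
    rw [integral_const_mul, sregWeight_const]
    calc _ ≤ (1 + β * η) ^ t * (10 * η ^ 2 * σ ^ 2) :=
          mul_le_mul_of_nonneg_left (h t).2 (by positivity)
      _ = _ := by ring
  rw [← Finset.sum_mul, sum_mul_sregWeight hβ'.ne'] at hsum
  have h1 : (1 + β * η) ^ T - 1 ≠ 0 := by linarith
  calc _ ≤ β / ((1 + β * η) ^ T - 1) * (((1 + β * η) ^ T - 1) / β * (10 * η * σ ^ 2)) :=
        mul_le_mul_of_nonneg_left hsum hcpos
    _ = _ := by field_simp

end StageExpectation

/-! ### Integrability and expectation of the outer error. -/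

section OuterExpectation

variable {n m : ℕ} {X : Set (Vec n)} {Y : Set (Vec m)} {F : Vec n → Vec m → ℝ}
  {gradF : Pt n m → Pt n m} {μd L σ : ℝ} (hF : IsMinimaxProblem X Y F gradF 0 μd L)
  (hμ : 0 < μd) (hμL : μd ≤ L)
  {Ξ : Type*} [MeasurableSpace Ξ] {g : Pt n m → Ξ → Pt n m}
  {P : Measure Ξ} (hg : IsSFO X Y gradF g P σ)
  {T : ℕ} (hT : 2 ≤ T) {z₀ : Pt n m} (hz₀ : z₀ ∈ X ×ˢ Y)
  {Ω : Type*}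

section Measurability

variable {ξ : ℕ → Ω → Ξ}
include hF hμ hμL hg hT hz₀

theorem measurable_catalystSREG (k : ℕ) :
    (Measurable[pastSamples ξ (2 * T * k)] fun ω =>
      (catalystSREG X Y g μd L σ T z₀ (fun i => ξ i ω) k).xbar) ∧
    (Measurable[pastSamples ξ (2 * T * k)] fun ω =>
      (catalystSREG X Y g μd L σ T z₀ (fun i => ξ i ω) k).ztil) ∧
    (Measurable[pastSamples ξ (2 * T * k)] fun ω =>
      (catalystSREG X Y g μd L σ T z₀ (fun i => ξ i ω) k).z) := by
  have hL : 0 < L := hμ.trans_le hμL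
  induction k with
  | zero => exact ⟨measurable_const, measurable_const, measurable_const⟩
  | succ k ih =>
    obtain ⟨h1, h2, h3⟩ := ih
    have hxc : Measurable[pastSamples ξ (2 * T * k)] fun ω =>
        catCenter X Y g μd L σ T z₀ (fun i => ξ i ω) k :=
      (h1.const_smul (gammaSeq (k + 1))).add (h2.fst.const_smul (1 - gammaSeq (k + 1)))
    have hz : Measurable[pastSamples ξ (2 * T * k)] fun ω =>
        (catInit X Y g μd L σ T z₀ (fun i => ξ i ω) k).z := hxc.prodMk h3.snd
    have hc : ∀ ω, (catInit X Y g μd L σ T z₀ (fun i => ξ i ω) k).calls = 2 * T * k :=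
      fun ω => catalystSREG_calls X Y g μd L σ T z₀ (fun i => ξ i ω) k
    have hη := (stepSize_pos (DY := Metric.diam Y) (σ := σ) hμ hL hT (k + 1)).le
    have hβ := (betaSeq_pos hμ (k + 1)).le
    have e : 2 * T * (k + 1) = 2 * T * k + 2 * T := by ring
    have ha := measurable_proxSreg_avg hF hg hβ hμ.le hη hxc hz hc ⟨_, hz₀.1⟩ ⟨_, hz₀.2⟩ T
    have hl := measurable_proxSreg_last hF hg hβ hμ.le hη hxc hz hc ⟨_, hz₀.1⟩ ⟨_, hz₀.2⟩ T
    have h2' := h2.mono (pastSamples_mono ξ (show 2 * T * k ≤ 2 * T * k + 2 * T by omega)) le_rfl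
    rw [e]
    exact ⟨((hl.fst.const_smul (alphaSeq μd L (Metric.diam Y) σ T (k + 1))).add
      (h2'.fst.const_smul ((0 - alphaSeq μd L (Metric.diam Y) σ T (k + 1))
        * (1 - gammaSeq (k + 1))))).const_smul
      (1 / (alphaSeq μd L (Metric.diam Y) σ T (k + 1) * gammaSeq (k + 1)
        + 0 * (1 - gammaSeq (k + 1)))), ha, hl⟩

variable [MeasurableSpace Ω] {Pr : Measure Ω} [IsProbabilityMeasure Pr]
  (hξ : ∀ i, Measurable (ξ i)) (hlaw : ∀ i, Pr.map (ξ i) = P) (hindep : iIndepFun ξ Pr)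
include hξ

theorem integrable_error {xstar : Vec n} (K : ℕ) :
    Integrable (fun ω =>
      primalObj F Y (catalystSREG X Y g μd L σ T z₀ (fun i => ξ i ω) K).ztil.1
        - primalObj F Y xstar
        + μd / 6 * ‖dualBest F Y (catalystSREG X Y g μd L σ T z₀ (fun i => ξ i ω) K).ztil.1
          - (catalystSREG X Y g μd L σ T z₀ (fun i => ξ i ω) K).z.2‖ ^ 2) Pr := by
  have hYne : Y.Nonempty := ⟨_, hz₀.2⟩
  have hmem := fun ω => hF.catalystSREG_mem (g := g) (σ := σ) hμ hμL hT hz₀ (fun i => ξ i ω) K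
  obtain ⟨-, h2, h3⟩ := measurable_catalystSREG hF hμ hμL hg hT hz₀ (ξ := ξ) K
  have h2' := (h2.mono (pastSamples_le hξ _) le_rfl).fst
  have h3' := (h3.mono (pastSamples_le hξ _) le_rfl).snd
  have hx : Measurable fun ω =>
      (⟨(catalystSREG X Y g μd L σ T z₀ (fun i => ξ i ω) K).ztil.1, (hmem ω).1.1⟩ : X) :=
    h2'.subtype_mk
  have hp := (hF.continuous_primalObj hμ hYne).measurable.comp hx
  have hd := (hF.continuous_dualBest hμ hYne).measurable.comp hx
  have : CompactSpace X := isCompact_iff_compactSpace.1 hF.compactX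
  obtain ⟨C, hC⟩ := (isCompact_range (hF.continuous_primalObj hμ hYne)).isBounded.exists_norm_le
  have hpi : Integrable (fun ω =>
      primalObj F Y (catalystSREG X Y g μd L σ T z₀ (fun i => ξ i ω) K).ztil.1) Pr :=
    Integrable.of_bound hp.aestronglyMeasurable C
      (Eventually.of_forall fun ω => hC _ ⟨⟨_, (hmem ω).1.1⟩, rfl⟩)
  have hdi : Integrable (fun ω =>
      ‖dualBest F Y (catalystSREG X Y g μd L σ T z₀ (fun i => ξ i ω) K).ztil.1
          - (catalystSREG X Y g μd L σ T z₀ (fun i => ξ i ω) K).z.2‖ ^ 2) Pr := by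
    refine Integrable.of_bound ((hd.sub h3').norm.pow_const 2).aestronglyMeasurable
      (Metric.diam Y ^ 2) (Eventually.of_forall fun ω => ?_)
    rw [Real.norm_of_nonneg (by positivity), ← dist_eq_norm]
    exact pow_le_pow_left₀ dist_nonneg (Metric.dist_le_diam_of_mem hF.compactY.isBounded
      (hF.dualBest_spec hμ hYne (hmem ω).1.1).1 (hmem ω).2.1.2) 2
  exact (hpi.sub (integrable_const _)).add (hdi.const_mul _)

include hlaw hindep

theorem integral_catNoise_le {xstar : Vec n} (hxs : xstar ∈ X) (k : ℕ) :
    Integrable (fun ω => catNoise X Y gradF g μd L σ T z₀ (fun i => ξ i ω) xstar k) Pr ∧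
    ∫ ω, catNoise X Y gradF g μd L σ T z₀ (fun i => ξ i ω) xstar k ∂Pr
      ≤ 10 * stepSize μd L (Metric.diam Y) σ T (k + 1) * σ ^ 2 := by
  have hL : 0 < L := hμ.trans_le hμL
  obtain ⟨h1, h2, h3⟩ := measurable_catalystSREG hF hμ hμL hg hT hz₀ (ξ := ξ) k
  have hxc : Measurable[pastSamples ξ (2 * T * k)] fun ω =>
      catCenter X Y g μd L σ T z₀ (fun i => ξ i ω) k :=
    (h1.const_smul (gammaSeq (k + 1))).add (h2.fst.const_smul (1 - gammaSeq (k + 1)))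
  have hz : Measurable[pastSamples ξ (2 * T * k)] fun ω =>
      (catInit X Y g μd L σ T z₀ (fun i => ξ i ω) k).z := hxc.prodMk h3.snd
  have hc : ∀ ω, (catInit X Y g μd L σ T z₀ (fun i => ξ i ω) k).calls = 2 * T * k :=
    fun ω => catalystSREG_calls X Y g μd L σ T z₀ (fun i => ξ i ω) k
  have hη := stepSize_pos (DY := Metric.diam Y) (σ := σ) hμ hL hT (k + 1)
  have hβ := betaSeq_pos hμ (k + 1)
  have hr : Measurable[pastSamples ξ (2 * T * k)] fun ω =>
      catRef X Y g μd L σ T z₀ (fun i => ξ i ω) xstar k :=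
    Measurable.const_add (h2.fst.const_smul (1 - gammaSeq (k + 1))) (gammaSeq (k + 1) • xstar)
  exact integral_stageNoise_le hF hg hξ hlaw hindep hβ.le hμ.le hη.le hxc hz hc ⟨_, hz₀.1⟩
    ⟨_, hz₀.2⟩
    (fun ω => (hF.catalystSREG_mem (g := g) (σ := σ) hμ hμL hT hz₀ (fun i => ξ i ω) k).2.2) hr
    (fun ω => hF.catRef_mem (g := g) (σ := σ) hμ hμL hT hz₀ (fun i => ξ i ω) hxs k)
    (by omega) hβ hη

/-- Passing from a pathwise estimate by the oracle noise to an estimate in expectation. -/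
theorem integral_error_le {xstar : Vec n} (hxs : xstar ∈ X) {K : ℕ} {C₀ : ℝ}
    (h : ∀ ω, primalObj F Y (catalystSREG X Y g μd L σ T z₀ (fun i => ξ i ω) K).ztil.1
        - primalObj F Y xstar
        + μd / 6 * ‖dualBest F Y (catalystSREG X Y g μd L σ T z₀ (fun i => ξ i ω) K).ztil.1
          - (catalystSREG X Y g μd L σ T z₀ (fun i => ξ i ω) K).z.2‖ ^ 2
      ≤ 2 / outerWeight K * (C₀ + ∑ j ∈ Finset.range K,
          outerWeight (j + 1) * catNoise X Y gradF g μd L σ T z₀ (fun i => ξ i ω) xstar j)) :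
    ∫ ω, (primalObj F Y (catalystSREG X Y g μd L σ T z₀ (fun i => ξ i ω) K).ztil.1
        - primalObj F Y xstar
        + μd / 6 * ‖dualBest F Y (catalystSREG X Y g μd L σ T z₀ (fun i => ξ i ω) K).ztil.1
          - (catalystSREG X Y g μd L σ T z₀ (fun i => ξ i ω) K).z.2‖ ^ 2) ∂Pr
      ≤ 2 * C₀ / outerWeight K
        + 120 * K * σ ^ 2 * (qParam μd (Metric.diam Y) σ T * Real.log T) / (μd * T) := by
  have hL : 0 < L := hμ.trans_le hμL
  have hW := outerWeight_pos K
  have hN := integral_catNoise_le hF hμ hμL hg hT hz₀ hξ hlaw hindep hxs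
  have hi : ∀ j ∈ Finset.range K, Integrable (fun ω =>
      outerWeight (j + 1) * catNoise X Y gradF g μd L σ T z₀ (fun i => ξ i ω) xstar j) Pr :=
    fun j _ => (hN j).1.const_mul _
  have hsi := integrable_finsetSum _ hi
  -- A bound on the step size uniform over the subproblems; the final 120 is 2 · 10 · 6.
  set Q := 6 * (qParam μd (Metric.diam Y) σ T * Real.log T) / (μd * T) with hQ
  have hT' : (0 : ℝ) < T := by exact_mod_cast (by omega : 0 < T)
  have hQ0 : 0 ≤ Q := by
    have := one_le_qParam_mul_log (μd := μd) (DY := Metric.diam Y) (σ := σ) hT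
    positivity
  have hsum : ∑ j ∈ Finset.range K, ∫ ω, outerWeight (j + 1) *
      catNoise X Y gradF g μd L σ T z₀ (fun i => ξ i ω) xstar j ∂Pr
      ≤ ∑ _j ∈ Finset.range K, outerWeight K * (10 * Q * σ ^ 2) := by
    refine Finset.sum_le_sum fun j hj => ?_
    have hj' := Finset.mem_range.1 hj
    rw [integral_const_mul]
    have h1 : outerWeight (j + 1) ≤ outerWeight K := outerWeight_mono (by omega)
    have h2 : stepSize μd L (Metric.diam Y) σ T (j + 1) ≤ Q := stepSize_le hμ hT (by omega)
    calc _ ≤ outerWeight (j + 1) * (10 * stepSize μd L (Metric.diam Y) σ T (j + 1) * σ ^ 2) :=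
          mul_le_mul_of_nonneg_left (hN j).2 (outerWeight_pos _).le
      _ ≤ outerWeight (j + 1) * (10 * Q * σ ^ 2) := by
          have := (outerWeight_pos (j + 1)).le
          gcongr
      _ ≤ _ := by gcongr
  rw [Finset.sum_const, Finset.card_range, nsmul_eq_mul] at hsum
  refine (integral_mono (integrable_error hF hμ hμL hg hT hz₀ hξ K)
    (((integrable_const C₀).add hsi).const_mul _) h).trans ?_
  simp only [Pi.add_apply]
  rw [integral_const_mul, integral_add (integrable_const _) hsi, integral_finsetSum _ hi]
  simp only [integral_const, probReal_univ, one_smul]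
  calc _ ≤ 2 / outerWeight K * (C₀ + K * (outerWeight K * (10 * Q * σ ^ 2))) := by gcongr
    _ = _ := by rw [hQ]; field_simp; ring

end Measurability

end OuterExpectation

/-! ### Consequences of the lower bounds on K and T. -/

section Accuracy

theorem exp_half_mul_le_one_add_pow {x : ℝ} (h0 : 0 ≤ x) (h1 : x ≤ 1) (T : ℕ) :
    Real.exp (x * T / 2) ≤ (1 + x) ^ T := by
  have h2 : Real.exp (x / 2) ≤ 1 + x := by
    have h := Real.one_sub_le_exp_neg (x / 2)
    have h3 : 0 < Real.exp (x / 2) := Real.exp_pos _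
    rw [Real.exp_neg, le_inv_comm₀ (by linarith) h3] at h
    refine h.trans ?_
    rw [inv_le_comm₀ (by linarith) (by linarith), inv_le_iff_one_le_mul₀ (by linarith)]
    nlinarith
  calc Real.exp (x * T / 2) = Real.exp (x / 2) ^ T := by
        rw [← Real.exp_nat_mul]; congr 1; ring
    _ ≤ _ := pow_le_pow_left₀ (Real.exp_pos _).le h2 T

theorem le_exp_posLog (x : ℝ) : x ≤ Real.exp (Real.posLog x) := by
  rcases le_or_gt x 0 with h | h
  · exact h.trans (Real.exp_pos _).le
  · calc x = Real.exp (Real.log x) := (Real.exp_log h).symm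
      _ ≤ _ := Real.exp_le_exp.2 (le_max_right _ _)

/-- This resolves the implicit condition on T, from log T ≤ log A + T/A - 1. -/
theorem mul_log_le_two_mul {A T : ℝ} (hA : 0 < A) (hT : 0 < T)
    (h : A * max (Real.log A) 1 ≤ T) : A * Real.log T ≤ 2 * T := by
  have h1 := Real.log_le_sub_one_of_pos (div_pos hT hA)
  rw [Real.log_div hT.ne' hA.ne'] at h1
  have h2 : A * Real.log A ≤ T := (mul_le_mul_of_nonneg_left (le_max_left _ _) hA.le).trans h
  have h3 := mul_le_mul_of_nonneg_left h1 hA.le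
  have h4 : A * (T / A) = T := by field_simp
  nlinarith

theorem one_le_log_ninety_six : 1 ≤ Real.log 96 := by
  rw [Real.le_log_iff_exp_le (by norm_num)]
  linarith [Real.exp_one_lt_d9]

variable {μd L DY σ gap dx dy ε : ℝ} {K T : ℕ}

theorem two_mul_dx_add_dy_le (hε : 0 < ε) (hK : outerBound μd dx dy ε ≤ K) :
    24 * (2 * μd * dx + μd * dy) ≤ ε * (K : ℝ) ^ 2 := by
  have h := (Real.sqrt_le_iff.1 hK).2
  rw [div_le_iff₀ hε] at h
  linarith

theorem log_terms_nonneg (hK : 1 ≤ K) (x : ℝ) :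
    1 ≤ Real.log 96 + Real.log (48 * (K : ℝ) ^ 2) + Real.posLog x := by
  have hK' : (1 : ℝ) ≤ K := by exact_mod_cast hK
  have h2 : 0 ≤ Real.log (48 * (K : ℝ) ^ 2) := Real.log_nonneg (by nlinarith)
  linarith [one_le_log_ninety_six, Real.posLog_nonneg (x := x)]

variable (hμ : 0 < μd) (hμL : μd ≤ L) (hσ : 0 < σ) (hε : 0 < ε) (hK : 1 ≤ K)
include hμ hμL hσ hε hK

theorem innerBound_terms (hT : innerBound μd L DY σ gap dx ε K ≤ T) :
    288 * L / μd * (Real.log 96 + Real.log (48 * (K : ℝ) ^ 2)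
      + Real.posLog (16 * gap / (μd * dx))) ≤ T ∧
    24756 * σ ^ 2 * (Real.posLog (μd ^ 2 * DY ^ 2 / σ ^ 2) + 2) * K / (ε * μd) ≤ T ∧
    49152 * σ ^ 2 * K / (μd * ε) * max (Real.log (49152 * σ ^ 2 * K / (μd * ε))) 1 ≤ T := by
  have hL : 0 < L := hμ.trans_le hμL
  have h0 := log_terms_nonneg hK (16 * gap / (μd * dx))
  have h1 : 0 ≤ 288 * L / μd * (Real.log 96 + Real.log (48 * (K : ℝ) ^ 2)
      + Real.posLog (16 * gap / (μd * dx))) := mul_nonneg (by positivity) (by linarith)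
  have hp := Real.posLog_nonneg (x := μd ^ 2 * DY ^ 2 / σ ^ 2)
  have h2 : 0 ≤ 24756 * σ ^ 2 * (Real.posLog (μd ^ 2 * DY ^ 2 / σ ^ 2) + 2) * K / (ε * μd) := by
    positivity
  have h3 : 0 ≤ 49152 * σ ^ 2 * K / (μd * ε) *
      max (Real.log (49152 * σ ^ 2 * K / (μd * ε))) 1 :=
    mul_nonneg (by positivity) (zero_le_one.trans (le_max_right _ _))
  unfold innerBound at hT
  refine ⟨?_, ?_, ?_⟩ <;> linarith

theorem two_le_of_innerBound_le (hT : innerBound μd L DY σ gap dx ε K ≤ T) : 2 ≤ T := by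
  obtain ⟨h1, -, -⟩ := innerBound_terms hμ hμL hσ hε hK hT
  have h0 := log_terms_nonneg hK (16 * gap / (μd * dx))
  have h2 : (288 : ℝ) ≤ 288 * L / μd := by
    rw [le_div_iff₀ hμ]; linarith
  have h3 : (288 : ℝ) * 1 ≤ T := (mul_le_mul h2 h0 zero_le_one (by linarith)).trans h1
  have : (2 : ℝ) ≤ T := by linarith
  exact_mod_cast this

/-- Since q log T ≤ 2(log₊(μd²D_Y²/σ²) + log T), the second part of the inner bound pays for log₊
and the third for log T; 240/24756 + 480/49152 < 1/50. -/
theorem noise_term_le (hT : innerBound μd L DY σ gap dx ε K ≤ T) :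
    120 * K * σ ^ 2 * (qParam μd DY σ T * Real.log T) / (μd * T) ≤ ε / 50 := by
  obtain ⟨-, h2, h3⟩ := innerBound_terms hμ hμL hσ hε hK hT
  have hT2 := two_le_of_innerBound_le hμ hμL hσ hε hK hT
  have hT2' : (2 : ℝ) ≤ T := by exact_mod_cast hT2
  have hT0 : (0 : ℝ) < T := by linarith
  have hK' : (1 : ℝ) ≤ K := by exact_mod_cast hK
  set ℓ := Real.posLog (μd ^ 2 * DY ^ 2 / σ ^ 2) with hℓ
  have hℓ0 : 0 ≤ ℓ := Real.posLog_nonneg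
  have hq : qParam μd DY σ T * Real.log T ≤ 2 * (ℓ + Real.log T) := by
    rw [qParam_mul_log_eq hT2]
    refine max_le ?_ ?_
    · have : Real.log (μd ^ 2 * DY ^ 2 / (16 * σ ^ 2)) ≤ ℓ := by
        -- For one-point Y the convention log 0 = 0 is in force.
        by_cases hD : DY = 0
        · simpa [hD] using hℓ0
        · refine le_trans (Real.log_le_log (by positivity) ?_) (le_max_right _ _)
          gcongr
          nlinarith [sq_nonneg σ]
      linarith
    · have := Real.log_le_log (by norm_num) hT2'
      have := Real.log_two_gt_d9
      linarith
  set A := 49152 * σ ^ 2 * K / (μd * ε) with hA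
  have hA0 : 0 < A := by positivity
  have h4 := mul_log_le_two_mul hA0 hT0 h3
  have h5 : σ ^ 2 * K = A * (μd * ε) / 49152 := by rw [hA]; field_simp
  have h6 : 24756 * (σ ^ 2 * K) * (ℓ + 2) ≤ T * (ε * μd) := by
    rw [div_le_iff₀ (by positivity)] at h2
    linarith
  rw [div_le_iff₀ (by positivity)]
  have h7 : 120 * (σ ^ 2 * K) * (qParam μd DY σ T * Real.log T)
      ≤ 120 * (σ ^ 2 * K) * (2 * (ℓ + Real.log T)) := by gcongr
  have h8 : (σ ^ 2 * K) * Real.log T ≤ 2 * T * (μd * ε) / 49152 := by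
    rw [h5]
    have := mul_le_mul_of_nonneg_right h4 (show 0 ≤ μd * ε by positivity)
    linarith
  have h9 : 0 ≤ σ ^ 2 * K := by positivity
  have h10 : 0 < T * (ε * μd) := by positivity
  linarith

/-- The first part of the inner bound makes θT/2 exceed the three logarithms, so Λ_T ≥ 96 · 48 K²
exp(log₊(16ρ)); 4607 = 96 · 48 - 1 accounts for Λ_T - 1. -/
theorem contraction_params (hT : innerBound μd L DY σ gap dx ε K ≤ T)
    (hθ : thetaParam μd L DY σ T = μd / (96 * L)) {e : ℝ}
    (he : e = 1 / (bigLambda μd L DY σ T - 1)) :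
    0 < e ∧ e * (4607 * (K : ℝ) ^ 2 * Real.exp (Real.posLog (16 * gap / (μd * dx)))) ≤ 1 := by
  have hL : 0 < L := hμ.trans_le hμL
  obtain ⟨h1, -, -⟩ := innerBound_terms hμ hμL hσ hε hK hT
  have hT2 := two_le_of_innerBound_le hμ hμL hσ hε hK hT
  have hK' : (1 : ℝ) ≤ K := by exact_mod_cast hK
  have hM := one_lt_bigLambda (DY := DY) (σ := σ) hμ hL hT2
  have h0 := log_terms_nonneg hK (16 * gap / (μd * dx))
  set r := Real.posLog (16 * gap / (μd * dx)) with hr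
  have hr1 : 1 ≤ Real.exp r := Real.one_le_exp Real.posLog_nonneg
  have hθ1 : μd / (96 * L) ≤ 1 := by rw [div_le_one (by positivity)]; linarith
  have h2 : Real.log 96 + Real.log (48 * (K : ℝ) ^ 2) + r ≤ μd / (96 * L) * T / 2 := by
    have h3 := mul_le_mul_of_nonneg_left h1 (show 0 ≤ μd / (96 * L) / 2 by positivity)
    have h4 : μd / (96 * L) / 2 * (288 * L / μd * (Real.log 96 + Real.log (48 * (K : ℝ) ^ 2) + r))
        = 3 / 2 * (Real.log 96 + Real.log (48 * (K : ℝ) ^ 2) + r) := by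
      field_simp; ring
    rw [h4] at h3
    linarith
  have h5 := (Real.exp_le_exp.2 h2).trans
    (exp_half_mul_le_one_add_pow (by positivity) hθ1 T)
  rw [Real.exp_add, Real.exp_add, Real.exp_log (by norm_num), Real.exp_log (by positivity),
    ← hθ, ← bigLambda_eq] at h5
  have h6 : 1 ≤ (K : ℝ) ^ 2 * Real.exp r := by nlinarith
  have hM0 : 0 < bigLambda μd L DY σ T - 1 := by linarith
  refine ⟨by rw [he]; positivity, ?_⟩
  rw [he, div_mul_eq_mul_div, div_le_one hM0]
  linarith

/-- The factor 2 in q offsets the loss in exp(θT/2) ≤ Λ_T, so that Λ_T ≥ μd²D_Y²T/(16σ²). The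
alternative 1/log T in q ensures Λ_T ≥ 3/2, whence e ≤ 3/Λ_T. -/
theorem bounded_params (hT : innerBound μd L DY σ gap dx ε K ≤ T)
    (hθ : thetaParam μd L DY σ T = qParam μd DY σ T * Real.log T / T) {e : ℝ}
    (he : e = 1 / (bigLambda μd L DY σ T - 1)) :
    e ≤ 2 ∧ μd / 4 * e * DY ^ 2 ≤ 12 * σ ^ 2 / (μd * T) := by
  have hL : 0 < L := hμ.trans_le hμL
  have hT2 := two_le_of_innerBound_le hμ hμL hσ hε hK hT
  have hT0 : (0 : ℝ) < T := by exact_mod_cast (by omega : 0 < T)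
  have hθ1 : thetaParam μd L DY σ T ≤ 1 := by
    refine (min_le_left _ _).trans ?_
    rw [div_le_one (by positivity)]; linarith
  have h5 := exp_half_mul_le_one_add_pow (thetaParam_pos (DY := DY) (σ := σ) hμ hL hT2).le hθ1 T
  rw [← bigLambda_eq, hθ, div_mul_cancel₀ _ hT0.ne', qParam_mul_log_eq hT2] at h5
  set M := bigLambda μd L DY σ T
  have h6 : 3 / 2 ≤ M := by
    refine le_trans ?_ h5
    have h7 := Real.add_one_le_exp
      (max (2 * (Real.log (μd ^ 2 * DY ^ 2 / (16 * σ ^ 2)) + Real.log T)) 1 / 2)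
    have := le_max_right (2 * (Real.log (μd ^ 2 * DY ^ 2 / (16 * σ ^ 2)) + Real.log T)) 1
    linarith
  have he3 : e ≤ 3 / M := by
    rw [he, div_le_div_iff₀ (by linarith) (by linarith)]
    linarith
  refine ⟨?_, ?_⟩
  · refine he3.trans ?_
    rw [div_le_iff₀ (by linarith)]
    linarith
  · by_cases hD : DY = 0
    · rw [hD]; simp; positivity
    · have h8 : μd ^ 2 * DY ^ 2 / (16 * σ ^ 2) * T ≤ M := by
        refine le_trans ?_ h5
        calc μd ^ 2 * DY ^ 2 / (16 * σ ^ 2) * T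
            = Real.exp (Real.log (μd ^ 2 * DY ^ 2 / (16 * σ ^ 2)) + Real.log T) := by
              rw [Real.exp_add, Real.exp_log (by positivity), Real.exp_log hT0]
          _ ≤ _ := by
              refine Real.exp_le_exp.2 ?_
              have := le_max_left
                (2 * (Real.log (μd ^ 2 * DY ^ 2 / (16 * σ ^ 2)) + Real.log T)) 1
              linarith
      have h9 : e ≤ 3 / (μd ^ 2 * DY ^ 2 / (16 * σ ^ 2) * T) := by
        refine he3.trans ?_
        gcongr
      calc μd / 4 * e * DY ^ 2 ≤ μd / 4 * (3 / (μd ^ 2 * DY ^ 2 / (16 * σ ^ 2) * T)) * DY ^ 2 := by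
            gcongr
        _ = _ := by field_simp; norm_num

end Accuracy

theorem le_outerWeight (K : ℕ) : (K : ℝ) ^ 2 ≤ outerWeight K := by
  unfold outerWeight
  nlinarith [(Nat.cast_nonneg K : (0 : ℝ) ≤ K)]

theorem outerWeight_le {K : ℕ} (hK : 1 ≤ K) : outerWeight K ≤ 6 * (K : ℝ) ^ 2 := by
  have hK' : (1 : ℝ) ≤ K := by exact_mod_cast hK
  unfold outerWeight
  nlinarith

/-- Accuracy of the scheme with admissible iteration counts. -/
theorem catalystSREG_accuracy {n m : ℕ} {X : Set (Vec n)} {Y : Set (Vec m)}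
    {F : Vec n → Vec m → ℝ} {gradF : Pt n m → Pt n m} {μd L σ : ℝ}
    (hμ : 0 < μd) (hμL : μd ≤ L) (hσ : 0 < σ)
    (hF : IsMinimaxProblem X Y F gradF 0 μd L)
    {Ξ : Type*} [MeasurableSpace Ξ] {g : Pt n m → Ξ → Pt n m} {P : Measure Ξ}
    (hg : IsSFO X Y gradF g P σ)
    {Ω : Type*} [MeasurableSpace Ω] {Pr : Measure Ω} [IsProbabilityMeasure Pr]
    {ξ : ℕ → Ω → Ξ} (hξ : ∀ i, Measurable (ξ i)) (hlaw : ∀ i, Pr.map (ξ i) = P)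
    (hindep : iIndepFun ξ Pr)
    {x₀ : Vec n} {y₀ : Vec m} (hx₀ : x₀ ∈ X) (hy₀ : y₀ ∈ Y)
    {xstar : Vec n} (hxs : xstar ∈ X) (hmin : IsMinOn (primalObj F Y) X xstar)
    {gap dx dy : ℝ} (hgap : gap = primalObj F Y x₀ - primalObj F Y xstar)
    (hdx : dx = ‖xstar - x₀‖ ^ 2) (hdy : dy = ‖dualBest F Y x₀ - y₀‖ ^ 2)
    {ε : ℝ} (hε : 0 < ε) {K : ℕ} (hK : 1 ≤ K) (hKb : outerBound μd dx dy ε ≤ K) {T : ℕ}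
    (hT : innerBound μd L (Metric.diam Y) σ gap dx ε K ≤ T) :
    ∫ ω, (primalObj F Y (catalystSREG X Y g μd L σ T (x₀, y₀) (fun i => ξ i ω) K).ztil.1
        - primalObj F Y xstar
        + μd / 6 * ‖dualBest F Y (catalystSREG X Y g μd L σ T (x₀, y₀) (fun i => ξ i ω) K).ztil.1
          - (catalystSREG X Y g μd L σ T (x₀, y₀) (fun i => ξ i ω) K).z.2‖ ^ 2) ∂Pr ≤ ε := by
  have hL : 0 < L := hμ.trans_le hμL
  have hT2 := two_le_of_innerBound_le hμ hμL hσ hε hK hT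
  have hT0 : (0 : ℝ) < T := by exact_mod_cast (by omega : 0 < T)
  have hK' : (1 : ℝ) ≤ K := by exact_mod_cast hK
  have hz₀ : ((x₀, y₀) : Pt n m) ∈ X ×ˢ Y := ⟨hx₀, hy₀⟩
  have hnoise := noise_term_le hμ hμL hσ hε hK hT
  have hdist := two_mul_dx_add_dy_le hε hKb
  have hdx0 : 0 ≤ dx := by rw [hdx]; positivity
  have hdy0 : 0 ≤ dy := by rw [hdy]; positivity
  have hgap0 : 0 ≤ gap := by rw [hgap]; exact sub_nonneg.2 (isMinOn_iff.1 hmin _ hx₀)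
  have hW := outerWeight_pos K
  have hWK := le_outerWeight K
  set e := 1 / (bigLambda μd L (Metric.diam Y) σ T - 1) with he
  -- The two regimes: step size limited by smoothness, or by the noise.
  rcases min_choice (μd / (96 * L)) (qParam μd (Metric.diam Y) σ T * Real.log T / T) with hθ | hθ
  · obtain ⟨he0, he1⟩ := contraction_params hμ hμL hσ hε hK hT hθ he
    set r := Real.exp (Real.posLog (16 * gap / (μd * dx))) with hr
    have hr1 : 1 ≤ r := Real.one_le_exp Real.posLog_nonneg
    have hK2 : 1 ≤ (K : ℝ) ^ 2 := by nlinarith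
    have he2 : e * (4607 * (K : ℝ) ^ 2) ≤ 1 := by
      exact (mul_le_mul_of_nonneg_left (le_mul_of_one_le_right (by positivity) hr1) he0.le).trans
        he1
    have he3 : e * (4607 * r) ≤ 1 := by
      refine le_trans ?_ he1
      gcongr
      linarith
    have he4 : e * 4607 ≤ 1 := by nlinarith
    have hgapr : 16 * gap ≤ r * (μd * dx) := by
      -- If dx = 0 the quotient ρ is meaningless, but then x₀ = x* and the gap vanishes.
      rcases hdx0.eq_or_lt with h | h
      · have h1 : xstar = x₀ := by
          rw [hdx] at h
          exact sub_eq_zero.1 (norm_eq_zero.1 (sq_eq_zero_iff.1 h.symm))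
        rw [hgap, h1, ← h]; simp
      · exact (div_le_iff₀ (by positivity)).1 (le_exp_posLog _)
    have hpath := fun ω => hF.error_le_of_contraction (g := g) (σ := σ) (K := K) hμ hμL hT2 hz₀
      (fun i => ξ i ω) hxs hmin he hK (by linarith) (by
        have := mul_le_mul_of_nonneg_left (outerWeight_le hK) he0.le
        linarith)
    simp only [← hdx, ← hdy, ← hgap] at hpath
    refine (integral_error_le hF hμ hμL hg hT2 hz₀ hξ hlaw hindep hxs hpath).trans ?_
    have hC : μd * (1 + e) / 2 * dx + 12 * e * gap + 2 * e * μd * dy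
        ≤ 2 * μd * dx + μd * dy := by
      have h1 : 12 * e * gap ≤ 1 / 2 * (μd * dx) := by
        have h2 := mul_le_mul_of_nonneg_left hgapr he0.le
        have h3 := mul_le_mul_of_nonneg_right he3 (show 0 ≤ μd * dx by positivity)
        have : 0 ≤ μd * dx := by positivity
        linarith
      have h2 : e * (μd * dx) ≤ 1 * (μd * dx) := by gcongr; linarith
      have h3 : e * (μd * dy) ≤ 1 / 2 * (μd * dy) := by gcongr; linarith
      have h4 : 0 ≤ μd * dx := by positivity
      linarith
    have h4 : 2 * (μd * (1 + e) / 2 * dx + 12 * e * gap + 2 * e * μd * dy) / outerWeight K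
        ≤ ε / 12 := by
      rw [div_le_iff₀ hW]
      have := mul_le_mul_of_nonneg_left hWK hε.le
      linarith
    linarith
  · obtain ⟨he2, heD⟩ := bounded_params hμ hμL hσ hε hK hT hθ he
    have hpath := fun ω => hF.error_le_of_bounded (g := g) (σ := σ) (K := K) hμ hμL hT2 hz₀
      (fun i => ξ i ω) hxs hmin he hK
    simp only [← hdx] at hpath
    refine (integral_error_le hF hμ hμL hg hT2 hz₀ hξ hlaw hindep hxs hpath).trans ?_
    obtain ⟨-, h2, -⟩ := innerBound_terms hμ hμL hσ hε hK hT
    -- The summand 2 next to log₊ in the second part of the inner bound is what pays here.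
    have h3 : K * (12 * σ ^ 2 / (μd * T)) ≤ ε / 100 := by
      rw [mul_div_assoc', div_le_iff₀ (by positivity)]
      rw [div_le_iff₀ (by positivity)] at h2
      have : 0 ≤ σ ^ 2 * Real.posLog (μd ^ 2 * Metric.diam Y ^ 2 / σ ^ 2) * K :=
        mul_nonneg (mul_nonneg (sq_nonneg _) Real.posLog_nonneg) (by positivity)
      have : 0 ≤ σ ^ 2 * K := by positivity
      linarith
    have h4 : K * (μd / 4 * e * Metric.diam Y ^ 2) ≤ ε / 100 :=
      (mul_le_mul_of_nonneg_left heD (by positivity)).trans h3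
    have h5 : 2 * (μd * (1 + e) / 2 * dx
        + K * outerWeight K * (μd / 4 * e * Metric.diam Y ^ 2)) / outerWeight K
        ≤ ε / 2 := by
      rw [div_le_iff₀ hW]
      have h6 := mul_le_mul_of_nonneg_left h4 hW.le
      have h7 := mul_le_mul_of_nonneg_left hWK hε.le
      have h8 : e * (μd * dx) ≤ 2 * (μd * dx) := by gcongr
      have h9 : 0 ≤ μd * dy := by positivity
      have h10 : 0 ≤ outerWeight K * ε := by positivity
      linarith
    linarith

/-! ### Counting oracle calls. -/

section Complexity

theorem log_le_of_le_pow {x : ℝ} (hx : 0 < x) {k : ℕ} (h : x ≤ (2.7 : ℝ) ^ k) :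
    Real.log x ≤ k := by
  rw [Real.log_le_iff_le_exp hx]
  refine h.trans ?_
  rw [← Real.exp_one_pow]
  exact pow_le_pow_left₀ (by norm_num) (by linarith [Real.exp_one_gt_d9]) k

variable {μd L DY σ gap dx dy ε : ℝ}

theorem sqrt_div_eq (hμ : 0 < μd) (hε : 0 < ε) (D : ℝ) :
    Real.sqrt (μd * D / ε) = μd * (Real.sqrt D / Real.sqrt (μd * ε)) := by
  rw [← Real.sqrt_div' _ (by positivity)]
  nth_rewrite 2 [← Real.sqrt_sq hμ.le]
  rw [← Real.sqrt_mul (by positivity)]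
  congr 1
  field_simp

/-- 24 · 2 ≤ 7², and rounding up costs at most one more square root, which is at least 1 because ε ≤
μd D₀. -/
theorem outerCount_le (hμ : 0 < μd) (hdy : 0 ≤ dy) (hε : 0 < ε)
    (hεD : ε ≤ μd * (dx + dy)) :
    (outerCount μd dx dy ε : ℝ) ≤ 8 * Real.sqrt (μd * (dx + dy) / ε) := by
  have hS : 1 ≤ Real.sqrt (μd * (dx + dy) / ε) := by
    rw [Real.one_le_sqrt, one_le_div hε]
    exact hεD
  have h1 : outerBound μd dx dy ε ≤ 7 * Real.sqrt (μd * (dx + dy) / ε) := by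
    rw [outerBound, show (7 : ℝ) = Real.sqrt (7 ^ 2) from (Real.sqrt_sq (by norm_num)).symm,
      ← Real.sqrt_mul (by norm_num)]
    refine Real.sqrt_le_sqrt ?_
    rw [mul_div_assoc']
    refine div_le_div_of_nonneg_right ?_ hε.le
    nlinarith [mul_nonneg hμ.le hdy]
  have h2 : (⌈outerBound μd dx dy ε⌉₊ : ℝ) < outerBound μd dx dy ε + 1 :=
    Nat.ceil_lt_add_one (Real.sqrt_nonneg _)
  rw [outerCount, Nat.cast_max]
  refine max_le ?_ ?_
  · rw [Nat.cast_one]; linarith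
  · linarith

theorem innerCount_le (hμ : 0 < μd) (hμL : μd ≤ L) (hσ : 0 < σ) (hε : 0 < ε) {K : ℕ}
    (hK : 1 ≤ K) :
    (innerCount μd L DY σ gap dx ε K : ℝ) ≤ 2 * innerBound μd L DY σ gap dx ε K := by
  have hL : 0 < L := hμ.trans_le hμL
  have h1 : 1 ≤ innerBound μd L DY σ gap dx ε K := by
    have h0 := log_terms_nonneg hK (16 * gap / (μd * dx))
    have hp := Real.posLog_nonneg (x := μd ^ 2 * DY ^ 2 / σ ^ 2)
    have h2 : 0 ≤ 24756 * σ ^ 2 * (Real.posLog (μd ^ 2 * DY ^ 2 / σ ^ 2) + 2) * K / (ε * μd) := by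
      positivity
    have h3 : 0 ≤ 49152 * σ ^ 2 * K / (μd * ε) *
        max (Real.log (49152 * σ ^ 2 * K / (μd * ε))) 1 :=
      mul_nonneg (by positivity) (zero_le_one.trans (le_max_right _ _))
    have h4 : (1 : ℝ) ≤ 288 * L / μd := by
      rw [le_div_iff₀ hμ]; linarith
    have h5 := one_le_mul_of_one_le_of_one_le h4 h0
    unfold innerBound
    linarith
  have h2 := Nat.ceil_lt_add_one (zero_le_one.trans h1)
  rw [innerCount]
  linarith

/-- The 4 is 2 for the calls per step times 2 for rounding T up. With S² = μd D₀/ε, the smoothness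
part carries one factor K ≤ 8S, while both noise parts contain K already and carry K² ≤ 64S². The
logarithm of K costs only a multiple of 1 + log S. -/
theorem four_mul_innerBound_mul_le (hμ : 0 < μd) (hμL : μd ≤ L) (hσ : 0 < σ)
    (hε : 0 < ε) (hεD : ε ≤ μd * (dx + dy)) {K : ℕ} (hK : 1 ≤ K)
    (hKS : (K : ℝ) ≤ 8 * Real.sqrt (μd * (dx + dy) / ε)) :
    4 * innerBound μd L DY σ gap dx ε K * K ≤
      10 ^ 9 * (L * Real.sqrt (dx + dy) / Real.sqrt (μd * ε) *
              (1 + Real.log (μd * (dx + dy) / ε) + Real.posLog (gap / (μd * dx)))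
            + σ ^ 2 * (dx + dy) / ε ^ 2 *
              (1 + Real.posLog (σ ^ 2 / (μd * ε)) + Real.posLog (μd ^ 2 * DY ^ 2 / σ ^ 2)
                + Real.log (μd * (dx + dy) / ε))) := by
  have hL : 0 < L := hμ.trans_le hμL
  have hK' : (1 : ℝ) ≤ K := by exact_mod_cast hK
  set D := dx + dy with hD
  have hD0 : 0 < D := by
    have : 0 < μd * D := hε.trans_le hεD
    exact pos_of_mul_pos_right this hμ.le
  set S := Real.sqrt (μd * D / ε) with hS
  have hS2 : S ^ 2 = μd * D / ε := Real.sq_sqrt (by positivity)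
  have hS1 : 1 ≤ S := by
    rw [hS, Real.one_le_sqrt, one_le_div hε]
    exact hεD
  set l := Real.log (μd * D / ε) with hl
  have hl2 : l = 2 * Real.log S := by rw [hl, ← hS2, Real.log_pow]; norm_num
  have hlS : 0 ≤ Real.log S := Real.log_nonneg hS1
  set r := Real.posLog (gap / (μd * dx)) with hr
  have hr0 : 0 ≤ r := Real.posLog_nonneg
  set q := σ ^ 2 / (μd * ε) with hq
  have hq0 : 0 < q := by positivity
  set p := Real.posLog q with hp
  have hp0 : 0 ≤ p := Real.posLog_nonneg
  set d := Real.posLog (μd ^ 2 * DY ^ 2 / σ ^ 2) with hd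
  have hd0 : 0 ≤ d := Real.posLog_nonneg
  have hK2 : (K : ℝ) ^ 2 ≤ 64 * (μd * D / ε) := by
    rw [← hS2]; nlinarith
  have b1 : Real.log 96 ≤ 5 := log_le_of_le_pow (k := 5) (by norm_num) (by norm_num)
  have b2 : Real.log (48 * (K : ℝ) ^ 2) ≤ 9 + l := by
    have h1 : Real.log 3072 ≤ 9 := log_le_of_le_pow (k := 9) (by norm_num) (by norm_num)
    have h2 : Real.log (48 * (K : ℝ) ^ 2) ≤ Real.log (3072 * (μd * D / ε)) :=
      Real.log_le_log (by positivity) (by linarith)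
    have h3 : Real.log (3072 * (μd * D / ε)) = Real.log 3072 + l :=
      Real.log_mul (by norm_num) (by positivity)
    linarith
  have b3 : Real.posLog (16 * gap / (μd * dx)) ≤ 3 + r := by
    have h1 : Real.log 16 ≤ 3 := log_le_of_le_pow (k := 3) (by norm_num) (by norm_num)
    have h2 : Real.posLog (16 * (gap / (μd * dx))) ≤ Real.posLog 16 + r := Real.posLog_mul
    have h3 : Real.posLog 16 ≤ 3 := max_le (by norm_num) h1
    rw [mul_div_assoc]
    linarith
  have b4 : max (Real.log (49152 * σ ^ 2 * K / (μd * ε))) 1 ≤ 13 * (1 + p + l) := by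
    have h1 : Real.log 393216 ≤ 13 := log_le_of_le_pow (k := 13) (by norm_num) (by norm_num)
    refine max_le ?_ (by linarith)
    have h2 : 49152 * σ ^ 2 * K / (μd * ε) ≤ 393216 * (S * q) := by
      calc 49152 * σ ^ 2 * K / (μd * ε) = 49152 * q * K := by rw [hq]; ring
        _ ≤ 49152 * q * (8 * S) := by gcongr
        _ = _ := by ring
    have h3 := Real.log_le_log (by positivity) h2
    rw [Real.log_mul (by norm_num) (by positivity), Real.log_mul (by positivity) (by positivity)]
      at h3
    have h4 : Real.log q ≤ p := le_max_right _ _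
    linarith
  have eS : L * Real.sqrt D / Real.sqrt (μd * ε) = L / μd * S := by
    rw [hS, sqrt_div_eq hμ hε]
    field_simp
  have eV : σ ^ 2 * D / ε ^ 2 = q * (μd * D / ε) := by rw [hq]; field_simp
  rw [eS, eV]
  have hl0 : 0 ≤ l := by linarith
  have u1 : 0 ≤ 1 + l + r := by linarith
  have u2 : 0 ≤ 1 + p + d + l := by linarith
  set V := μd * D / ε with hV
  have hV0 : 0 < V := by positivity
  have i1 : 4 * (288 * L / μd * (Real.log 96 + Real.log (48 * (K : ℝ) ^ 2)
      + Real.posLog (16 * gap / (μd * dx)))) * K ≤ 156672 * (L / μd * S * (1 + l + r)) := by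
    calc _ ≤ 4 * (288 * L / μd * (17 * (1 + l + r))) * (8 * S) := by
          gcongr
          linarith
      _ = _ := by ring
  have i2 : 4 * (24756 * σ ^ 2 * (d + 2) * K / (ε * μd)) * K ≤
      12675072 * (q * V * (1 + p + d + l)) := by
    calc _ = 99024 * q * (d + 2) * (K : ℝ) ^ 2 := by rw [hq]; field_simp; ring
      _ ≤ 99024 * q * (2 * (1 + p + d + l)) * (64 * V) := by
          gcongr
          linarith
      _ = _ := by ring
  have i3 : 4 * (49152 * σ ^ 2 * K / (μd * ε) *
      max (Real.log (49152 * σ ^ 2 * K / (μd * ε))) 1) * K ≤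
      163577856 * (q * V * (1 + p + d + l)) := by
    calc _ ≤ 4 * (49152 * σ ^ 2 * K / (μd * ε) * (13 * (1 + p + l))) * K := by gcongr
      _ = 2555904 * q * (1 + p + l) * (K : ℝ) ^ 2 := by rw [hq]; field_simp; ring
      _ ≤ 2555904 * q * (1 + p + d + l) * (64 * V) := by
          refine mul_le_mul (mul_le_mul_of_nonneg_left ?_ (by positivity)) (by linarith)
            (by positivity) (mul_nonneg (by positivity) u2)
          linarith
      _ = _ := by ring
  have j1 : 0 ≤ L / μd * S * (1 + l + r) := mul_nonneg (by positivity) (by linarith)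
  have j2 : 0 ≤ q * V * (1 + p + d + l) := mul_nonneg (by positivity) (by linarith)
  unfold innerBound
  rw [← hd]
  linarith

variable {n m : ℕ} {Ξ : Type*} (X : Set (Vec n)) (Y : Set (Vec m)) (g : Pt n m → Ξ → Pt n m)

theorem sfoCalls_le (hμ : 0 < μd) (hμL : μd ≤ L) (hσ : 0 < σ)
    (hdy : 0 ≤ dy) (hε : 0 < ε) (hεD : ε ≤ μd * (dx + dy)) (z₀ : Pt n m) (s : ℕ → Ξ) :
    (sfoCalls X Y g μd L σ z₀ s gap dx dy ε : ℝ) ≤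
      10 ^ 9 * (L * Real.sqrt (dx + dy) / Real.sqrt (μd * ε) *
              (1 + Real.log (μd * (dx + dy) / ε) + Real.posLog (gap / (μd * dx)))
            + σ ^ 2 * (dx + dy) / ε ^ 2 *
              (1 + Real.posLog (σ ^ 2 / (μd * ε))
                + Real.posLog (μd ^ 2 * Metric.diam Y ^ 2 / σ ^ 2)
                + Real.log (μd * (dx + dy) / ε))) := by
  have hK : 1 ≤ outerCount μd dx dy ε := le_max_left _ _
  refine le_trans ?_ (four_mul_innerBound_mul_le hμ hμL hσ hε hεD hK
    (outerCount_le hμ hdy hε hεD))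
  rw [sfoCalls, catalystSREG_calls]
  push_cast
  have h := innerCount_le (DY := Metric.diam Y) (gap := gap) (dx := dx) hμ hμL hσ hε hK
  have : (0 : ℝ) ≤ outerCount μd dx dy ε := Nat.cast_nonneg _
  refine mul_le_mul_of_nonneg_right ?_ this
  linarith

theorem tendsto_log_div_mul (hμ : 0 < μd) {a : ℝ} (ha : 0 < a) :
    Tendsto (fun ε : ℝ => Real.log (a / (μd * ε))) (𝓝[>] 0) atTop := by
  refine Real.tendsto_log_atTop.comp ?_
  have h := tendsto_inv_nhdsGT_zero (𝕜 := ℝ) |>.const_mul_atTop (div_pos ha hμ)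
  refine h.congr fun ε => ?_
  rw [div_mul_eq_div_div, ← div_eq_mul_inv]

/-- log(μd D₀/ε) and log(σ²/(μd ε)) differ by the constant `c` and tend to infinity, so for small ε
they dominate all constant terms, including the possibly negative `cD`. Replacing √D₀ by D₀ puts
1/√D₀ into the constant. -/
theorem sfoCalls_isBigO (hμ : 0 < μd) (hμL : μd ≤ L) (hσ : 0 < σ)
    (hdy : 0 ≤ dy) (hD : 0 < dx + dy) (z₀ : Pt n m) (s : ℕ → Ξ) :
    (fun ε : ℝ => (sfoCalls X Y g μd L σ z₀ s gap dx dy ε : ℝ)) =O[𝓝[>] 0]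
        (fun ε : ℝ =>
          L * (dx + dy) / Real.sqrt (μd * ε) * Real.log (μd * (dx + dy) / ε)
            + σ ^ 2 * (dx + dy) / ε ^ 2 *
              (Real.log (σ ^ 2 / (μd * ε))
                + Real.log (μd ^ 2 * Metric.diam Y ^ 2 / σ ^ 2))) := by
  have hL : 0 < L := hμ.trans_le hμL
  set D := dx + dy with hDdef
  set cD := Real.log (μd ^ 2 * Metric.diam Y ^ 2 / σ ^ 2) with hcD
  set d := Real.posLog (μd ^ 2 * Metric.diam Y ^ 2 / σ ^ 2) with hd
  set r := Real.posLog (gap / (μd * dx)) with hr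
  set c := Real.log (μd ^ 2 * D / σ ^ 2) with hc
  refine IsBigO.of_bound (10 ^ 9 * (2 / Real.sqrt D + 4)) ?_
  have t2 := tendsto_log_div_mul hμ (show 0 < σ ^ 2 by positivity)
  filter_upwards [self_mem_nhdsWithin, Ioo_mem_nhdsGT (show 0 < μd * D by positivity),
    t2.eventually_ge_atTop 0, t2.eventually_ge_atTop (1 + r - c),
    t2.eventually_ge_atTop (1 + d + c - 4 * cD), t2.eventually_ge_atTop (- cD),
    t2.eventually_ge_atTop (-c)]
    with ε hε hεD e0 e1 e2 e3 e4
  have hε0 : 0 < ε := hε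
  have hN := sfoCalls_le X Y g (gap := gap) hμ hμL hσ hdy hε0 hεD.2.le z₀ s
  rw [← hDdef, ← hr, ← hd] at hN
  set l₂ := Real.log (σ ^ 2 / (μd * ε)) with hl₂
  have hl₁ : Real.log (μd * D / ε) = l₂ + c := by
    rw [hl₂, hc, ← Real.log_mul (by positivity) (by positivity)]
    congr 1
    field_simp
  have hp : Real.posLog (σ ^ 2 / (μd * ε)) = l₂ := max_eq_right e0
  rw [hl₁, hp] at hN
  rw [hl₁]
  have hsD : 0 < Real.sqrt D := Real.sqrt_pos.2 hD
  have hse : 0 < Real.sqrt (μd * ε) := Real.sqrt_pos.2 (by positivity)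
  have hA : L * Real.sqrt D / Real.sqrt (μd * ε)
      = 1 / Real.sqrt D * (L * D / Real.sqrt (μd * ε)) := by
    nth_rewrite 3 [← Real.mul_self_sqrt hD.le]
    field_simp
  rw [hA] at hN
  set A := L * D / Real.sqrt (μd * ε) with hAdef
  set B := σ ^ 2 * D / ε ^ 2 with hB
  have hA0 : 0 < A := by positivity
  have hB0 : 0 < B := by positivity
  have k1 : 0 ≤ A * (l₂ + c) := mul_nonneg hA0.le (by linarith)
  have k2 : 0 ≤ B * (l₂ + cD) := mul_nonneg hB0.le (by linarith)
  rw [Real.norm_of_nonneg (Nat.cast_nonneg _), Real.norm_of_nonneg (add_nonneg k1 k2)]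
  refine hN.trans ?_
  have k3 : 1 / Real.sqrt D * A * (1 + (l₂ + c) + r) ≤ 2 / Real.sqrt D * (A * (l₂ + c)) := by
    calc _ ≤ 1 / Real.sqrt D * A * (2 * (l₂ + c)) := by
          gcongr
          linarith
      _ = _ := by ring
  have k4 : B * (1 + l₂ + d + (l₂ + c)) ≤ 4 * (B * (l₂ + cD)) := by
    calc _ ≤ B * (4 * (l₂ + cD)) := by
          gcongr
          linarith
      _ = _ := by ring
  have k5 : 0 ≤ 2 / Real.sqrt D * (B * (l₂ + cD)) := mul_nonneg (by positivity) k2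
  linarith

end Complexity

theorem mainTheorem8 {n m : ℕ} {X : Set (Vec n)} {Y : Set (Vec m)}
    {F : Vec n → Vec m → ℝ} {gradF : Pt n m → Pt n m} {μd L σ : ℝ}
    (hμd : 0 < μd) (hμdL : μd ≤ L) (hσ : 0 < σ)
    (hF : IsMinimaxProblem X Y F gradF 0 μd L)
    {Ξ : Type*} [MeasurableSpace Ξ] {g : Pt n m → Ξ → Pt n m} {P : Measure Ξ}
    (hg : IsSFO X Y gradF g P σ)
    {Ω : Type*} [MeasurableSpace Ω] {Pr : Measure Ω} [IsProbabilityMeasure Pr]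
    {ξ : ℕ → Ω → Ξ} (hξ : ∀ i, Measurable (ξ i)) (hlaw : ∀ i, Pr.map (ξ i) = P)
    (hindep : iIndepFun ξ Pr)
    {x₀ : Vec n} {y₀ : Vec m} (hx₀ : x₀ ∈ X) (hy₀ : y₀ ∈ Y)
    {xstar : Vec n} (hxstar : xstar ∈ X) (hmin : IsMinOn (primalObj F Y) X xstar)
    {gap dx dy : ℝ} (hgap : gap = primalObj F Y x₀ - primalObj F Y xstar)
    (hdx : dx = ‖xstar - x₀‖ ^ 2) (hdy : dy = ‖dualBest F Y x₀ - y₀‖ ^ 2) :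
    -- accuracy
    (∀ ε : ℝ, 0 < ε → ∀ K : ℕ, 1 ≤ K → outerBound μd dx dy ε ≤ K →
      ∀ T : ℕ, innerBound μd L (Metric.diam Y) σ gap dx ε K ≤ T →
        let out : Ω → CatState n m :=
          fun ω => catalystSREG X Y g μd L σ T (x₀, y₀) (fun i => ξ i ω) K
        let err : Ω → ℝ := fun ω =>
          primalObj F Y (out ω).ztil.1 - primalObj F Y xstar
            + μd / 6 * ‖dualBest F Y (out ω).ztil.1 - (out ω).z.2‖ ^ 2
        Integrable err Pr ∧ ∫ ω, err ω ∂Pr ≤ ε) ∧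
    -- oracle complexity, with an absolute constant
    (∀ ε : ℝ, 0 < ε → ε ≤ μd * (dx + dy) → ∀ s : ℕ → Ξ,
      (sfoCalls X Y g μd L σ (x₀, y₀) s gap dx dy ε : ℝ) ≤
        10 ^ 9 *
          (L * Real.sqrt (dx + dy) / Real.sqrt (μd * ε) *
              (1 + Real.log (μd * (dx + dy) / ε) + Real.posLog (gap / (μd * dx)))
            + σ ^ 2 * (dx + dy) / ε ^ 2 *
              (1 + Real.posLog (σ ^ 2 / (μd * ε))
                + Real.posLog (μd ^ 2 * Metric.diam Y ^ 2 / σ ^ 2)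
                + Real.log (μd * (dx + dy) / ε)))) ∧
    -- oracle complexity as the accuracy tends to zero
    (0 < dx + dy → ∀ s : ℕ → Ξ,
      (fun ε : ℝ => (sfoCalls X Y g μd L σ (x₀, y₀) s gap dx dy ε : ℝ)) =O[𝓝[>] 0]
        (fun ε : ℝ =>
          L * (dx + dy) / Real.sqrt (μd * ε) * Real.log (μd * (dx + dy) / ε)
            + σ ^ 2 * (dx + dy) / ε ^ 2 *
              (Real.log (σ ^ 2 / (μd * ε))
                + Real.log (μd ^ 2 * Metric.diam Y ^ 2 / σ ^ 2)))) := by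
  have hdy0 : 0 ≤ dy := by rw [hdy]; positivity
  refine ⟨fun ε hε K hK hKb T hT => ?_,
    fun ε hε hεD s => sfoCalls_le X Y g hμd hμdL hσ hdy0 hε hεD _ s,
    fun hD s => sfoCalls_isBigO X Y g hμd hμdL hσ hdy0 hD _ s⟩
  exact ⟨integrable_error hF hμd hμdL hg (two_le_of_innerBound_le hμd hμdL hσ hε hK hT)
      ⟨hx₀, hy₀⟩ hξ K,
    catalystSREG_accuracy hμd hμdL hσ hF hg hξ hlaw hindep hx₀ hy₀ hxstar hmin hgap hdx hdy hε hK
      hKb hT⟩
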